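/- **Setting (Model 1).** Let $\mathcal H_P=L^2(\mathbb R^3;\mathbb C^2)$ be the state space of a spin-$1/2$ particle $P$ and $H_P=-\tfrac12\Delta\otimes 1$. Let $\mathcal H_Q$ be a separable Hilbert space with a self-adjoint operator $H_Q$. On $\mathcal H=\mathcal H_P\otimes\mathcal H_Q=L^2(\mathbb R^3;\mathbb C^2\otimes\mathcal H_Q)$ let $H$ be a self-adjoint operator whose domain contains the algebraic tensor product $\mathcal D(H_P)\otimes\mathcal D(H_Q)$, on which $H=H_P\otimes 1+1\otimes H_Q+H_{P,Q}$. Fix a unit vector $e\in\mathbb R^3$, an angle $0<\theta_0<\pi/4$, and put $$\mathcal C_{\theta}=\{k\in\mathbb R^3: k\cdot e\ge |k|\cos\theta\},\qquad \mathcal C_{\theta;v}=\{k\in\mathcal C_\theta: |k|>v\}.$$ Let $v>0$, $\alpha>1$, $\beta>0$, let $C_1,C_2,L$ be real constants and let $(M_{kl})_{k,l\in\mathbb N}$ be real numbers. For $d>0$ consider the following assumptions. **(A1)** $\Omega=\bigcup_{n\in I}\Omega_n$, $I\subseteq\mathbb N$, is a union of open cubes of diameter at most $L$, every point of $\Omega$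 has distance at least $d$ from $\mathcal C_{2\theta_0}$, and $d_n:=\mathrm{dist}(\Omega_n,\mathcal C_{2\theta_0})\to\infty$ as $n\to\infty$ (if $I$ is infinite). There are operators $H_{P,Q_n}$ on $\mathcal H$, $n\in I$, such that $H_{P,Q}\Psi=\sum_{n\in I}H_{P,Q_n}\Psi$ for all $\Psi\in\mathcal D(H_{P,Q})\supseteq\mathcal D(H_P)\otimes\mathcal D(H_Q)$. Each $H_{P,Q_n}$ commutes with the position operator $\vec x$, that is: if $f$ is a bounded measurable function on $\mathbb R^3$ and $\Psi$, $f(\vec x)\Psi$ belong to $\mathcal D(H_{P,Q_n})$, then $H_{P,Q_n}f(\vec x)\Psi=f(\vec x)H_{P,Q_n}\Psi$. There are closable operators $N_n$ on $\mathcal H_Q$ with $\mathcal D(N_n)\supseteq\mathcal D(H_Q)$ such that, for all $n\in I$ and $\Psi\in\mathcal D(H_P)\otimes\mathcal D(H_Q)$, $$\|(H_{P,Q_n}\Psi)(x)\|\le\frac{\|(1\otimes N_n)\Psi(x)\|}{\mathrm{dist}(\Omega_n,x)^{\alpha}}\quad\text{for a.e. }x\in\Omega^c,\qquad\text{and}\qquad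 \sum_{n\in I}d_n^{\frac{1-\alpha}2}\le C_1d^{-\beta}.$$ **(A2)** $\Psi_0\in\mathcal S(\mathbb R^3;\mathbb C^2\otimes\mathcal H_Q)$, $\|\Psi_0\|_{L^2}=1$, the Fourier transform $\widehat\Psi_0(k)=(2\pi)^{-3/2}\int e^{-ik\cdot x}\Psi_0(x)\,d^3x$ vanishes outside $\mathcal C_{\theta_0;v}$, and $\sup_x|x|^k\|D^l\Psi_0(x)\|\le M_{kl}$ for all $k,l\in\mathbb N$. **(A3)** For all $t\ge0$, $n\in I$ and $s\in\{1,2\}$, $(1\otimes N_n)e^{-itH_Q}\Psi_0$ is well defined (for a.e. $x$, the vector $e^{-itH_Q}\Psi_0(x)$ lies in $\mathbb C^2\otimes\mathcal D(N_n)$) and $\|(1\otimes N_n)e^{-itH_Q}\Psi_0\|_{L^s(\mathbb R^3;\mathbb C^2\otimes\mathcal H_Q)}<C_2$. Let $\rho_P$ be the reduced density matrix of $P$ in the state $\Psi_0$, i.e. $\langle\varphi_1,\rho_P\varphi_2\rangle=\sum_j\langle\varphi_1\otimes e_j,\Psi_0\rangle\langle\Psi_0,\varphi_2\otimes e_j\rangle$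 for $\varphi_1,\varphi_2\in\mathcal H_P$ and an orthonormal basis $(e_j)$ of $\mathcal H_Q$. **Lemma.** For every $\eta>0$ there is a length $d_0>0$, depending only on $\eta$, $v$, $e$, $\theta_0$, $\alpha$, $\beta$, $C_1$, $C_2$, $L$ and $(M_{kl})$, such that the following holds for every $d>d_0$. Whenever $\mathcal H_Q,H_Q,H,H_{P,Q},\Omega,I,(\Omega_n),(H_{P,Q_n}),(N_n),\Psi_0$ are as above and satisfy (A1)–(A3), then $$\Big|\big\langle e^{-itH}\Psi_0,(O_P\otimes 1_{\mathcal H_Q})e^{-itH}\Psi_0\big\rangle-\mathrm{Tr}_{\mathcal H_P}\big(\rho_P\,e^{itH_P}O_Pe^{-itH_P}\big)\Big|\le\eta\,\|O_P\|$$ for all bounded operators $O_P$ on $\mathcal H_P$ and all $t\ge0$. In particular $d_0$ does not depend on the number of degrees of freedom of $Q$. -/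

import Mathlib

open MeasureTheory Filter Topology
open scoped InnerProductSpace ENNReal SchwartzMap FourierTransform

noncomputable section

namespace ClosedSystem

/-! ### Hilbert spaces -/

/-- Physical space. -/
abbrev R3 := EuclideanSpace ℝ (Fin 3)

/-- The Hilbert space `ℂ² ⊗ K`, realised as pairs of vectors of `K` with the `ℓ²` norm. -/
abbrev SpinTensor (K : Type*) := PiLp 2 (fun _ : Fin 2 => K)

/-- The spin space `ℂ²`. -/
abbrev Spin := SpinTensor ℂ

/-- The state space `L²(ℝ³; ℂ²)` of the particle `P`. -/
abbrev HilbertP := Lp Spin 2 (volume : Measure R3)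

/-- The state space `L²(ℝ³; ℂ² ⊗ K)` of `P ∨ Q`, where `K` is the state space of `Q`. -/
abbrev HilbertPQ (K : Type*) [NormedAddCommGroup K] := Lp (SpinTensor K) 2 (volume : Measure R3)

theorem inner_rankOne_self {E : Type*} [NormedAddCommGroup E] [InnerProductSpace ℂ E]
    (x a b : E) : ⟪a, InnerProductSpace.rankOne ℂ x x b⟫_ℂ = ⟪a, x⟫_ℂ * ⟪x, b⟫_ℂ := by
  rw [InnerProductSpace.rankOne_apply, inner_smul_right, mul_comm]

theorem hasSum_inner_rankOne {E ι : Type*} [NormedAddCommGroup E] [InnerProductSpace ℂ E]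
    {x : ι → E} (hx : Summable fun j => InnerProductSpace.rankOne ℂ (x j) (x j)) (a b : E) :
    HasSum (fun j => ⟪a, x j⟫_ℂ * ⟪x j, b⟫_ℂ)
      ⟪a, (∑' j, InnerProductSpace.rankOne ℂ (x j) (x j)) b⟫_ℂ := by
  have h0 := (hx.hasSum.mapL (ContinuousLinearMap.apply ℂ E b)).mapL (innerSL ℂ a)
  exact h0.congr_fun fun j => (inner_rankOne_self (x j) a b).symm

theorem hasSum_inner_mul_inner_of_basis {E F ι κ : Type*} [NormedAddCommGroup E]
    [InnerProductSpace ℂ E] [CompleteSpace E] [NormedAddCommGroup F] [InnerProductSpace ℂ F]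
    [CompleteSpace F] (J₁ J₂ : E →L[ℂ] F) (Ψ : F) (b : HilbertBasis ι ℂ E)
    (b' : HilbertBasis κ ℂ E) {c : ℂ} (h : HasSum (fun j => ⟪J₁ (b j), Ψ⟫_ℂ * ⟪Ψ, J₂ (b j)⟫_ℂ) c) :
    HasSum (fun j => ⟪J₁ (b' j), Ψ⟫_ℂ * ⟪Ψ, J₂ (b' j)⟫_ℂ) c := by
  have key : ∀ χ : E, ⟪J₁ χ, Ψ⟫_ℂ * ⟪Ψ, J₂ χ⟫_ℂ
      = ⟪ContinuousLinearMap.adjoint J₂ Ψ, χ⟫_ℂ * ⟪χ, ContinuousLinearMap.adjoint J₁ Ψ⟫_ℂ :=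
    fun χ => by
      rw [ContinuousLinearMap.adjoint_inner_left, ContinuousLinearMap.adjoint_inner_right, mul_comm]
  simp only [key] at h ⊢
  rw [← (b.hasSum_inner_mul_inner _ _).unique h]
  exact b'.hasSum_inner_mul_inner _ _

section Tensor

variable {K : Type*} [NormedAddCommGroup K] [InnerProductSpace ℂ K]

/-- The vector `s ⊗ χ = (s₀ χ, s₁ χ)` of `ℂ² ⊗ K`, as a continuous bilinear map. -/
def spinTmul : K →L[ℂ] Spin →L[ℂ] SpinTensor K :=
  LinearMap.mkContinuous₂
    (LinearMap.mk₂ ℂ (fun (χ : K) (s : Spin) => (WithLp.toLp 2 (fun i => s i • χ) : SpinTensor K))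
      (fun χ χ' s => by ext i; simp)
      (fun c χ s => by ext i; simp [smul_smul, mul_comm])
      (fun χ s s' => by ext i; simp [add_smul])
      (fun c χ s => by ext i; simp [mul_smul])) 1
    (fun χ s => by
      have h : ‖(WithLp.toLp 2 (fun i => s i • χ) : SpinTensor K)‖ ^ 2 = (‖s‖ * ‖χ‖) ^ 2 := by
        rw [PiLp.norm_sq_eq_of_L2, mul_pow, PiLp.norm_sq_eq_of_L2, Finset.sum_mul]
        exact Finset.sum_congr rfl fun i _ => by simp [norm_smul, mul_pow]
      have h2 := (pow_left_inj₀ (norm_nonneg _) (by positivity) two_ne_zero).1 h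
      simp only [LinearMap.mk₂_apply]
      rw [h2]; linarith [mul_comm ‖s‖ ‖χ‖])

@[simp] theorem spinTmul_apply (χ : K) (s : Spin) (i : Fin 2) : spinTmul χ s i = s i • χ := rfl

/-- `tensor χ φ` is the vector `φ ⊗ χ`, that is, the function `x ↦ φ(x) ⊗ χ`. -/
def tensor : K →L[ℂ] HilbertP →L[ℂ] HilbertPQ K := spinTmul.compLpL₂ 2 volume

theorem coeFn_tensor (χ : K) (φ : HilbertP) : tensor χ φ =ᵐ[volume] fun x => spinTmul χ (φ x) :=
  ContinuousLinearMap.coeFn_compLp _ _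

theorem inner_tensor (χ χ' : K) (φ φ' : HilbertP) :
    ⟪tensor χ φ, tensor χ' φ'⟫_ℂ = ⟪φ, φ'⟫_ℂ * ⟪χ, χ'⟫_ℂ := by
  rw [L2.inner_def, L2.inner_def, ← integral_mul_const]
  refine integral_congr_ae ?_
  filter_upwards [coeFn_tensor χ φ, coeFn_tensor χ' φ'] with x h1 h2
  rw [h1, h2]
  simp only [PiLp.inner_apply, spinTmul_apply, inner_smul_left, inner_smul_right, Finset.sum_mul]
  refine Finset.sum_congr rfl fun i _ => ?_
  simp only [RCLike.inner_apply]
  ring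

/-- Embeddings of `L²(ℝ³; ℂ²)` along an orthonormal family have orthogonal ranges. -/
theorem orthogonalFamily_tensor {ι : Type*} {e : ι → K} (he : Orthonormal ℂ e) :
    OrthogonalFamily ℂ (fun _ : ι => HilbertP)
      (fun j => (tensor (e j)).toLinearMap.isometryOfInner (fun φ φ' => by
        simp [inner_tensor, he.1 j])) := by
  intro i j hij φ φ'
  simp [inner_tensor, he.2 hij]

end Tensor

section Complete

variable {K : Type*} [NormedAddCommGroup K] [InnerProductSpace ℂ K] [CompleteSpace K]

/-- The partial inner product `Ψ ↦ ⟨χ, Ψ⟩_K ∈ L²(ℝ³; ℂ²)`, the adjoint of `φ ↦ φ ⊗ χ`. -/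
def slice (χ : K) : HilbertPQ K →L[ℂ] HilbertP := ContinuousLinearMap.adjoint (tensor χ)

theorem slice_tensor (χ χ' : K) (φ : HilbertP) :
    slice χ (tensor χ' φ) = ⟪χ, χ'⟫_ℂ • φ := by
  refine ext_inner_left ℂ fun ψ => ?_
  rw [slice, ContinuousLinearMap.adjoint_inner_right, inner_tensor, inner_smul_right, mul_comm]

theorem sum_norm_slice_sq_le {ι : Type*} {e : ι → K} (he : Orthonormal ℂ e) (Ψ : HilbertPQ K)
    (s : Finset ι) : ∑ j ∈ s, ‖slice (e j) Ψ‖ ^ 2 ≤ ‖Ψ‖ ^ 2 := by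
  set S : HilbertPQ K := ∑ j ∈ s, tensor (e j) (slice (e j) Ψ) with hS
  have h1 : ‖S‖ ^ 2 = ∑ j ∈ s, ‖slice (e j) Ψ‖ ^ 2 :=
    (orthogonalFamily_tensor he).norm_sum (fun j => slice (e j) Ψ) s
  have h2 : ⟪S, Ψ⟫_ℂ = ((∑ j ∈ s, ‖slice (e j) Ψ‖ ^ 2 : ℝ) : ℂ) := by
    rw [hS, sum_inner]
    push_cast
    refine Finset.sum_congr rfl fun j _ => ?_
    rw [← ContinuousLinearMap.adjoint_inner_right]
    exact inner_self_eq_norm_sq_to_K _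
  have h3 : ‖S‖ ^ 2 ≤ ‖S‖ * ‖Ψ‖ := by
    have := norm_inner_le_norm (𝕜 := ℂ) S Ψ
    rw [h2, ← h1, Complex.norm_real, Real.norm_of_nonneg (sq_nonneg _)] at this
    exact this
  rw [← h1]
  nlinarith [norm_nonneg S, norm_nonneg Ψ, sq_nonneg (‖S‖ - ‖Ψ‖)]

theorem summable_amplify {ι : Type*} {e : ι → K} (he : Orthonormal ℂ e)
    (O : HilbertP →L[ℂ] HilbertP) (Ψ : HilbertPQ K) :
    Summable fun j => tensor (e j) (O (slice (e j) Ψ)) := by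
  refine ((orthogonalFamily_tensor he).summable_iff_norm_sq_summable
    (fun j => O (slice (e j) Ψ))).2 ?_
  refine Summable.of_nonneg_of_le (fun _ => sq_nonneg _) (fun j => ?_)
    ((summable_of_sum_le (fun _ => sq_nonneg _) (sum_norm_slice_sq_le he Ψ)).mul_left (‖O‖ ^ 2))
  rw [← mul_pow]
  exact pow_le_pow_left₀ (norm_nonneg _) (O.le_opNorm _) 2

variable (K) in
/-- An orthonormal basis of `K`, indexed by its set of vectors. -/
def stdBasis : HilbertBasis ((exists_hilbertBasis ℂ K).choose) ℂ K :=
  (exists_hilbertBasis ℂ K).choose_spec.choose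

/-- The observable `O ⊗ 1` on `L²(ℝ³; ℂ² ⊗ K)`, given by `Ψ ↦ ∑ⱼ O⟨eⱼ, Ψ⟩ ⊗ eⱼ`. -/
def amplify (O : HilbertP →L[ℂ] HilbertP) : HilbertPQ K →L[ℂ] HilbertPQ K :=
  LinearMap.mkContinuous
    { toFun := fun Ψ => ∑' j, tensor (stdBasis K j) (O (slice (stdBasis K j) Ψ))
      map_add' := fun Ψ Φ => by
        simp only [map_add]
        exact (summable_amplify (stdBasis K).orthonormal O Ψ).tsum_add
          (summable_amplify (stdBasis K).orthonormal O Φ)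
      map_smul' := fun c Ψ => by
        simp only [map_smul, RingHom.id_apply]
        exact (summable_amplify (stdBasis K).orthonormal O Ψ).tsum_const_smul c } ‖O‖
    (fun Ψ => by
      have hs := (summable_amplify (stdBasis K).orthonormal O Ψ).hasSum
      refine le_of_tendsto hs.norm (Eventually.of_forall fun s => ?_)
      have h1 : ‖∑ j ∈ s, tensor (stdBasis K j) (O (slice (stdBasis K j) Ψ))‖ ^ 2
          = ∑ j ∈ s, ‖O (slice (stdBasis K j) Ψ)‖ ^ 2 :=
        (orthogonalFamily_tensor (stdBasis K).orthonormal).norm_sum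
          (fun j => O (slice (stdBasis K j) Ψ)) s
      refine le_of_sq_le_sq ?_ (by positivity)
      rw [h1, mul_pow]
      calc ∑ j ∈ s, ‖O (slice (stdBasis K j) Ψ)‖ ^ 2
          ≤ ∑ j ∈ s, ‖O‖ ^ 2 * ‖slice (stdBasis K j) Ψ‖ ^ 2 := by
            refine Finset.sum_le_sum fun j _ => ?_
            rw [← mul_pow]
            exact pow_le_pow_left₀ (norm_nonneg _) (O.le_opNorm _) 2
        _ ≤ ‖O‖ ^ 2 * ‖Ψ‖ ^ 2 := by
            rw [← Finset.mul_sum]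
            exact mul_le_mul_of_nonneg_left
              (sum_norm_slice_sq_le (stdBasis K).orthonormal Ψ s) (sq_nonneg _))

/-- `(O ⊗ 1)(φ ⊗ χ) = Oφ ⊗ χ`. -/
theorem amplify_tensor (O : HilbertP →L[ℂ] HilbertP) (χ : K) (φ : HilbertP) :
    amplify O (tensor χ φ) = tensor χ (O φ) := by
  have h : HasSum (fun j => tensor (stdBasis K j) (O (slice (stdBasis K j) (tensor χ φ))))
      (tensor χ (O φ)) := by
    have h0 := (((stdBasis K).hasSum_repr χ).mapL tensor).mapL
      (ContinuousLinearMap.apply ℂ (HilbertPQ K) (O φ))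
    refine h0.congr_fun ?_
    intro j
    simp [slice_tensor, HilbertBasis.repr_apply_apply]
  exact h.tsum_eq

/-- The reduced density matrix `ρ_P` of `P` in the state `Ψ`,
given by `ρ_P = ∑ⱼ |⟨eⱼ, Ψ⟩⟩⟨⟨eⱼ, Ψ⟩|`. -/
def reducedDensity (Ψ : HilbertPQ K) : HilbertP →L[ℂ] HilbertP :=
  ∑' j, InnerProductSpace.rankOne ℂ (slice (stdBasis K j) Ψ) (slice (stdBasis K j) Ψ)

theorem summable_reducedDensity (Ψ : HilbertPQ K) :
    Summable fun j => InnerProductSpace.rankOne ℂ (slice (stdBasis K j) Ψ)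
      (slice (stdBasis K j) Ψ) := by
  refine Summable.of_norm ?_
  simp only [InnerProductSpace.norm_rankOne, ← pow_two]
  exact summable_of_sum_le (fun _ => sq_nonneg _)
    (sum_norm_slice_sq_le (stdBasis K).orthonormal Ψ)

theorem inner_slice_right (χ : K) (Ψ : HilbertPQ K) (φ : HilbertP) :
    ⟪φ, slice χ Ψ⟫_ℂ = ⟪tensor χ φ, Ψ⟫_ℂ :=
  ContinuousLinearMap.adjoint_inner_right (tensor χ) φ Ψ

theorem inner_slice_left (χ : K) (Ψ : HilbertPQ K) (φ : HilbertP) :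
    ⟪slice χ Ψ, φ⟫_ℂ = ⟪Ψ, tensor χ φ⟫_ℂ :=
  ContinuousLinearMap.adjoint_inner_left (tensor χ) φ Ψ

/-- For every orthonormal basis `b` of `K`,
`⟨φ₁, ρ_P φ₂⟩ = ∑ⱼ ⟨φ₁ ⊗ bⱼ, Ψ⟩ ⟨Ψ, φ₂ ⊗ bⱼ⟩`. -/
theorem hasSum_inner_reducedDensity {ι : Type*} (b : HilbertBasis ι ℂ K) (Ψ : HilbertPQ K)
    (φ₁ φ₂ : HilbertP) :
    HasSum (fun j => ⟪tensor (b j) φ₁, Ψ⟫_ℂ * ⟪Ψ, tensor (b j) φ₂⟫_ℂ)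
      ⟪φ₁, reducedDensity Ψ φ₂⟫_ℂ := by
  have h := hasSum_inner_rankOne (summable_reducedDensity Ψ) φ₁ φ₂
  simp only [inner_slice_right, inner_slice_left] at h
  exact hasSum_inner_mul_inner_of_basis
    ((ContinuousLinearMap.apply ℂ (HilbertPQ K) φ₁) ∘L tensor)
    ((ContinuousLinearMap.apply ℂ (HilbertPQ K) φ₂) ∘L tensor) Ψ (stdBasis K) b h

end Complete

/-! ### Unbounded operators and their unitary groups -/

section Operators

variable {E : Type*} [NormedAddCommGroup E] [InnerProductSpace ℂ E]

/-- `U t = e^{-itA}`: `U` is a strongly continuous one-parameter unitary group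
whose generator (including its domain) is `A`. -/
structure IsUnitaryGroup (A : E →ₗ.[ℂ] E) (U : ℝ → E →L[ℂ] E) : Prop where
  zero : U 0 = 1
  add : ∀ s t, U (s + t) = U s * U t
  norm_map : ∀ t ψ, ‖U t ψ‖ = ‖ψ‖
  continuous : ∀ ψ, Continuous fun t => U t ψ
  generator : ∀ ψ φ, (ψ, φ) ∈ A.graph ↔ HasDerivAt (fun t : ℝ => U t ψ) (-Complex.I • φ) 0

/-- A self-adjoint operator determines its unitary group. -/
theorem IsUnitaryGroup.unique [CompleteSpace E] {A : E →ₗ.[ℂ] E} (hA : IsSelfAdjoint A)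
    {U V : ℝ → E →L[ℂ] E} (hU : IsUnitaryGroup A U) (hV : IsUnitaryGroup A V) : U = V := by
  have hsym : ∀ ψ φ ψ' φ', (ψ, φ) ∈ A.graph → (ψ', φ') ∈ A.graph →
      ⟪φ, ψ'⟫_ℂ = ⟪ψ, φ'⟫_ℂ := by
    intro ψ φ ψ' φ' h h'
    obtain ⟨x, rfl, rfl⟩ := (LinearPMap.mem_graph_iff _).1 h
    obtain ⟨y, rfl, rfl⟩ := (LinearPMap.mem_graph_iff _).1 h'
    have := LinearPMap.adjoint_isFormalAdjoint hA.dense_domain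
    rw [LinearPMap.isSelfAdjoint_def.1 hA] at this
    exact this x y
  have hder : ∀ {W : ℝ → E →L[ℂ] E}, IsUnitaryGroup A W → ∀ ψ φ, (ψ, φ) ∈ A.graph → ∀ t,
      (W t ψ, W t φ) ∈ A.graph ∧ HasDerivAt (fun s => W s ψ) (-Complex.I • W t φ) t := by
    intro W hW ψ φ h t
    have h0 := (hW.generator ψ φ).1 h
    have h1 := ((W t).restrictScalars ℝ).hasFDerivAt.comp_hasDerivAt (0 : ℝ) h0
    simp only [ContinuousLinearMap.coe_restrictScalars', map_smul] at h1
    refine ⟨(hW.generator _ _).2 ?_, ?_⟩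
    · refine h1.congr_of_eventuallyEq (Eventually.of_forall fun s => ?_)
      simp only [Function.comp]
      rw [← mul_apply_eq_comp, ← mul_apply_eq_comp, ← hW.add, ← hW.add,
        add_comm]
    · have h2 := HasDerivAt.comp_sub_const t t (by rw [sub_self]; exact h1)
      refine h2.congr_of_eventuallyEq (Eventually.of_forall fun s => ?_)
      simp only [Function.comp]
      rw [← mul_apply_eq_comp, ← hW.add]
      simp
  have hmain : ∀ ψ ∈ A.domain, ∀ t, U t ψ = V t ψ := by
    intro ψ hψ t
    have hg : (ψ, A ⟨ψ, hψ⟩) ∈ A.graph := (LinearPMap.mem_graph_iff _).2 ⟨⟨ψ, hψ⟩, rfl, rfl⟩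
    have hd : ∀ s, HasDerivAt (fun s => ⟪U s ψ, V s ψ⟫_ℂ) 0 s := by
      intro s
      obtain ⟨hu, hu'⟩ := hder hU _ _ hg s
      obtain ⟨hv, hv'⟩ := hder hV _ _ hg s
      refine (hu'.inner ℂ hv').congr_deriv ?_
      rw [inner_smul_left, inner_smul_right, hsym _ _ _ _ hu hv]
      simp
    have hc : ⟪U t ψ, V t ψ⟫_ℂ = ⟪ψ, ψ⟫_ℂ := by
      have := is_const_of_deriv_eq_zero (fun s => (hd s).differentiableAt)
        (fun s => (hd s).deriv) t 0
      simpa [hU.zero, hV.zero] using this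
    have h2 : ‖U t ψ - V t ψ‖ ^ 2 = 0 := by
      rw [@norm_sub_sq ℂ, hc, hU.norm_map, hV.norm_map, inner_self_eq_norm_sq]
      ring
    exact sub_eq_zero.1 (norm_eq_zero.1 (pow_eq_zero_iff two_ne_zero |>.1 h2))
  funext t
  refine ContinuousLinearMap.ext fun ψ => ?_
  exact congrFun (Continuous.ext_on hA.dense_domain (U t).continuous (V t).continuous
    (fun ψ hψ => hmain ψ hψ t)) ψ

end Operators

/-- The Fourier transform on `L²(ℝ³; ℂ²)` with Mathlib's normalisation `∫ e^{-2πi x·ξ} φ(x) dx`: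
the frequency variable `ξ` belongs to the momentum `k = 2πξ`. -/
def fourierP : HilbertP ≃ₗᵢ[ℂ] HilbertP := Lp.fourierTransformₗᵢ R3 Spin

/-- The kinetic energy `|k|²/2` as a function of the frequency `ξ = k/2π`. -/
def kineticEnergy (ξ : R3) : ℝ := (2 * Real.pi * ‖ξ‖) ^ 2 / 2

/-- The bounded function `e^{-it|k|²/2}` of the frequency `ξ = k/2π`, as an element of `L^∞`. -/
def freePhase (t : ℝ) : Lp ℂ ∞ (volume : Measure R3) :=
  (memLp_top_of_bound (f := fun ξ : R3 => Complex.exp ((-(t * kineticEnergy ξ) : ℝ) * Complex.I))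
    (by unfold kineticEnergy; fun_prop) 1
    (Eventually.of_forall fun ξ => by rw [Complex.norm_exp_ofReal_mul_I])).toLp

/-- `e^{-itH_P}` for `H_P = -Δ/2 ⊗ 1`: multiplication by `e^{-it|k|²/2}` in momentum space. -/
def freeEvolution (t : ℝ) : HilbertP →L[ℂ] HilbertP :=
  (fourierP.symm : HilbertP →L[ℂ] HilbertP) ∘L
    (ContinuousLinearMap.lsmul ℂ ℂ).holderL volume ∞ 2 2 (freePhase t) ∘L
    (fourierP : HilbertP →L[ℂ] HilbertP)

/-- The function `|k|²/2 f` of the frequency `ξ = k/2π`. -/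
def kinetic (f : HilbertP) (ξ : R3) : Spin := kineticEnergy ξ • f ξ

theorem kinetic_add (f g : HilbertP) : kinetic (f + g) =ᵐ[volume] kinetic f + kinetic g := by
  filter_upwards [Lp.coeFn_add f g] with ξ h
  simp only [kinetic, Pi.add_apply]
  rw [h, Pi.add_apply, smul_add]

theorem kinetic_smul (c : ℂ) (f : HilbertP) : kinetic (c • f) =ᵐ[volume] c • kinetic f := by
  filter_upwards [Lp.coeFn_smul c f] with ξ h
  simp only [kinetic, Pi.smul_apply]
  rw [h, Pi.smul_apply, smul_comm]

/-- The vectors `f` for which `|k|²/2 f` is square-integrable. -/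
def kineticDomain : Submodule ℂ HilbertP where
  carrier := {f | MemLp (kinetic f) 2 volume}
  add_mem' := fun {f g} hf hg => (memLp_congr_ae (kinetic_add f g)).2 (MemLp.add hf hg)
  zero_mem' := by
    have h := kinetic_smul 0 0
    rw [zero_smul, zero_smul] at h
    exact (memLp_congr_ae h).2 MemLp.zero
  smul_mem' := fun c f hf => (memLp_congr_ae (kinetic_smul c f)).2 (MemLp.const_smul hf c)

/-- The multiplication operator `f ↦ |k|²/2 f`. -/
def kineticOp : kineticDomain →ₗ[ℂ] HilbertP where
  toFun := fun f => MemLp.toLp (kinetic f.1) f.2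
  map_add' := fun f g => by
    have hf : MemLp (kinetic f.1) 2 volume := f.2
    have hg : MemLp (kinetic g.1) 2 volume := g.2
    exact (MemLp.toLp_congr _ (hf.add hg) (kinetic_add f.1 g.1)).trans (MemLp.toLp_add hf hg)
  map_smul' := fun c f => by
    have hf : MemLp (kinetic f.1) 2 volume := f.2
    exact (MemLp.toLp_congr _ (hf.const_smul c) (kinetic_smul c f.1)).trans
      (MemLp.toLp_const_smul c hf)

/-- `H_P = -Δ/2 ⊗ 1` on its natural domain `H²(ℝ³; ℂ²)`: multiplication by `|k|²/2` in momentum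
space, on the vectors `φ` for which the product is again square-integrable. -/
def freeHamiltonian : HilbertP →ₗ.[ℂ] HilbertP where
  domain := kineticDomain.comap fourierP.toLinearEquiv.toLinearMap
  toFun := fourierP.symm.toLinearEquiv.toLinearMap ∘ₗ kineticOp ∘ₗ
    (fourierP.toLinearEquiv.toLinearMap.restrict
      (p := kineticDomain.comap fourierP.toLinearEquiv.toLinearMap) (q := kineticDomain)
      fun _ h => h)

/-- `τ` is the trace of `B`: for every orthonormal basis `b`, the series `∑ₖ ⟨bₖ, B bₖ⟩`
converges (unconditionally) to `τ`. -/
def IsTrace (B : HilbertP →L[ℂ] HilbertP) (τ : ℂ) : Prop :=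
  ∀ (ι : Type) (b : HilbertBasis ι ℂ HilbertP), HasSum (fun k => ⟪b k, B (b k)⟫_ℂ) τ

/-! ### Geometry -/

/-- The cone `{k | k · e ≥ |k| cos θ}` with axis `e` and half-opening angle `θ`. -/
def cone (e : R3) (θ : ℝ) : Set R3 := {k | ‖k‖ * Real.cos θ ≤ ⟪k, e⟫_ℝ}

/-- The truncated cone `{k | k · e ≥ |k| cos θ, |k| > v}`. -/
def truncatedCone (e : R3) (θ v : ℝ) : Set R3 := {k | k ∈ cone e θ ∧ v < ‖k‖}

/-- The distance `inf {|x - y| : x ∈ A, y ∈ B}` between two non-empty sets. -/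
def setDist (A B : Set R3) : ℝ := sInf (Set.image2 dist A B)

/-- Open cubes in `ℝ³`, of any position, orientation and side length `ℓ > 0`. -/
def IsOpenCube (S : Set R3) : Prop :=
  ∃ (g : R3 ≃ᵢ R3) (ℓ : ℝ), 0 < ℓ ∧ S = g '' {x | ∀ i, 0 < x i ∧ x i < ℓ}

/-! ### The model -/

section Model

variable {K : Type*} [NormedAddCommGroup K] [InnerProductSpace ℂ K]

/-- The algebraic tensor product `D(H_P) ⊗ D(H_Q)`, as a subspace of `L²(ℝ³; ℂ² ⊗ K)`. -/
def algTensor (HQ : K →ₗ.[ℂ] K) : Submodule ℂ (HilbertPQ K) :=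
  Submodule.span ℂ {Ψ | ∃ φ ∈ freeHamiltonian.domain, ∃ χ ∈ HQ.domain, Ψ = tensor χ φ}

/-- `SpinLift A u w` says that `u ∈ ℂ² ⊗ K` lies in the domain of `1 ⊗ A` and `(1 ⊗ A) u = w`. -/
def SpinLift (A : K →ₗ.[ℂ] K) (u w : SpinTensor K) : Prop := ∀ i, (u i, w i) ∈ A.graph

/-- `H` is a self-adjoint Hamiltonian `H_P ⊗ 1 + 1 ⊗ H_Q + H_{P,Q}`: its domain contains
`D(H_P) ⊗ D(H_Q)`, on which it is given by this sum. -/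
structure IsHamiltonian (HQ : K →ₗ.[ℂ] K) (HPQ H : HilbertPQ K →ₗ.[ℂ] HilbertPQ K)
    [CompleteSpace K] : Prop where
  selfAdjoint : IsSelfAdjoint H
  apply_tensor : ∀ (φ : freeHamiltonian.domain) (χ : HQ.domain) (Θ : HilbertPQ K),
    (tensor (χ : K) (φ : HilbertP), Θ) ∈ HPQ.graph →
    (tensor (χ : K) (φ : HilbertP),
      tensor (χ : K) (freeHamiltonian φ) + tensor (HQ χ) (φ : HilbertP) + Θ) ∈ H.graph

/-- Location of `Q` and properties of the interaction. The set `Ω` lies at distance at least `d`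
from the cone `C` and is covered by the open cubes `cube n`, `n ∈ I`, of diameter at most `L`;
the interaction `HPQ` is the sum of the operators `HPQn n`, `n ∈ I`. -/
structure InteractionAssumption (C : Set R3) (α β C₁ L d : ℝ) (HQ : K →ₗ.[ℂ] K)
    (HPQ : HilbertPQ K →ₗ.[ℂ] HilbertPQ K) (Ω : Set R3) (I : Set ℕ) (cube : ℕ → Set R3)
    (HPQn : ℕ → HilbertPQ K →ₗ.[ℂ] HilbertPQ K) (N : ℕ → K →ₗ.[ℂ] K) : Prop where
  separated : ∀ x ∈ Ω, ∀ y ∈ C, d ≤ dist x y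
  covering : Ω = ⋃ n ∈ I, cube n
  isOpenCube : ∀ n ∈ I, IsOpenCube (cube n)
  diam_le : ∀ n ∈ I, Metric.diam (cube n) ≤ L
  dist_tendsto : Tendsto (fun n : I => setDist (cube n) C) cofinite atTop
  /-- The domain of `H_{P,Q}` contains `D(H_P) ⊗ D(H_Q)`. -/
  le_domain : algTensor HQ ≤ HPQ.domain
  /-- `H_{P,Q} Ψ = ∑ₙ H_{P,Qₙ} Ψ` for all `Ψ` in the domain of `H_{P,Q}`, as a limit of
  partial sums. -/
  strong_sum : ∀ Ψ : HPQ.domain, ∃ Φ : ℕ → HilbertPQ K,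
    (∀ n ∈ I, ((Ψ : HilbertPQ K), Φ n) ∈ (HPQn n).graph) ∧
    Tendsto (fun m => ∑ n ∈ Finset.range m, I.indicator Φ n) atTop (𝓝 (HPQ Ψ))
  /-- `H_{P,Qₙ}` commutes with the position operator, in the sense that it commutes with
  multiplication by bounded measurable functions of the position. -/
  commute_position : ∀ n ∈ I, ∀ f : R3 → ℂ, Measurable f → (∃ B, ∀ x, ‖f x‖ ≤ B) →
    ∀ Ψ Ψ' Φ Φ' : HilbertPQ K, (Ψ, Φ) ∈ (HPQn n).graph → (Ψ', Φ') ∈ (HPQn n).graph →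
    (∀ᵐ x, Ψ' x = f x • Ψ x) → ∀ᵐ x, Φ' x = f x • Φ x
  /-- The operators `Nₙ` are closable and defined on `D(H_Q)`. -/
  closable : ∀ n ∈ I, (N n).IsClosable
  domain_le : ∀ n ∈ I, HQ.domain ≤ (N n).domain
  /-- `‖(H_{P,Qₙ} Ψ)(x)‖ ≤ ‖(1 ⊗ Nₙ) Ψ(x)‖ / dist(Ωₙ, x)^α` for `x ∉ Ω` and
  `Ψ ∈ D(H_P) ⊗ D(H_Q)`. -/
  decay : ∀ n ∈ I, ∀ Ψ ∈ algTensor HQ, ∀ Φ, (Ψ, Φ) ∈ (HPQn n).graph →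
    ∀ᵐ x, x ∉ Ω → ∀ w, SpinLift (N n) (Ψ x) w →
      Metric.infDist x (cube n) ^ α * ‖Φ x‖ ≤ ‖w‖
  summable : Summable fun n : I => setDist (cube n) C ^ ((1 - α) / 2)
  tsum_le : ∑' n : I, setDist (cube n) C ^ ((1 - α) / 2) ≤ C₁ * d ^ (-β)

/-- The Fourier transform `(2π)^{-3/2} ∫ e^{-ik·x} Ψ(x) dx`. -/
def momentumTransform (Ψ : 𝓢(R3, SpinTensor K)) (k : R3) : SpinTensor K :=
  (2 * Real.pi) ^ (-(3 / 2) : ℝ) •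
    ∫ x : R3, Complex.exp (-Complex.I * (⟪k, x⟫_ℝ : ℝ)) • Ψ x

/-- Choice of the initial state: a normalised Schwartz function with momenta in the region `R`,
whose Schwartz seminorms are bounded by the numbers `M k l`. -/
structure InitialStateAssumption (R : Set R3) (M : ℕ → ℕ → ℝ)
    (Ψ₀ : 𝓢(R3, SpinTensor K)) : Prop where
  norm_eq_one : ‖Ψ₀.toLp 2 (volume : Measure R3)‖ = 1
  support_subset : Function.support (momentumTransform Ψ₀) ⊆ R
  seminorm_le : ∀ k l, SchwartzMap.seminorm ℝ k l Ψ₀ ≤ M k l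

/-- Bound on the number of particles: `(1 ⊗ Nₙ) e^{-itH_Q} Ψ₀` is well defined, and its norms in
`L¹(ℝ³; ℂ² ⊗ K)` and `L²(ℝ³; ℂ² ⊗ K)` are less than `C₂`, for all `t ≥ 0` and all `n ∈ I`. -/
def ParticleBound (C₂ : ℝ) (UQ : ℝ → K →L[ℂ] K) (I : Set ℕ) (N : ℕ → K →ₗ.[ℂ] K)
    (Ψ₀ : 𝓢(R3, SpinTensor K)) : Prop :=
  ∀ t, 0 ≤ t → ∀ n ∈ I, ∃ F : R3 → SpinTensor K,
    (∀ᵐ x, SpinLift (N n) (WithLp.toLp 2 fun i => UQ t (Ψ₀ x i)) (F x)) ∧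
    ∀ s ∈ ({1, 2} : Set ℝ≥0∞), MemLp F s (volume : Measure R3) ∧
      eLpNorm F s (volume : Measure R3) < ENNReal.ofReal C₂

end Model

end ClosedSystem

end

set_option linter.unusedSectionVars false

noncomputable section

namespace ClosedSystem

/-! ### The free evolution of Schwartz functions -/

/-! Write `V t = e^{-itH_P} ⊗ e^{-itH_Q}` (`decoupled`). The trace is the expectation of `O ⊗ 1` in
the state `V t Ψ₀`: one has `Tr(ρ_P B) = ⟨Ψ₀, (B ⊗ 1) Ψ₀⟩` (`isTrace_reducedDensity_comp`), and the
evolution of `Q` drops out (`inner_decoupled_amplify`). So it suffices that `e^{-itH} Ψ₀` and `V t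
Ψ₀` are close in norm, uniformly in `t` (`exists_norm_exact_sub_decoupled_le`).

Let `C` be the cone of half-angle `2θ₀`. Choose a smooth `0 ≤ f ≤ 1` at scale `d` that lives within
`d/2` of `C`, is `1` on a ball of radius proportional to `d`, and has derivatives of size `O(1/d)`
that vanish on `C` (`exists_isCutoff`). By Duhamel's formula, `f V s Ψ` solves the full equation up
to `[-Δ/2, f] V s Ψ + H_{P,Q} f V s Ψ`, and both terms are integrable in `s` with a small integral.

Commutator: it only sees the wave off `C`. In the Schrödinger kernel the phase `e^{i|y|²/2t}` is
replaced by `1 + i|y|²/2t`. The resulting integral is the Fourier transform of a polynomial times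
`ψ` at `x/2πt`, which vanishes off `C` together with that of `ψ`. The Taylor remainder gives
`O((1+s)⁻²)` in `L²` (`exists_freeS_eq_off_cone_l2norm_le`).

Interaction: where `f ≠ 0`, the distance to `Ωₙ` is at least `dist(Ωₙ, C)/2`. Its power `-α` is
split into `dist(Ωₙ, C)^{(1-α)/2}`, summable over `n` by (A1), and a weight in `x` of exponent
`(1+α)/2 > 1` (`rpow_mul_le_infDist_rpow`). Interpolating the dispersive bound `s^{-3/2}` with
conservation of the `L²` norm, free waves decay in this weight faster than `1/s`
(`exists_integral_weight_freeS_le`).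

Removal of the cut-off: initially `(1-f)Ψ₀` is small because `Ψ₀` is a Schwartz function. Later no
propagation estimate is needed: Duhamel and unitarity force `‖f V t Ψ‖` to stay near `‖Ψ‖`, and `f²
+ (1-f)² ≤ 1` then makes `(1-f) V t Ψ` small, which produces the square root
(`norm_exact_sub_decoupled_le`).

The Hamiltonian is only known on the algebraic tensor product, so `Ψ₀` is first approximated by
finite sums of product states that keep the bounds on `Nₙ e^{-itH_Q}` up to a factor `8`
(`exists_prodS_approx`). This combines a discretised mollification in `x` with a short time average
over `e^{-irH_Q}`; closability of `Nₙ` lets the bounds pass through both averages by duality with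
the dense domain of `Nₙ*`. The error of this approximation may grow with `t`, but it is sent to zero
with `t` and `d` fixed. -/

theorem hasTemperateGrowth_cexp_ofReal_mul_I :
    (fun r : ℝ => Complex.exp (r * Complex.I)).HasTemperateGrowth := by
  refine ⟨(Complex.ofRealCLM.contDiff.mul contDiff_const).cexp, fun n => ⟨0, 1, fun x => ?_⟩⟩
  have h : ∀ n : ℕ, iteratedDeriv n (fun r : ℝ => Complex.exp (r * Complex.I))
      = fun r : ℝ => Complex.I ^ n * Complex.exp (r * Complex.I) := by
    intro n
    induction n with
    | zero => simp
    | succ n ih =>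
      rw [iteratedDeriv_succ, ih]
      funext r
      have h1 : HasDerivAt (fun r : ℝ => Complex.exp (r * Complex.I))
          (Complex.exp (r * Complex.I) * (1 * Complex.I)) r :=
        ((Complex.ofRealCLM.hasDerivAt (x := r)).mul_const Complex.I).cexp
      rw [(h1.const_mul (Complex.I ^ n)).deriv]
      ring
  rw [norm_iteratedFDeriv_eq_norm_iteratedDeriv, h]
  simp [Complex.norm_exp_ofReal_mul_I]

/-- The function `e^{iq}` has temperate growth if the real function `q` does. -/
@[fun_prop]
theorem hasTemperateGrowth_cexp {q : R3 → ℝ} (hq : q.HasTemperateGrowth) :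
    (fun x => Complex.exp ((q x : ℝ) * Complex.I)).HasTemperateGrowth :=
  hasTemperateGrowth_cexp_ofReal_mul_I.comp hq

@[fun_prop]
theorem hasTemperateGrowth_kineticEnergy : kineticEnergy.HasTemperateGrowth := by
  have h : kineticEnergy = fun ξ : R3 => (2 * Real.pi ^ 2) * ‖ξ‖ ^ 2 := by
    funext ξ; unfold kineticEnergy; ring
  rw [h]
  fun_prop

/-- The function `e^{-it|k|²/2}` of the frequency `ξ = k/2π`. -/
def phase (t : ℝ) (ξ : R3) : ℂ := Complex.exp ((-(t * kineticEnergy ξ) : ℝ) * Complex.I)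

@[fun_prop]
theorem hasTemperateGrowth_phase (t : ℝ) : (phase t).HasTemperateGrowth := by
  unfold phase
  exact hasTemperateGrowth_cexp (by fun_prop)

theorem norm_phase (t : ℝ) (ξ : R3) : ‖phase t ξ‖ = 1 := Complex.norm_exp_ofReal_mul_I _

theorem phase_add (s t : ℝ) (ξ : R3) : phase (s + t) ξ = phase s ξ * phase t ξ := by
  rw [phase, phase, phase, ← Complex.exp_add]
  congr 1
  push_cast
  ring

/-! ### Multiplier calculus, the explicit Schrödinger kernel and the dispersive bound. -/

section Schwartz

variable {E : Type*} [NormedAddCommGroup E] [InnerProductSpace ℂ E] [CompleteSpace E]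

variable (E) in
/-- The evolution `e^{itΔ/2}` of Schwartz functions. -/
def freeS (t : ℝ) : 𝓢(R3, E) →L[ℂ] 𝓢(R3, E) := SchwartzMap.fourierMultiplierCLM E (phase t)

theorem freeS_apply (t : ℝ) (ψ : 𝓢(R3, E)) :
    freeS E t ψ = 𝓕⁻ (SchwartzMap.smulLeftCLM E (phase t) (𝓕 ψ)) := rfl

theorem fourier_freeS (t : ℝ) (ψ : 𝓢(R3, E)) :
    𝓕 (freeS E t ψ) = SchwartzMap.smulLeftCLM E (phase t) (𝓕 ψ) := by
  rw [freeS_apply, FourierTransform.fourier_fourierInv_eq]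

/-- The `L²` norm of a Schwartz function. -/
def l2norm (ψ : 𝓢(R3, E)) : ℝ := ‖ψ.toLp 2 (volume : Measure R3)‖

theorem l2norm_fourier (ψ : 𝓢(R3, E)) : l2norm (𝓕 ψ) = l2norm ψ :=
  SchwartzMap.norm_fourier_toL2_eq ψ

theorem l2norm_le_of_norm_le {F : Type*} [NormedAddCommGroup F] [InnerProductSpace ℂ F]
    [CompleteSpace F] {ψ : 𝓢(R3, E)} {φ : 𝓢(R3, F)}
    (h : ∀ x, ‖ψ x‖ ≤ ‖φ x‖) : l2norm ψ ≤ l2norm φ := by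
  refine Lp.norm_le_norm_of_ae_le ?_
  filter_upwards [ψ.coeFn_toLp 2 (volume : Measure R3), φ.coeFn_toLp 2 (volume : Measure R3)]
    with x h1 h2
  rw [h1, h2]
  exact h x

theorem l2norm_freeS (t : ℝ) (ψ : 𝓢(R3, E)) : l2norm (freeS E t ψ) = l2norm ψ := by
  rw [← l2norm_fourier, fourier_freeS, ← l2norm_fourier ψ]
  apply le_antisymm <;> refine l2norm_le_of_norm_le fun x => ?_ <;>
  simp [SchwartzMap.smulLeftCLM_apply_apply (hasTemperateGrowth_phase t), norm_smul, norm_phase]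

open LineDeriv in
theorem freeS_lineDeriv (t : ℝ) (m : R3) (ψ : 𝓢(R3, E)) :
    ∂_{m} (freeS E t ψ) = freeS E t (∂_{m} ψ) := by
  have hr : ∀ φ : 𝓢(R3, E), ∂_{m} φ = (2 * Real.pi * Complex.I) •
      SchwartzMap.fourierMultiplierCLM E (fun x : R3 => ((inner ℝ x m : ℝ) : ℂ)) φ := by
    intro φ
    rw [SchwartzMap.lineDeriv_eq_fourierMultiplierCLM]
    congr 1
    exact (SchwartzMap.fourierMultiplierCLM_ofReal (𝕜 := ℂ) (by fun_prop) φ).symm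
  rw [hr, hr, map_smul, freeS,
    SchwartzMap.fourierMultiplierCLM_fourierMultiplierCLM_apply (by fun_prop) (by fun_prop),
    SchwartzMap.fourierMultiplierCLM_fourierMultiplierCLM_apply (by fun_prop) (by fun_prop),
    mul_comm (phase t)]

theorem freeS_add (s t : ℝ) (ψ : 𝓢(R3, E)) : freeS E (s + t) ψ = freeS E s (freeS E t ψ) := by
  rw [freeS, freeS, freeS,
    SchwartzMap.fourierMultiplierCLM_fourierMultiplierCLM_apply (by fun_prop) (by fun_prop)]
  rw [show phase (s + t) = phase s * phase t from funext (phase_add s t)]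

theorem fourier_postcomp {F : Type*} [NormedAddCommGroup F] [InnerProductSpace ℂ F]
    [CompleteSpace F] (A : E →L[ℂ] F) (ψ : 𝓢(R3, E)) :
    𝓕 (ψ.postcompCLM A) = (𝓕 ψ).postcompCLM A := by
  ext ξ
  simp only [SchwartzMap.fourier_coe, SchwartzMap.postcompCLM_apply, Real.fourier_eq]
  rw [← A.integral_comp_comm]
  · simp [Circle.smul_def]
  · exact (Real.fourierIntegral_convergent_iff ξ).2 ψ.integrable

/-- The evolution acts on the position variable only, hence commutes with a fixed operator on the
values. This separates the roles of `P` and `Q` in product states. -/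
theorem freeS_postcomp {F : Type*} [NormedAddCommGroup F] [InnerProductSpace ℂ F]
    [CompleteSpace F] (A : E →L[ℂ] F) (t : ℝ) (ψ : 𝓢(R3, E)) :
    freeS F t (ψ.postcompCLM A) = (freeS E t ψ).postcompCLM A := by
  apply (FourierTransform.fourierEquiv ℂ 𝓢(R3, F)).injective
  change 𝓕 (freeS F t (ψ.postcompCLM A)) = 𝓕 ((freeS E t ψ).postcompCLM A)
  rw [fourier_freeS, fourier_postcomp, fourier_postcomp, fourier_freeS]
  ext x
  simp [SchwartzMap.smulLeftCLM_apply_apply (hasTemperateGrowth_phase t)]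

/-- The normalisation `(2πit)^{-3/2}` of the Schrödinger kernel. -/
def kernelConst (t : ℝ) : ℂ :=
  ((Real.pi : ℂ) / (2 * Real.pi ^ 2 * (t * Complex.I))) ^ ((3 / 2 : ℝ) : ℂ)

theorem norm_kernelConst {t : ℝ} (ht : 0 < t) : ‖kernelConst t‖ = (2 * Real.pi * t) ^ (-(3 / 2) : ℝ) := by
  have hpi := Real.pi_pos
  rw [kernelConst, Complex.norm_cpow_real]
  have h : ‖(Real.pi : ℂ) / (2 * Real.pi ^ 2 * (t * Complex.I))‖ = (2 * Real.pi * t)⁻¹ := by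
    simp only [norm_div, norm_mul, Complex.norm_real, Complex.norm_I, norm_pow, Real.norm_eq_abs,
      abs_of_pos hpi, abs_of_pos ht, Complex.norm_ofNat]
    field_simp
  rw [h, Real.inv_rpow (by positivity), Real.rpow_neg (by positivity)]

/-- The Fourier transform is moved from `ψ` to the Gaussian, whose transform is explicit. -/
theorem integral_gaussian_smul_fourier {b : ℂ} (hb : 0 < b.re) (ψ : 𝓢(R3, E)) (x : R3) :
    ∫ ξ : R3, Complex.exp (-b * ‖ξ‖ ^ 2 + 2 * Real.pi * Complex.I * ⟪x, ξ⟫_ℝ) • 𝓕 ψ ξ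
      = ((Real.pi : ℂ) / b) ^ ((3 / 2 : ℝ) : ℂ) •
        ∫ y : R3, Complex.exp (-Real.pi ^ 2 * ‖x - y‖ ^ 2 / b) • ψ y := by
  have hint : Integrable (fun ξ : R3 =>
      Complex.exp (-b * ‖ξ‖ ^ 2 + 2 * Real.pi * Complex.I * ⟪x, ξ⟫_ℝ)) :=
    GaussianFourier.integrable_cexp_neg_mul_sq_norm_add hb _ x
  have h : ∫ ξ : R3,
      𝓕 (fun v : R3 => Complex.exp (-b * ‖v‖ ^ 2 + 2 * Real.pi * Complex.I * ⟪x, v⟫_ℝ)) ξ • ψ ξ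
      = ∫ ξ : R3, Complex.exp (-b * ‖ξ‖ ^ 2 + 2 * Real.pi * Complex.I * ⟪x, ξ⟫_ℝ) • 𝓕 ψ ξ :=
    (VectorFourier.integral_fourierIntegral_smul_eq_flip (L := innerₗ R3)
      Real.continuous_fourierChar continuous_inner hint ψ.integrable).trans (by
        rw [flip_innerₗ]; rfl)
  rw [← h, ← integral_smul]
  refine integral_congr_ae (Eventually.of_forall fun y => ?_)
  simp only [fourier_gaussian_innerProductSpace' hb, smul_smul]
  congr 3
  simp

theorem freeS_apply_eq_integral (t : ℝ) (ψ : 𝓢(R3, E)) (x : R3) :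
    freeS E t ψ x = ∫ ξ : R3, Complex.exp (-(2 * Real.pi ^ 2 * (t * Complex.I)) * ‖ξ‖ ^ 2
      + 2 * Real.pi * Complex.I * ⟪x, ξ⟫_ℝ) • 𝓕 ψ ξ := by
  rw [freeS_apply, SchwartzMap.fourierInv_coe, Real.fourierInv_eq']
  refine integral_congr_ae (Eventually.of_forall fun ξ => ?_)
  simp only [SchwartzMap.smulLeftCLM_apply_apply (hasTemperateGrowth_phase t), smul_smul, phase,
    ← Complex.exp_add, kineticEnergy]
  congr 2
  rw [real_inner_comm]
  push_cast
  ring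

/-- Regularise `it` to `ε + it`, where the Gaussian formula applies, and let `ε ↓ 0`. Both sides
converge by dominated convergence, since the regularised exponentials have modulus at most one. -/
theorem freeS_kernel {t : ℝ} (ht : 0 < t) (ψ : 𝓢(R3, E)) (x : R3) :
    freeS E t ψ x = kernelConst t •
      ∫ y : R3, Complex.exp ((‖x - y‖ ^ 2 / (2 * t) : ℝ) * Complex.I) • ψ y := by
  set b : ℝ → ℂ := fun ε => 2 * Real.pi ^ 2 * (ε + t * Complex.I) with hb
  have hpi := Real.pi_pos
  have hpi2 : (2 * (Real.pi : ℂ) ^ 2) = ((2 * Real.pi ^ 2 : ℝ) : ℂ) := by push_cast; ring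
  have hre : ∀ ε, (b ε).re = 2 * Real.pi ^ 2 * ε := fun ε => by
    rw [hb]; simp only [hpi2, Complex.re_ofReal_mul]; simp
  have him : ∀ ε, (b ε).im = 2 * Real.pi ^ 2 * t := fun ε => by
    rw [hb]; simp only [hpi2, Complex.im_ofReal_mul]; simp
  have hb0 : ∀ ε, b ε ≠ 0 := fun ε h => by
    have := him ε
    rw [h, Complex.zero_im] at this
    have : 0 < 2 * Real.pi ^ 2 * t := by positivity
    linarith
  have hbc : Continuous b := by rw [hb]; fun_prop
  have hlim1 : Tendsto (fun ε : ℝ => ∫ ξ : R3, Complex.exp (-b ε * ‖ξ‖ ^ 2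
      + 2 * Real.pi * Complex.I * ⟪x, ξ⟫_ℝ) • 𝓕 ψ ξ) (𝓝[>] 0) (𝓝 (freeS E t ψ x)) := by
    rw [freeS_apply_eq_integral]
    refine tendsto_integral_filter_of_dominated_convergence (fun ξ => ‖𝓕 ψ ξ‖)
      (Eventually.of_forall fun ε => ?_) ?_ (𝓕 ψ).integrable.norm
      (Eventually.of_forall fun ξ => ?_)
    · exact (Continuous.smul (by fun_prop) (𝓕 ψ).continuous).aestronglyMeasurable
    · filter_upwards [self_mem_nhdsWithin] with ε hε
      refine Eventually.of_forall fun ξ => ?_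
      rw [norm_smul, Complex.norm_exp]
      refine mul_le_of_le_one_left (norm_nonneg _) (Real.exp_le_one_iff.2 ?_)
      have h1 : (-b ε * (‖ξ‖ : ℂ) ^ 2 + 2 * Real.pi * Complex.I * ⟪x, ξ⟫_ℝ).re
          = -(b ε).re * ‖ξ‖ ^ 2 := by
        have : -b ε * (‖ξ‖ : ℂ) ^ 2 + 2 * Real.pi * Complex.I * ⟪x, ξ⟫_ℝ
          = ((‖ξ‖ ^ 2 : ℝ) : ℂ) * (-b ε) + ((2 * Real.pi * ⟪x, ξ⟫_ℝ : ℝ) : ℂ) * Complex.I := by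
          push_cast; ring
        rw [this, Complex.add_re, Complex.re_ofReal_mul, Complex.re_ofReal_mul]
        simp; ring
      rw [h1, hre]
      have : (0 : ℝ) < ε := hε
      have : 0 ≤ 2 * Real.pi ^ 2 * ε * ‖ξ‖ ^ 2 := by positivity
      linarith
    · have h0 : Continuous (fun ε : ℝ => Complex.exp (-b ε * ‖ξ‖ ^ 2
        + 2 * Real.pi * Complex.I * ⟪x, ξ⟫_ℝ) • 𝓕 ψ ξ) := by fun_prop
      have h1 := (h0.tendsto 0).mono_left (nhdsWithin_le_nhds (s := Set.Ioi 0))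
      convert h1 using 2
      simp [hb]
  have hlim2 : Tendsto (fun ε : ℝ => ((Real.pi : ℂ) / b ε) ^ ((3 / 2 : ℝ) : ℂ) •
        ∫ y : R3, Complex.exp (-Real.pi ^ 2 * ‖x - y‖ ^ 2 / b ε) • ψ y) (𝓝[>] 0)
      (𝓝 (kernelConst t •
      ∫ y : R3, Complex.exp ((‖x - y‖ ^ 2 / (2 * t) : ℝ) * Complex.I) • ψ y)) := by
    refine Tendsto.smul ?_ ?_
    · have h1 : ContinuousAt (fun ε : ℝ => ((Real.pi : ℂ) / b ε) ^ ((3 / 2 : ℝ) : ℂ)) 0 := by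
        refine ContinuousAt.cpow (continuousAt_const.div hbc.continuousAt (hb0 0))
          continuousAt_const ?_
        -- The base `π / b 0` has negative imaginary part, so it avoids the branch cut of the power.
        refine Or.inr ?_
        rw [div_eq_mul_inv, Complex.im_ofReal_mul, Complex.inv_im, him]
        have := Complex.normSq_pos.2 (hb0 0)
        have : 0 < Real.pi * ((2 * Real.pi ^ 2 * t) / Complex.normSq (b 0)) := by positivity
        rw [neg_div]
        linarith
      have h2 := h1.tendsto.mono_left (nhdsWithin_le_nhds (s := Set.Ioi 0))
      convert h2 using 2
      simp [kernelConst, hb]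
    · refine tendsto_integral_filter_of_dominated_convergence (fun y => ‖ψ y‖)
        (Eventually.of_forall fun ε => ?_) ?_ ψ.integrable.norm
        (Eventually.of_forall fun y => ?_)
      · exact (Continuous.smul (by fun_prop) ψ.continuous).aestronglyMeasurable
      · filter_upwards [self_mem_nhdsWithin] with ε hε
        refine Eventually.of_forall fun y => ?_
        rw [norm_smul, Complex.norm_exp]
        refine mul_le_of_le_one_left (norm_nonneg _) (Real.exp_le_one_iff.2 ?_)
        have h1 : -(Real.pi : ℂ) ^ 2 * (‖x - y‖ : ℂ) ^ 2 / b ε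
            = ((-(Real.pi ^ 2 * ‖x - y‖ ^ 2) : ℝ) : ℂ) * (b ε)⁻¹ := by
          push_cast; ring
        rw [h1, Complex.re_ofReal_mul, Complex.inv_re, hre]
        have : (0 : ℝ) < ε := hε
        have := Complex.normSq_pos.2 (hb0 ε)
        have : 0 ≤ (Real.pi ^ 2 * ‖x - y‖ ^ 2) *
          (2 * Real.pi ^ 2 * ε / Complex.normSq (b ε)) := by positivity
        linarith
      · have h0 : ContinuousAt (fun ε : ℝ => Complex.exp (-Real.pi ^ 2 * ‖x - y‖ ^ 2 / b ε) • ψ y)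
            0 := by
          refine ContinuousAt.smul (ContinuousAt.cexp ?_) continuousAt_const
          exact continuousAt_const.div hbc.continuousAt (hb0 0)
        have h1 := h0.tendsto.mono_left (nhdsWithin_le_nhds (s := Set.Ioi 0))
        convert h1 using 4
        have hpi' : (Real.pi : ℂ) ≠ 0 := by exact_mod_cast hpi.ne'
        have ht' : (t : ℂ) ≠ 0 := by exact_mod_cast ht.ne'
        simp only [hb]
        push_cast
        field_simp
        linear_combination ((‖x - y‖ : ℂ) ^ 2 * t) * Complex.I_sq
  refine tendsto_nhds_unique hlim1 (hlim2.congr' ?_)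
  filter_upwards [self_mem_nhdsWithin] with ε hε
  refine (integral_gaussian_smul_fourier ?_ ψ x).symm
  rw [hre]
  have : (0 : ℝ) < ε := hε
  positivity

/-- The dispersive estimate. -/
theorem norm_freeS_le {t : ℝ} (ht : 0 < t) (ψ : 𝓢(R3, E)) (x : R3) :
    ‖freeS E t ψ x‖ ≤ (2 * Real.pi * t) ^ (-(3 / 2) : ℝ) * ∫ y, ‖ψ y‖ := by
  rw [freeS_kernel ht, norm_smul, norm_kernelConst ht]
  refine mul_le_mul_of_nonneg_left ((norm_integral_le_integral_norm _).trans_eq ?_) (by positivity)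
  simp only [norm_smul, Complex.norm_exp_ofReal_mul_I, one_mul]

end Schwartz

end ClosedSystem

end

noncomputable section

namespace ClosedSystem

/-! ### Decay of the free evolution off the cone of momenta -/

/-- For `x ≥ 0` the remainder vanishes at `0` and its derivative `i(e^{iy} - 1)` has norm at most
`y`; complex conjugation handles negative `x`. -/
theorem norm_cexp_sub_one_sub_le (x : ℝ) :
    ‖Complex.exp (x * Complex.I) - 1 - x * Complex.I‖ ≤ x ^ 2 / 2 := by
  have key : ∀ x : ℝ, 0 ≤ x →
      ‖Complex.exp (x * Complex.I) - 1 - x * Complex.I‖ ≤ x ^ 2 / 2 := by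
    intro x hx
    have hd : ∀ y : ℝ, HasDerivAt (fun r : ℝ => Complex.exp (r * Complex.I) - 1 - r * Complex.I)
        (Complex.exp (y * Complex.I) * (1 * Complex.I) - 1 * Complex.I) y := fun y =>
      ((((Complex.ofRealCLM.hasDerivAt (x := y)).mul_const Complex.I).cexp).sub_const 1).sub
        ((Complex.ofRealCLM.hasDerivAt (x := y)).mul_const Complex.I)
    refine image_norm_le_of_norm_deriv_right_le_deriv_boundary (a := 0) (b := x)
      (B := fun r => r ^ 2 / 2) (B' := fun r => r)
      (fun y _ => (hd y).continuousAt.continuousWithinAt)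
      (fun y _ => (hd y).hasDerivWithinAt) (by simp)
      (fun y => by simpa using ((hasDerivAt_pow 2 y).div_const 2)) (fun y hy => ?_)
      ⟨hx, le_rfl⟩
    have : Complex.exp (y * Complex.I) * (1 * Complex.I) - 1 * Complex.I
        = (Complex.exp (Complex.I * y) - 1) * Complex.I := by rw [mul_comm Complex.I]; ring
    rw [this, norm_mul, Complex.norm_I, mul_one]
    exact Real.norm_exp_I_mul_ofReal_sub_one_le.trans_eq (Real.norm_of_nonneg hy.1)
  rcases le_total 0 x with hx | hx
  · exact key x hx
  · have h := key (-x) (by linarith)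
    rw [← Complex.norm_conj] at h
    simpa [← Complex.exp_conj, sub_eq_add_neg] using h

section Cone

theorem isClosed_cone (e : R3) (θ : ℝ) : IsClosed (cone e θ) :=
  isClosed_le (by fun_prop) (by fun_prop)

theorem smul_mem_cone {e : R3} {θ : ℝ} {c : ℝ} (hc : 0 < c) {x : R3} :
    c • x ∈ cone e θ ↔ x ∈ cone e θ := by
  simp only [cone, Set.mem_ofPred_eq, norm_smul, real_inner_smul_left, Real.norm_of_nonneg hc.le,
    mul_assoc]
  exact mul_le_mul_iff_right₀ hc

end Cone

/-! ### Replacing a free wave off its momentum cone by a small one. -/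

section Decay

variable {E : Type*} [NormedAddCommGroup E] [InnerProductSpace ℂ E] [CompleteSpace E]

open LineDeriv

theorem lineDeriv_eq_zero_off {C : Set R3} (hC : IsClosed C) {φ : 𝓢(R3, E)}
    (hφ : ∀ x ∉ C, φ x = 0) (m : R3) : ∀ x ∉ C, (∂_{m} φ : 𝓢(R3, E)) x = 0 := by
  intro x hx
  rw [SchwartzMap.lineDerivOp_apply_eq_fderiv]
  have : (φ : R3 → E) =ᶠ[𝓝 x] fun _ => 0 := by
    filter_upwards [hC.isOpen_compl.mem_nhds hx] with y hy using hφ y hy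
  rw [this.fderiv_eq]
  simp

/-- Up to a nonzero constant, multiplication by a coordinate is a derivative in momentum space, and
differentiation does not enlarge the support. -/
theorem fourier_inner_smul_eq_zero_off {C : Set R3} (hC : IsClosed C) {ψ : 𝓢(R3, E)}
    (hψ : ∀ ξ ∉ C, 𝓕 ψ ξ = 0) (m : R3) :
    ∀ ξ ∉ C, 𝓕 (SchwartzMap.smulLeftCLM E (fun x : R3 => (inner ℝ x m : ℝ)) ψ) ξ = 0 := by
  intro ξ hξ
  have h := lineDeriv_eq_zero_off hC hψ m ξ hξ
  rw [SchwartzMap.lineDerivOp_fourier_eq, FourierTransform.fourier_smul, smul_apply,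
    smul_eq_zero] at h
  refine h.resolve_left ?_
  simp [Real.pi_ne_zero]

theorem fourier_lineDeriv_eq_zero_off {C : Set R3} {ψ : 𝓢(R3, E)}
    (hψ : ∀ ξ ∉ C, 𝓕 ψ ξ = 0) (m : R3) :
    ∀ ξ ∉ C, 𝓕 (∂_{m} ψ : 𝓢(R3, E)) ξ = 0 := by
  intro ξ hξ
  rw [SchwartzMap.fourier_lineDerivOp_eq, smul_apply,
    SchwartzMap.smulLeftCLM_apply_apply (by fun_prop), hψ ξ hξ]
  simp

theorem fourier_norm_sq_smul_eq_zero_off {C : Set R3} (hC : IsClosed C) {ψ : 𝓢(R3, E)}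
    (hψ : ∀ ξ ∉ C, 𝓕 ψ ξ = 0) :
    ∀ ξ ∉ C, 𝓕 (SchwartzMap.smulLeftCLM E (fun x : R3 => ‖x‖ ^ 2) ψ) ξ = 0 := by
  intro ξ hξ
  set b := EuclideanSpace.basisFun (Fin 3) ℝ
  have h : SchwartzMap.smulLeftCLM E (fun x : R3 => ‖x‖ ^ 2) ψ
      = ∑ i, SchwartzMap.smulLeftCLM E (fun x : R3 => (inner ℝ x (b i) : ℝ))
        (SchwartzMap.smulLeftCLM E (fun x : R3 => (inner ℝ x (b i) : ℝ)) ψ) := by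
    ext x
    rw [SchwartzMap.smulLeftCLM_apply_apply (by fun_prop), sum_apply]
    simp only [SchwartzMap.smulLeftCLM_apply_apply
      (Function.hasTemperateGrowth_inner_left _), smul_smul, ← Finset.sum_smul]
    rw [← b.sum_sq_inner_left]
    simp only [sq]
  rw [h]
  have : 𝓕 (∑ i, SchwartzMap.smulLeftCLM E (fun x : R3 => (inner ℝ x (b i) : ℝ))
        (SchwartzMap.smulLeftCLM E (fun x : R3 => (inner ℝ x (b i) : ℝ)) ψ))
      = ∑ i, 𝓕 (SchwartzMap.smulLeftCLM E (fun x : R3 => (inner ℝ x (b i) : ℝ))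
        (SchwartzMap.smulLeftCLM E (fun x : R3 => (inner ℝ x (b i) : ℝ)) ψ)) :=
    map_sum (FourierTransform.fourierCLM ℂ 𝓢(R3, E)) _ _
  rw [this, sum_apply]
  exact Finset.sum_eq_zero fun i _ => fourier_inner_smul_eq_zero_off hC
    (fourier_inner_smul_eq_zero_off hC hψ _) _ ξ hξ

/-- Off a closed cone containing the momenta of `ψ`, the free evolution of `ψ` agrees with that
of a small function. -/
theorem exists_freeS_eq_off_cone {C : Set R3} (hC : IsClosed C)
    (hCs : ∀ c : ℝ, 0 < c → ∀ x, c • x ∈ C → x ∈ C) {ψ : 𝓢(R3, E)}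
    (hψ : ∀ ξ ∉ C, 𝓕 ψ ξ = 0) {t : ℝ} (ht : 0 < t) :
    ∃ ψ' : 𝓢(R3, E), (∀ x ∉ C, freeS E t ψ x = freeS E t ψ' x) ∧
      ∀ y, ‖ψ' y‖ ≤ ‖y‖ ^ 4 / (8 * t ^ 2) * ‖ψ y‖ := by
  set z : R3 → ℝ := fun y => ‖y‖ ^ 2 / (2 * t) with hz
  have hzt : z.HasTemperateGrowth := by
    have : z = fun y => (2 * t)⁻¹ * ‖y‖ ^ 2 := by funext y; simp [hz, div_eq_inv_mul]
    rw [this]; fun_prop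
  -- The first-order Taylor polynomial of `e^{iz}` times `ψ`; a polynomial weight keeps the momenta
  -- inside `C`.
  set T : 𝓢(R3, E) := ψ + (Complex.I * ((2 * t)⁻¹ : ℝ)) •
    SchwartzMap.smulLeftCLM E (fun x : R3 => ‖x‖ ^ 2) ψ with hT
  have hTx : ∀ y, T y = (1 + z y * Complex.I) • ψ y := by
    intro y
    rw [hT, add_apply, smul_apply,
      SchwartzMap.smulLeftCLM_apply_apply (by fun_prop), add_smul, one_smul,
      ← Complex.coe_smul (‖y‖ ^ 2), smul_smul]
    congr 2
    simp only [hz]; push_cast; ring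
  have hFT : ∀ ξ ∉ C, 𝓕 T ξ = 0 := by
    intro ξ hξ
    rw [hT, FourierTransform.fourier_add, FourierTransform.fourier_smul, add_apply,
      smul_apply, hψ ξ hξ, fourier_norm_sq_smul_eq_zero_off hC hψ ξ hξ]
    simp
  have hg : (fun y : R3 => Complex.exp ((-z y : ℝ) * Complex.I)).HasTemperateGrowth :=
    hasTemperateGrowth_cexp hzt.neg
  -- The factor `e^{-iz}` cancels the quadratic phase in `y` of the kernel, so that the evolution of
  -- `χ` at `x` is a phase and a constant times the Fourier transform of `T` at `x/2πt`.
  set χ : 𝓢(R3, E) := SchwartzMap.smulLeftCLM E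
    (fun y : R3 => Complex.exp ((-z y : ℝ) * Complex.I)) T with hχ
  have hχx : ∀ y, χ y = Complex.exp ((-z y : ℝ) * Complex.I) • T y := fun y => by
    rw [hχ, SchwartzMap.smulLeftCLM_apply_apply hg]
  have hzero : ∀ x ∉ C, freeS E t χ x = 0 := by
    intro x hx
    have hi : ∫ y : R3, Complex.exp ((‖x - y‖ ^ 2 / (2 * t) : ℝ) * Complex.I) • χ y
        = Complex.exp ((z x : ℝ) * Complex.I) • 𝓕 T ((2 * Real.pi * t)⁻¹ • x) := by
      rw [SchwartzMap.fourier_coe, Real.fourier_eq', ← integral_smul]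
      refine integral_congr_ae (Eventually.of_forall fun y => ?_)
      simp only [hχx, smul_smul, ← Complex.exp_add]
      congr 2
      rw [real_inner_smul_right, real_inner_comm, @norm_sub_sq_real]
      simp only [hz]
      have hpi : (Real.pi : ℂ) ≠ 0 := by exact_mod_cast Real.pi_ne_zero
      have ht' : (t : ℂ) ≠ 0 := by exact_mod_cast ht.ne'
      push_cast
      field_simp
      ring
    rw [freeS_kernel ht, hi, hFT, smul_zero, smul_zero]
    exact fun h => hx (hCs _ (inv_pos.2 (by positivity)) x h)
  -- Here `ψ - χ = e^{-iz}(e^{iz} - 1 - iz)ψ`, so the pointwise bound is that of the Taylor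
  -- remainder, `z²/2`.
  refine ⟨ψ - χ, fun x hx => ?_, fun y => ?_⟩
  · rw [map_sub, sub_apply, hzero x hx, sub_zero]
  · have h1 : (ψ - χ) y = (Complex.exp ((-z y : ℝ) * Complex.I) *
        (Complex.exp ((z y : ℝ) * Complex.I) - 1 - z y * Complex.I)) • ψ y := by
      rw [sub_apply, hχx, hTx, smul_smul, sub_sub, mul_sub, sub_smul,
        ← Complex.exp_add]
      simp
    rw [h1, norm_smul, norm_mul, Complex.norm_exp_ofReal_mul_I, one_mul]
    refine mul_le_mul_of_nonneg_right ((norm_cexp_sub_one_sub_le _).trans_eq ?_) (norm_nonneg _)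
    simp only [hz]
    field_simp
    ring

/-- The `L²` norm of `(1 + |y|²)⁻¹` on `ℝ³`. -/
def bracketNorm : ℝ := (eLpNorm (fun y : R3 => (1 + ‖y‖ ^ 2)⁻¹) 2 volume).toReal

/-- The square decays like `|y|⁻⁴`, and `4` exceeds the dimension. -/
theorem memLp_bracket : MemLp (fun y : R3 => (1 + ‖y‖ ^ 2)⁻¹) 2 volume := by
  have hc : Continuous (fun y : R3 => (1 + ‖y‖ ^ 2)⁻¹) :=
    Continuous.inv₀ (by fun_prop) (fun y => by positivity)
  rw [memLp_two_iff_integrable_sq hc.aestronglyMeasurable]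
  have h := integrable_rpow_neg_one_add_norm_sq (E := R3) (μ := volume) (r := 4) (by
    simp; norm_num)
  refine h.congr (Eventually.of_forall fun y => ?_)
  simp only
  rw [show (-4 / 2 : ℝ) = -(2 : ℕ) by norm_num, Real.rpow_neg (by positivity), Real.rpow_natCast,
    inv_pow]

theorem l2norm_le_bracketNorm {ψ : 𝓢(R3, E)} {A : ℝ} (hA : 0 ≤ A)
    (h : ∀ y, (1 + ‖y‖ ^ 2) * ‖ψ y‖ ≤ A) : l2norm ψ ≤ A * bracketNorm := by
  have h2 : ∀ y : R3, ‖ψ y‖ ≤ A * ‖(1 + ‖y‖ ^ 2)⁻¹‖ := fun y => by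
    have hy : (0 : ℝ) < 1 + ‖y‖ ^ 2 := by positivity
    rw [norm_inv, Real.norm_of_nonneg hy.le, ← div_eq_mul_inv, le_div_iff₀ hy, mul_comm]
    exact h y
  have h1 := eLpNorm_le_mul_eLpNorm_of_ae_le_mul (μ := (volume : Measure R3))
    (Eventually.of_forall h2) 2
  rw [l2norm, SchwartzMap.norm_toLp, bracketNorm]
  refine (ENNReal.toReal_mono ?_ h1).trans_eq ?_
  · exact ENNReal.mul_ne_top ENNReal.ofReal_ne_top memLp_bracket.2.ne
  · rw [ENNReal.toReal_mul, ENNReal.toReal_ofReal hA]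

/-- For `t ≥ 1` the factor `|y|⁴/8t²` of the Taylor remainder gives `t⁻²`; for `t < 1` the function
`ψ` itself serves. The constant `4` comes from `(1 + t)² ≤ 4 max(1, t²)`. -/
theorem exists_freeS_eq_off_cone_l2norm_le {C : Set R3} (hC : IsClosed C)
    (hCs : ∀ c : ℝ, 0 < c → ∀ x, c • x ∈ C → x ∈ C) {ψ : 𝓢(R3, E)}
    (hψ : ∀ ξ ∉ C, 𝓕 ψ ξ = 0) {A : ℝ} (hA0 : ∀ y, (1 + ‖y‖ ^ 2) * ‖ψ y‖ ≤ A)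
    (hA4 : ∀ y, (1 + ‖y‖ ^ 2) * (‖y‖ ^ 4 * ‖ψ y‖) ≤ A) {t : ℝ} (ht : 0 ≤ t) :
    ∃ ψ' : 𝓢(R3, E), (∀ x ∉ C, freeS E t ψ x = freeS E t ψ' x) ∧
      l2norm ψ' ≤ 4 * A * bracketNorm * (1 + t) ^ (-2 : ℝ) := by
  have hA : 0 ≤ A := (by positivity : (0 : ℝ) ≤ (1 + ‖(0 : R3)‖ ^ 2) * ‖ψ 0‖).trans (hA0 0)
  have hb : 0 ≤ bracketNorm := ENNReal.toReal_nonneg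
  have hrp : (1 + t) ^ (-2 : ℝ) = ((1 + t) ^ 2)⁻¹ := by
    rw [Real.rpow_neg (by positivity)]; norm_num
  rcases lt_or_ge t 1 with h | h
  · refine ⟨ψ, fun _ _ => rfl, (l2norm_le_bracketNorm hA hA0).trans ?_⟩
    rw [hrp, ← div_eq_mul_inv, le_div_iff₀ (by positivity)]
    have : (1 + t) ^ 2 ≤ 4 := by nlinarith
    nlinarith [mul_nonneg hA hb]
  · obtain ⟨ψ', h1, h2⟩ := exists_freeS_eq_off_cone hC hCs hψ (by linarith : 0 < t)
    refine ⟨ψ', h1, (l2norm_le_bracketNorm (A := A * (t ^ 2)⁻¹) (by positivity) fun y => ?_).trans ?_⟩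
    · refine (mul_le_mul_of_nonneg_left (h2 y) (by positivity)).trans ?_
      have h3 := hA4 y
      have ht2 : 0 < t ^ 2 := by positivity
      calc (1 + ‖y‖ ^ 2) * (‖y‖ ^ 4 / (8 * t ^ 2) * ‖ψ y‖)
          = (1 + ‖y‖ ^ 2) * (‖y‖ ^ 4 * ‖ψ y‖) * (8⁻¹ * (t ^ 2)⁻¹) := by field_simp
        _ ≤ A * (8⁻¹ * (t ^ 2)⁻¹) := mul_le_mul_of_nonneg_right h3 (by positivity)
        _ ≤ A * (t ^ 2)⁻¹ := by
            refine mul_le_mul_of_nonneg_left ?_ hA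
            have : 0 < (t ^ 2)⁻¹ := by positivity
            linarith
    · rw [hrp]
      have : (t ^ 2)⁻¹ ≤ 4 * ((1 + t) ^ 2)⁻¹ := by
        rw [← div_eq_mul_inv, inv_le_comm₀ (by positivity) (by positivity), inv_div,
          div_le_iff₀ (by norm_num)]
        nlinarith
      nlinarith [mul_nonneg hA hb]

end Decay

end ClosedSystem

end

noncomputable section

namespace ClosedSystem

/-! ### The free evolution on `L²` -/

/-! ### Differentiability in time, in the `L²` norm, of the evolution of Schwartz functions. -/

section L2

variable {E : Type*} [NormedAddCommGroup E] [InnerProductSpace ℂ E] [CompleteSpace E]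

variable (E) in
/-- The embedding of Schwartz functions into `L²`. -/
abbrev toL2 : 𝓢(R3, E) →L[ℂ] Lp E 2 (volume : Measure R3) := SchwartzMap.toLpCLM ℂ E 2 volume

theorem norm_toL2 (ψ : 𝓢(R3, E)) : ‖toL2 E ψ‖ = l2norm ψ := rfl

theorem coeFn_toL2 (ψ : 𝓢(R3, E)) : toL2 E ψ =ᵐ[volume] ψ := ψ.coeFn_toLp 2 volume

theorem denseRange_toL2 : DenseRange (toL2 E) :=
  SchwartzMap.denseRange_toLpCLM (F := E) (μ := (volume : Measure R3)) ENNReal.ofNat_ne_top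

theorem l2norm_nonneg (ψ : 𝓢(R3, E)) : 0 ≤ l2norm ψ := norm_nonneg _

theorem l2norm_add_le (ψ φ : 𝓢(R3, E)) : l2norm (ψ + φ) ≤ l2norm ψ + l2norm φ := by
  rw [← norm_toL2, map_add]
  exact norm_add_le _ _

theorem l2norm_smul (c : ℂ) (ψ : 𝓢(R3, E)) : l2norm (c • ψ) = ‖c‖ * l2norm ψ := by
  rw [← norm_toL2, map_smul, norm_smul, norm_toL2]

theorem l2norm_sum_le {ι : Type*} (s : Finset ι) (ψ : ι → 𝓢(R3, E)) :
    l2norm (∑ i ∈ s, ψ i) ≤ ∑ i ∈ s, l2norm (ψ i) := by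
  rw [← norm_toL2, map_sum]
  exact norm_sum_le _ _

variable (E) in
/-- The operator `-Δ/2` on Schwartz functions. -/
def kinS : 𝓢(R3, E) →L[ℂ] 𝓢(R3, E) :=
  SchwartzMap.fourierMultiplierCLM E (fun ξ : R3 => (kineticEnergy ξ : ℂ))

theorem fourier_kinS (ψ : 𝓢(R3, E)) :
    𝓕 (kinS E ψ) = SchwartzMap.smulLeftCLM E (fun ξ : R3 => (kineticEnergy ξ : ℂ)) (𝓕 ψ) := by
  rw [kinS, SchwartzMap.fourierMultiplierCLM_apply, FourierTransform.fourier_fourierInv_eq]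

open Laplacian in
theorem kinS_eq_laplacian (ψ : 𝓢(R3, E)) : kinS E ψ = (-(1 / 2) : ℝ) • Δ ψ := by
  rw [SchwartzMap.laplacian_eq_fourierMultiplierCLM, smul_smul, kinS]
  have h1 := SchwartzMap.fourierMultiplierCLM_ofReal (F := E) (E := R3) (𝕜 := ℂ)
    hasTemperateGrowth_kineticEnergy ψ
  have h2 : kineticEnergy = (2 * Real.pi ^ 2) • (fun ξ : R3 => ‖ξ‖ ^ 2) := by
    funext ξ; simp only [kineticEnergy, Pi.smul_apply, smul_eq_mul]; ring
  refine h1.trans ?_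
  rw [h2, SchwartzMap.fourierMultiplierCLM_smul (by fun_prop), smul_apply]
  congr 1
  ring

theorem kinS_freeS (t : ℝ) (ψ : 𝓢(R3, E)) : kinS E (freeS E t ψ) = freeS E t (kinS E ψ) := by
  rw [kinS, freeS,
    SchwartzMap.fourierMultiplierCLM_fourierMultiplierCLM_apply (by fun_prop) (by fun_prop),
    SchwartzMap.fourierMultiplierCLM_fourierMultiplierCLM_apply (by fun_prop) (by fun_prop),
    mul_comm]

/-- By Plancherel this is the second-order Taylor remainder of `e^{-ihE}` in momentum space; the
factor `E²` becomes the kinetic operator applied twice. -/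
theorem l2norm_freeS_sub_le (t h : ℝ) (ψ : 𝓢(R3, E)) :
    l2norm (freeS E (t + h) ψ - freeS E t ψ - (-(h * Complex.I)) • freeS E t (kinS E ψ))
      ≤ h ^ 2 / 2 * l2norm (kinS E (kinS E ψ)) := by
  have e1 : h ^ 2 / 2 * l2norm (kinS E (kinS E ψ))
      = l2norm (((h ^ 2 / 2 : ℝ) : ℂ) • 𝓕 (kinS E (kinS E ψ))) := by
    rw [l2norm_smul, l2norm_fourier, Complex.norm_real, Real.norm_of_nonneg (by positivity)]
  rw [e1, ← l2norm_fourier]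
  refine l2norm_le_of_norm_le fun ξ => ?_
  have hF : 𝓕 (freeS E (t + h) ψ - freeS E t ψ - (-(h * Complex.I)) • freeS E t (kinS E ψ))
      = 𝓕 (freeS E (t + h) ψ) - 𝓕 (freeS E t ψ) - (-(h * Complex.I)) • 𝓕 (freeS E t (kinS E ψ)) := by
    have h0 := map_sub (FourierTransform.fourierCLM ℂ 𝓢(R3, E))
      (freeS E (t + h) ψ - freeS E t ψ) ((-(h * Complex.I)) • freeS E t (kinS E ψ))
    have h1 := map_sub (FourierTransform.fourierCLM ℂ 𝓢(R3, E)) (freeS E (t + h) ψ) (freeS E t ψ)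
    have h2 := map_smul (FourierTransform.fourierCLM ℂ 𝓢(R3, E)) (-(h * Complex.I))
      (freeS E t (kinS E ψ))
    rw [h1, h2] at h0
    exact h0
  rw [hF]
  simp only [fourier_freeS, fourier_kinS, sub_apply, smul_apply,
    SchwartzMap.smulLeftCLM_apply_apply (hasTemperateGrowth_phase _),
    SchwartzMap.smulLeftCLM_apply_apply (show (fun ξ : R3 => (kineticEnergy ξ : ℂ)).HasTemperateGrowth
      by fun_prop), smul_smul, ← sub_smul, norm_smul]
  have h1 : phase (t + h) ξ - phase t ξ - -(h * Complex.I) * (phase t ξ * (kineticEnergy ξ : ℂ))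
      = phase t ξ * (Complex.exp ((-(h * kineticEnergy ξ) : ℝ) * Complex.I) - 1
        - (-(h * kineticEnergy ξ) : ℝ) * Complex.I) := by
    rw [phase_add]
    simp only [phase]
    push_cast
    ring
  rw [h1, norm_mul, norm_phase, one_mul]
  refine mul_le_mul_of_nonneg_right ((norm_cexp_sub_one_sub_le _).trans_eq ?_) (norm_nonneg _)
  simp only [norm_mul, Complex.norm_real, Real.norm_eq_abs]
  rw [abs_of_nonneg (by positivity : 0 ≤ h ^ 2 / 2), abs_mul_abs_self]
  ring

theorem hasDerivAt_of_norm_sub_le {F : Type*} [NormedAddCommGroup F] [NormedSpace ℂ F]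
    {u : ℝ → F} {u' : F} {t C : ℝ}
    (h : ∀ r : ℝ, ‖u (t + r) - u t - (r : ℂ) • u'‖ ≤ C * r ^ 2) : HasDerivAt u u' t := by
  rw [hasDerivAt_iff_isLittleO_nhds_zero]
  have h1 : (fun r : ℝ => u (t + r) - u t - r • u') =O[𝓝 0] fun r : ℝ => r ^ 2 := by
    refine Asymptotics.IsBigO.of_bound C (Eventually.of_forall fun r => ?_)
    rw [← Complex.coe_smul r, Real.norm_of_nonneg (by positivity)]
    exact h r
  exact h1.trans_isLittleO (by simpa using Asymptotics.isLittleO_pow_id (𝕜 := ℝ) one_lt_two)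

end L2

/-! ### Agreement of the Schwartz and `L²` evolutions, and unitarity by density. -/

theorem coeFn_freePhase (t : ℝ) : freePhase t =ᵐ[volume] phase t := MemLp.coeFn_toLp _

theorem fourierP_toL2 (φ : 𝓢(R3, Spin)) : fourierP (toL2 Spin φ) = toL2 Spin (𝓕 φ) :=
  SchwartzMap.toLp_fourier_eq φ

theorem fourierP_symm_toL2 (φ : 𝓢(R3, Spin)) : fourierP.symm (toL2 Spin (𝓕 φ)) = toL2 Spin φ := by
  rw [← fourierP_toL2, LinearIsometryEquiv.symm_apply_apply]

theorem freeEvolution_toL2 (t : ℝ) (φ : 𝓢(R3, Spin)) :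
    freeEvolution t (toL2 Spin φ) = toL2 Spin (freeS Spin t φ) := by
  rw [← fourierP_symm_toL2 (freeS Spin t φ)]
  change fourierP.symm ((ContinuousLinearMap.lsmul ℂ ℂ).holderL volume ∞ 2 2 (freePhase t)
    (fourierP (toL2 Spin φ))) = _
  congr 1
  rw [fourierP_toL2, fourier_freeS]
  refine Lp.ext ?_
  filter_upwards [(ContinuousLinearMap.lsmul ℂ ℂ).coeFn_holder (r := 2) (freePhase t)
    (toL2 Spin (𝓕 φ)), coeFn_freePhase t, coeFn_toL2 (𝓕 φ),
    coeFn_toL2 (SchwartzMap.smulLeftCLM Spin (phase t) (𝓕 φ))] with x h1 h2 h3 h4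
  refine h1.trans ?_
  rw [h2, h3, h4, SchwartzMap.smulLeftCLM_apply_apply (hasTemperateGrowth_phase t)]
  rfl

theorem norm_freeEvolution (t : ℝ) (φ : HilbertP) : ‖freeEvolution t φ‖ = ‖φ‖ := by
  refine congrFun (DenseRange.equalizer (f := toL2 Spin) (g := fun φ => ‖freeEvolution t φ‖)
    (h := fun φ => ‖φ‖) denseRange_toL2 (by fun_prop) (by fun_prop) ?_) φ
  funext ψ
  simp only [Function.comp]
  rw [freeEvolution_toL2, norm_toL2, norm_toL2, l2norm_freeS]

theorem freeEvolution_add (s t : ℝ) :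
    freeEvolution (s + t) = freeEvolution s ∘L freeEvolution t := by
  refine DFunLike.coe_injective (denseRange_toL2.equalizer (by fun_prop) (by fun_prop) ?_)
  funext ψ
  simp only [Function.comp, ContinuousLinearMap.comp_apply, freeEvolution_toL2, freeS_add]

theorem freeEvolution_zero : freeEvolution 0 = ContinuousLinearMap.id ℂ HilbertP := by
  refine DFunLike.coe_injective (denseRange_toL2.equalizer (by fun_prop) (by fun_prop) ?_)
  funext ψ
  have : phase 0 = fun _ => 1 := by funext ξ; simp [phase]
  simp only [Function.comp, freeEvolution_toL2, freeS, this]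
  simp

theorem adjoint_freeEvolution (t : ℝ) :
    ContinuousLinearMap.adjoint (freeEvolution t) = freeEvolution (-t) := by
  have h1 : ∀ φ φ', ⟪freeEvolution t φ, freeEvolution t φ'⟫_ℂ = ⟪φ, φ'⟫_ℂ :=
    (LinearMap.norm_map_iff_inner_map_map (freeEvolution t)).1 (norm_freeEvolution t)
  have h2 : ∀ φ, freeEvolution t (freeEvolution (-t) φ) = φ := fun φ => by
    rw [← ContinuousLinearMap.comp_apply, ← freeEvolution_add, add_neg_cancel, freeEvolution_zero]
    rfl
  refine ContinuousLinearMap.ext fun φ => ext_inner_right ℂ fun φ' => ?_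
  rw [ContinuousLinearMap.adjoint_inner_left, ← h1 (freeEvolution (-t) φ), h2]

theorem mem_graph_freeHamiltonian (φ : 𝓢(R3, Spin)) :
    (toL2 Spin φ, toL2 Spin (kinS Spin φ)) ∈ freeHamiltonian.graph := by
  have hk : kinetic (toL2 Spin (𝓕 φ)) =ᵐ[volume] (𝓕 (kinS Spin φ) : 𝓢(R3, Spin)) := by
    filter_upwards [coeFn_toL2 (𝓕 φ)] with ξ h
    rw [kinetic, h, fourier_kinS, SchwartzMap.smulLeftCLM_apply_apply (by fun_prop)]
    simp
  have hd : MemLp (kinetic (toL2 Spin (𝓕 φ))) 2 volume :=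
    (memLp_congr_ae hk).2 ((𝓕 (kinS Spin φ)).memLp 2 volume)
  have hdom : toL2 Spin φ ∈ freeHamiltonian.domain := by
    change fourierP (toL2 Spin φ) ∈ kineticDomain
    rw [fourierP_toL2]
    exact hd
  refine (LinearPMap.mem_graph_iff _).2 ⟨⟨toL2 Spin φ, hdom⟩, rfl, ?_⟩
  have hd' : MemLp (kinetic (fourierP (toL2 Spin φ))) 2 volume := hdom
  change fourierP.symm (hd'.toLp (kinetic (fourierP (toL2 Spin φ)))) = toL2 Spin (kinS Spin φ)
  rw [← fourierP_symm_toL2 (kinS Spin φ)]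
  congr 1
  refine Lp.ext ?_
  filter_upwards [hd'.coeFn_toLp, hk, coeFn_toL2 (𝓕 (kinS Spin φ))] with x h1 h2 h3
  rw [h1, h3, fourierP_toL2, h2]

end ClosedSystem

end

noncomputable section

namespace ClosedSystem

/-! ### Smooth cut-offs to a neighbourhood of a cone -/

open LineDeriv

/-! ### The commutator of the kinetic energy with a cut-off. -/

section Commutator

variable {E : Type*} [NormedAddCommGroup E] [InnerProductSpace ℂ E] [CompleteSpace E]

variable (E) in
/-- Multiplication of Schwartz functions by a real function of temperate growth. -/
abbrev mulS (f : R3 → ℝ) : 𝓢(R3, E) →L[ℝ] 𝓢(R3, E) := SchwartzMap.smulLeftCLM E f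

theorem mulS_apply {f : R3 → ℝ} (hf : f.HasTemperateGrowth) (ψ : 𝓢(R3, E)) (x : R3) :
    mulS E f ψ x = f x • ψ x := SchwartzMap.smulLeftCLM_apply_apply hf ψ x

theorem lineDeriv_mulS {f f₁ : R3 → ℝ} (hf : f.HasTemperateGrowth) (hf₁ : f₁.HasTemperateGrowth)
    {m : R3} (h : ∀ x, HasDerivAt (fun s : ℝ => f (x + s • m)) (f₁ x) 0) (ψ : 𝓢(R3, E)) :
    ∂_{m} (mulS E f ψ) = mulS E f (∂_{m} ψ) + mulS E f₁ ψ := by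
  ext x
  rw [add_apply, mulS_apply hf, mulS_apply hf₁, SchwartzMap.lineDerivOp_apply,
    SchwartzMap.lineDerivOp_apply_eq_fderiv]
  have h1 : HasDerivAt (fun s : ℝ => ψ (x + s • m)) (fderiv ℝ ψ x m) 0 :=
    (ψ.hasFDerivAt x).hasLineDerivAt m
  have h2 := (h x).smul h1
  simp only [zero_smul, add_zero] at h2
  rw [lineDeriv, ← h2.deriv]
  congr 1
  funext s
  exact mulS_apply hf ψ _

theorem l2norm_mulS_le {f : R3 → ℝ} (hf : f.HasTemperateGrowth) {b : ℝ}
    (hb : ∀ x, |f x| ≤ b) (ψ : 𝓢(R3, E)) : l2norm (mulS E f ψ) ≤ b * l2norm ψ := by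
  have hb0 : 0 ≤ b := (abs_nonneg _).trans (hb 0)
  have h : l2norm ((b : ℂ) • ψ) = b * l2norm ψ := by
    rw [l2norm_smul, Complex.norm_real, Real.norm_of_nonneg hb0]
  rw [← h]
  refine l2norm_le_of_norm_le fun x => ?_
  rw [mulS_apply hf, smul_apply, norm_smul, norm_smul, Complex.norm_real, Real.norm_of_nonneg hb0]
  exact mul_le_mul_of_nonneg_right (hb x) (norm_nonneg _)

/-- The coordinate directions of `ℝ³`. -/
def coordVec (i : Fin 3) : R3 := EuclideanSpace.basisFun (Fin 3) ℝ i

theorem norm_coordVec (i : Fin 3) : ‖coordVec i‖ = 1 :=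
  (EuclideanSpace.basisFun (Fin 3) ℝ).orthonormal.1 i

/-- The function `f` is a smooth cut-off at scale `d` to a neighbourhood of the set `C`; the
functions `f₁ i`, `f₂ i` are its first and second partial derivatives. -/
structure IsCutoff (C : Set R3) (b ε d : ℝ) (f : R3 → ℝ) (f₁ f₂ : Fin 3 → R3 → ℝ) : Prop where
  growth : f.HasTemperateGrowth
  growth₁ : ∀ i, (f₁ i).HasTemperateGrowth
  growth₂ : ∀ i, (f₂ i).HasTemperateGrowth
  nonneg : ∀ x, 0 ≤ f x
  le_one : ∀ x, f x ≤ 1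
  eq_one : ∀ x, ‖x‖ ≤ ε * d → f x = 1
  near : ∀ x, f x ≠ 0 → ∃ c ∈ C, dist x c ≤ d / 2
  deriv₁ : ∀ i x, HasDerivAt (fun s : ℝ => f (x + s • coordVec i)) (f₁ i x) 0
  deriv₂ : ∀ i x, HasDerivAt (fun s : ℝ => f₁ i (x + s • coordVec i)) (f₂ i x) 0
  bound₁ : ∀ i x, |f₁ i x| ≤ b / d
  bound₂ : ∀ i x, |f₂ i x| ≤ b / d
  zero₁ : ∀ i, ∀ x ∈ C, f₁ i x = 0
  zero₂ : ∀ i, ∀ x ∈ C, f₂ i x = 0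

variable (E) in
/-- The commutator `[-Δ/2, f]`. -/
def commS (f₁ f₂ : Fin 3 → R3 → ℝ) (ψ : 𝓢(R3, E)) : 𝓢(R3, E) :=
  (-(1 / 2) : ℝ) • ∑ i, ((2 : ℝ) • mulS E (f₁ i) (∂_{coordVec i} ψ) + mulS E (f₂ i) ψ)

open Laplacian in
theorem kinS_mulS {C : Set R3} {b ε d : ℝ} {f : R3 → ℝ} {f₁ f₂ : Fin 3 → R3 → ℝ}
    (h : IsCutoff C b ε d f f₁ f₂) (ψ : 𝓢(R3, E)) :
    kinS E (mulS E f ψ) = mulS E f (kinS E ψ) + commS E f₁ f₂ ψ := by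
  rw [kinS_eq_laplacian, kinS_eq_laplacian, map_smul, commS, ← smul_add]
  congr 1
  rw [SchwartzMap.laplacian_eq_sum (EuclideanSpace.basisFun (Fin 3) ℝ),
    SchwartzMap.laplacian_eq_sum (EuclideanSpace.basisFun (Fin 3) ℝ), map_sum,
    ← Finset.sum_add_distrib]
  refine Finset.sum_congr rfl fun i _ => ?_
  change ∂_{coordVec i} (∂_{coordVec i} (mulS E f ψ)) = mulS E f (∂_{coordVec i} (∂_{coordVec i} ψ))
    + _
  rw [lineDeriv_mulS h.growth (h.growth₁ i) (h.deriv₁ i), lineDerivOp_add,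
    lineDeriv_mulS h.growth (h.growth₁ i) (h.deriv₁ i),
    lineDeriv_mulS (h.growth₁ i) (h.growth₂ i) (h.deriv₂ i), two_smul]
  abel

theorem commS_sub (f₁ f₂ : Fin 3 → R3 → ℝ) (ψ φ : 𝓢(R3, E)) :
    commS E f₁ f₂ (ψ - φ) = commS E f₁ f₂ ψ - commS E f₁ f₂ φ := by
  have hd : ∀ m : R3, (∂_{m} (ψ - φ) : 𝓢(R3, E)) = ∂_{m} ψ - ∂_{m} φ := fun m =>
    map_sub (lineDerivOpCLM ℝ 𝓢(R3, E) m) ψ φ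
  simp only [commS, hd, map_sub, smul_sub, Finset.smul_sum, smul_add, ← Finset.sum_sub_distrib]
  refine Finset.sum_congr rfl fun i _ => ?_
  abel

/-- Every term carries a derivative of the cut-off, which vanishes on `C`. Hence `ψ` and its
derivatives may be replaced by anything that agrees with them off `C`; this is where the small
substitutes for the free wave enter. -/
theorem l2norm_commS_le {C : Set R3} {b ε d : ℝ} {f : R3 → ℝ} {f₁ f₂ : Fin 3 → R3 → ℝ}
    (h : IsCutoff C b ε d f f₁ f₂) {ψ χ : 𝓢(R3, E)} {χ₁ : Fin 3 → 𝓢(R3, E)}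
    (h0 : ∀ x ∉ C, ψ x = χ x) (h1 : ∀ i, ∀ x ∉ C, (∂_{coordVec i} ψ : 𝓢(R3, E)) x = χ₁ i x) :
    l2norm (commS E f₁ f₂ ψ) ≤ b / d * ∑ i, (l2norm (χ₁ i) + l2norm χ) := by
  have he : commS E f₁ f₂ ψ
      = ((-(1 / 2) : ℝ) : ℂ) • ∑ i, (((2 : ℝ) : ℂ) • mulS E (f₁ i) (χ₁ i) + mulS E (f₂ i) χ) := by
    ext x
    simp only [commS, smul_apply, sum_apply, add_apply, mulS_apply (h.growth₁ _),
      mulS_apply (h.growth₂ _), Complex.coe_smul]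
    congr 1
    refine Finset.sum_congr rfl fun i _ => ?_
    by_cases hx : x ∈ C
    · simp [h.zero₁ i x hx, h.zero₂ i x hx]
    · rw [h0 x hx, h1 i x hx]
  rw [he, l2norm_smul, Finset.mul_sum, Complex.norm_real]
  calc ‖(-(1 / 2) : ℝ)‖ * l2norm (∑ i, (((2 : ℝ) : ℂ) • mulS E (f₁ i) (χ₁ i) + mulS E (f₂ i) χ))
      ≤ (1 / 2) * ∑ i, (2 * (b / d * l2norm (χ₁ i)) + b / d * l2norm χ) := by
        rw [norm_neg, Real.norm_of_nonneg (by norm_num)]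
        refine mul_le_mul_of_nonneg_left ((l2norm_sum_le _ _).trans ?_) (by norm_num)
        refine Finset.sum_le_sum fun i _ => (l2norm_add_le _ _).trans (add_le_add ?_ ?_)
        · rw [l2norm_smul, Complex.norm_real, Real.norm_of_nonneg (by norm_num)]
          exact mul_le_mul_of_nonneg_left (l2norm_mulS_le (h.growth₁ i) (h.bound₁ i) _)
            (by norm_num)
        · exact l2norm_mulS_le (h.growth₂ i) (h.bound₂ i) _
    _ ≤ ∑ i, b / d * (l2norm (χ₁ i) + l2norm χ) := by
        rw [Finset.mul_sum]
        refine Finset.sum_le_sum fun i _ => ?_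
        have hb : 0 ≤ b / d := (abs_nonneg _).trans (h.bound₁ i 0)
        nlinarith [mul_nonneg hb (l2norm_nonneg χ)]

end Commutator

/-! ### Existence of cut-offs with uniform constants. -/

section Construction

theorem hasTemperateGrowth_of_deriv_hasCompactSupport {h : ℝ → ℝ} (hh : ContDiff ℝ (⊤ : ℕ∞) h)
    (hc : HasCompactSupport (deriv h)) {B : ℝ} (hB : ∀ x, |h x| ≤ B) : h.HasTemperateGrowth := by
  refine Function.HasTemperateGrowth.of_fderiv (k := 0) (C := B) ?_
    (hh.differentiable (by simp)) fun x => by simpa using hB x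
  refine HasCompactSupport.hasTemperateGrowth ?_ (hh.fderiv_right (by simp))
  refine hc.of_isClosed_subset (isClosed_tsupport _) (closure_mono ?_)
  intro x hx h0
  refine hx ?_
  ext
  simpa using h0

/-- The profile of the cut-off: a smooth function that equals `0` on `(-∞, -4]` and `1` on
`[-3, ∞)`. -/
def profile (s : ℝ) : ℝ := Real.smoothTransition (s + 4)

theorem contDiff_profile : ContDiff ℝ (⊤ : ℕ∞) profile :=
  Real.smoothTransition.contDiff.comp (contDiff_id.add contDiff_const)

theorem deriv_profile_eq_zero {s : ℝ} (hs : s ∉ Set.Icc (-4 : ℝ) (-3)) : deriv profile s = 0 := by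
  rw [Set.mem_Icc, not_and_or, not_le, not_le] at hs
  rcases hs with hs | hs
  · have : profile =ᶠ[𝓝 s] fun _ => 0 := by
      filter_upwards [eventually_lt_nhds hs] with r hr
      exact Real.smoothTransition.zero_of_nonpos (by linarith)
    rw [this.deriv_eq, deriv_const]
  · have : profile =ᶠ[𝓝 s] fun _ => 1 := by
      filter_upwards [eventually_gt_nhds hs] with r hr
      exact Real.smoothTransition.one_of_one_le (by linarith)
    rw [this.deriv_eq, deriv_const]

theorem hasCompactSupport_deriv_profile : HasCompactSupport (deriv profile) :=
  HasCompactSupport.intro isCompact_Icc fun _ h => deriv_profile_eq_zero h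

theorem contDiff_deriv_profile : ContDiff ℝ (⊤ : ℕ∞) (deriv profile) :=
  (contDiff_infty_iff_deriv.1 contDiff_profile).2

theorem contDiff_deriv_deriv_profile : ContDiff ℝ (⊤ : ℕ∞) (deriv (deriv profile)) :=
  (contDiff_infty_iff_deriv.1 contDiff_deriv_profile).2

@[fun_prop]
theorem hasTemperateGrowth_profile : profile.HasTemperateGrowth :=
  hasTemperateGrowth_of_deriv_hasCompactSupport contDiff_profile hasCompactSupport_deriv_profile
    (B := 1) fun s => abs_le.2 ⟨(by norm_num : (-1 : ℝ) ≤ 0).trans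
      (Real.smoothTransition.nonneg (s + 4)), Real.smoothTransition.le_one _⟩

@[fun_prop]
theorem hasTemperateGrowth_deriv_profile : (deriv profile).HasTemperateGrowth :=
  hasCompactSupport_deriv_profile.hasTemperateGrowth contDiff_deriv_profile

@[fun_prop]
theorem hasTemperateGrowth_deriv_deriv_profile : (deriv (deriv profile)).HasTemperateGrowth :=
  hasCompactSupport_deriv_profile.deriv.hasTemperateGrowth contDiff_deriv_deriv_profile

theorem exists_abs_deriv_profile_le :
    ∃ B : ℝ, 0 ≤ B ∧ ∀ s, |deriv profile s| ≤ B ∧ |deriv (deriv profile) s| ≤ B := by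
  obtain ⟨B₁, h1⟩ := hasCompactSupport_deriv_profile.exists_bound_of_continuous
    contDiff_deriv_profile.continuous
  obtain ⟨B₂, h2⟩ := hasCompactSupport_deriv_profile.deriv.exists_bound_of_continuous
    contDiff_deriv_deriv_profile.continuous
  exact ⟨max B₁ B₂, ((norm_nonneg _).trans (h1 0)).trans (le_max_left _ _),
    fun s => ⟨(h1 s).trans (le_max_left _ _), (h2 s).trans (le_max_right _ _)⟩⟩

/-- The powers of the bracket `1 + |ρx|²`. -/
def bracket (ρ a : ℝ) (x : R3) : ℝ := (1 + ‖ρ • x‖ ^ 2) ^ a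

@[fun_prop]
theorem hasTemperateGrowth_bracket (ρ a : ℝ) : (bracket ρ a).HasTemperateGrowth :=
  (Function.hasTemperateGrowth_one_add_norm_sq_rpow R3 a).comp
    (g := fun x : R3 => (1 + ‖x‖ ^ 2) ^ a) (f := fun x : R3 => ρ • x) (by fun_prop)

theorem bracket_pos (ρ a : ℝ) (x : R3) : 0 < bracket ρ a x := Real.rpow_pos_of_pos (by positivity) _

theorem bracket_add (ρ a a' : ℝ) (x : R3) :
    bracket ρ (a + a') x = bracket ρ a x * bracket ρ a' x := Real.rpow_add (by positivity) _ _

theorem bracket_le_one {ρ a : ℝ} (ha : a ≤ 0) (x : R3) : bracket ρ a x ≤ 1 :=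
  Real.rpow_le_one_of_one_le_of_nonpos (by nlinarith [sq_nonneg ‖ρ • x‖]) ha

theorem bracket_half_sq (ρ : ℝ) (x : R3) : bracket ρ (1 / 2) x ^ 2 = 1 + ‖ρ • x‖ ^ 2 := by
  rw [sq, ← bracket_add]
  norm_num [bracket]

theorem hasDerivAt_bracket (ρ a : ℝ) (m x : R3) :
    HasDerivAt (fun s : ℝ => bracket ρ a (x + s • m))
      (2 * a * ρ ^ 2 * ⟪x, m⟫_ℝ * bracket ρ (a - 1) x) 0 := by
  have h1 : HasDerivAt (fun s : ℝ => 1 + ‖ρ • (x + s • m)‖ ^ 2) (2 * ⟪ρ • x, ρ • m⟫_ℝ) 0 := by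
    have h2 : HasDerivAt (fun s : ℝ => ρ • (x + s • m)) (ρ • m) 0 := by
      exact ((((hasDerivAt_id (0 : ℝ)).smul_const m).const_add x).const_smul ρ).congr_deriv (by simp)
    simpa using h2.norm_sq.const_add 1
  have h2 := h1.rpow_const (p := a) (Or.inl (by positivity))
  simp only [zero_smul, add_zero] at h2
  refine h2.congr_deriv ?_
  rw [real_inner_smul_left, real_inner_smul_right, bracket]
  ring

theorem abs_inner_le_bracket {ρ : ℝ} (hρ : 0 ≤ ρ) {m : R3} (hm : ‖m‖ = 1) (x : R3) :
    ρ * |⟪x, m⟫_ℝ| ≤ bracket ρ (1 / 2) x := by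
  refine le_of_sq_le_sq ?_ (bracket_pos _ _ _).le
  rw [bracket_half_sq, norm_smul, Real.norm_of_nonneg hρ]
  have := abs_real_inner_le_norm x m
  rw [hm, mul_one] at this
  have := mul_le_mul_of_nonneg_left this hρ
  have h0 : 0 ≤ ρ * |⟪x, m⟫_ℝ| := by positivity
  nlinarith

/-- The phase function `ρ x·e - c √(1 + |ρx|²)`, positive deep inside the cone. -/
def coneFn (e : R3) (c ρ : ℝ) (x : R3) : ℝ := ρ * ⟪x, e⟫_ℝ - c * bracket ρ (1 / 2) x

/-- The first derivative of `coneFn` in the direction `m`. -/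
def coneFn₁ (e : R3) (c ρ : ℝ) (m x : R3) : ℝ :=
  ρ * ⟪m, e⟫_ℝ - c * (ρ ^ 2 * ⟪x, m⟫_ℝ * bracket ρ (-1 / 2) x)

/-- The second derivative of `coneFn` in the direction `m`. -/
def coneFn₂ (c ρ : ℝ) (m x : R3) : ℝ :=
  -(c * (ρ ^ 2 * (‖m‖ ^ 2 * bracket ρ (-1 / 2) x -
    ρ ^ 2 * ⟪x, m⟫_ℝ ^ 2 * bracket ρ (-3 / 2) x)))

theorem hasTemperateGrowth_coneFn (e : R3) (c ρ : ℝ) : (coneFn e c ρ).HasTemperateGrowth := by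
  unfold coneFn; fun_prop

theorem hasTemperateGrowth_coneFn₁ (e : R3) (c ρ : ℝ) (m : R3) :
    (coneFn₁ e c ρ m).HasTemperateGrowth := by
  unfold coneFn₁; fun_prop

theorem hasTemperateGrowth_coneFn₂ (c ρ : ℝ) (m : R3) : (coneFn₂ c ρ m).HasTemperateGrowth := by
  unfold coneFn₂; fun_prop

theorem hasDerivAt_inner_line (x m e : R3) :
    HasDerivAt (fun s : ℝ => ⟪x + s • m, e⟫_ℝ) ⟪m, e⟫_ℝ 0 := by
  simp only [inner_add_left, real_inner_smul_left]
  simpa using ((hasDerivAt_id (0 : ℝ)).mul_const ⟪m, e⟫_ℝ).const_add ⟪x, e⟫_ℝ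

theorem hasDerivAt_coneFn (e : R3) (c ρ : ℝ) (m x : R3) :
    HasDerivAt (fun s : ℝ => coneFn e c ρ (x + s • m)) (coneFn₁ e c ρ m x) 0 := by
  refine (((hasDerivAt_inner_line x m e).const_mul ρ).sub
    ((hasDerivAt_bracket ρ (1 / 2) m x).const_mul c)).congr_deriv ?_
  rw [coneFn₁]
  norm_num

theorem hasDerivAt_coneFn₁ (e : R3) (c ρ : ℝ) (m x : R3) :
    HasDerivAt (fun s : ℝ => coneFn₁ e c ρ m (x + s • m)) (coneFn₂ c ρ m x) 0 := by
  have h := ((((hasDerivAt_inner_line x m m).const_mul (ρ ^ 2)).mul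
    (hasDerivAt_bracket ρ (-1 / 2) m x)).const_mul c).const_sub (ρ * ⟪m, e⟫_ℝ)
  refine h.congr_deriv ?_
  rw [coneFn₂, real_inner_self_eq_norm_sq]
  simp only [zero_smul, add_zero]
  rw [show (-1 / 2 - 1 : ℝ) = -3 / 2 by norm_num]
  ring

/-- The linear growth in `x` is absorbed by the bracket, since `ρ|x·m| ≤ √(1 + |ρx|²)`; each of the
two terms contributes at most `ρ`. -/
theorem abs_coneFn₁_le {e : R3} (he : ‖e‖ = 1) {c : ℝ} (hc : 0 ≤ c) (hc' : c ≤ 1) {ρ : ℝ}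
    (hρ : 0 ≤ ρ) {m : R3} (hm : ‖m‖ = 1) (x : R3) : |coneFn₁ e c ρ m x| ≤ 2 * ρ := by
  have h1 : |⟪m, e⟫_ℝ| ≤ 1 := (abs_real_inner_le_norm m e).trans_eq (by rw [hm, he, mul_one])
  have h2 : ρ * |⟪x, m⟫_ℝ| * bracket ρ (-1 / 2) x ≤ 1 := by
    refine (mul_le_mul_of_nonneg_right (abs_inner_le_bracket hρ hm x)
      (bracket_pos _ _ _).le).trans_eq ?_
    rw [← bracket_add]
    norm_num [bracket]
  have h3 : |ρ * ⟪m, e⟫_ℝ| ≤ ρ := by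
    rw [abs_mul, abs_of_nonneg hρ]; exact mul_le_of_le_one_right hρ h1
  have h4 : |c * (ρ ^ 2 * ⟪x, m⟫_ℝ * bracket ρ (-1 / 2) x)| ≤ ρ := by
    rw [abs_mul, abs_mul, abs_mul, abs_of_nonneg hc, abs_of_nonneg (sq_nonneg ρ),
      abs_of_pos (bracket_pos _ _ _)]
    have h5 : ρ ^ 2 * |⟪x, m⟫_ℝ| * bracket ρ (-1 / 2) x ≤ ρ := by
      calc _ = ρ * (ρ * |⟪x, m⟫_ℝ| * bracket ρ (-1 / 2) x) := by ring
        _ ≤ ρ := mul_le_of_le_one_right hρ h2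
    have h6 : 0 ≤ ρ ^ 2 * |⟪x, m⟫_ℝ| * bracket ρ (-1 / 2) x :=
      mul_nonneg (by positivity) (bracket_pos _ _ _).le
    exact (mul_le_of_le_one_left h6 hc').trans h5
  exact (abs_sub _ _).trans (by linarith)

theorem abs_coneFn₂_le {c : ℝ} (hc : 0 ≤ c) (hc' : c ≤ 1) {ρ : ℝ}
    (hρ : 0 ≤ ρ) {m : R3} (hm : ‖m‖ = 1) (x : R3) : |coneFn₂ c ρ m x| ≤ 2 * ρ ^ 2 := by
  have h1 : ρ ^ 2 * ⟪x, m⟫_ℝ ^ 2 * bracket ρ (-3 / 2) x ≤ 1 := by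
    have h2 : ρ ^ 2 * ⟪x, m⟫_ℝ ^ 2 ≤ bracket ρ (1 / 2) x ^ 2 := by
      rw [← mul_pow, ← sq_abs, abs_mul, abs_of_nonneg hρ]
      exact pow_le_pow_left₀ (by positivity) (abs_inner_le_bracket hρ hm x) 2
    refine (mul_le_mul_of_nonneg_right h2 (bracket_pos _ _ _).le).trans ?_
    rw [sq, ← bracket_add, ← bracket_add]
    exact bracket_le_one (by norm_num) x
  have h2 : 0 ≤ ρ ^ 2 * ⟪x, m⟫_ℝ ^ 2 * bracket ρ (-3 / 2) x :=
    mul_nonneg (by positivity) (bracket_pos _ _ _).le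
  have h3 := bracket_le_one (ρ := ρ) (a := -1 / 2) (by norm_num) x
  have h4 := bracket_pos ρ (-1 / 2) x
  rw [coneFn₂, abs_neg, abs_mul, abs_mul, abs_of_nonneg hc, abs_of_nonneg (sq_nonneg ρ), hm]
  have h5 : |1 ^ 2 * bracket ρ (-1 / 2) x - ρ ^ 2 * ⟪x, m⟫_ℝ ^ 2 * bracket ρ (-3 / 2) x| ≤ 2 := by
    rw [abs_le]; constructor <;> linarith
  calc _ ≤ 1 * (ρ ^ 2 * 2) := by gcongr
    _ = 2 * ρ ^ 2 := by ring

/-- Every cone of half-opening angle less than `π/2` has smooth cut-offs at every scale. -/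
theorem exists_isCutoff {e : R3} (he : ‖e‖ = 1) {θ : ℝ} (hc : 0 ≤ Real.cos θ)
    (hc' : Real.cos θ < 1) :
    ∃ b ε : ℝ, 0 ≤ b ∧ 0 < ε ∧ ∀ d : ℝ, 1 ≤ d → ∃ (f : R3 → ℝ) (f₁ f₂ : Fin 3 → R3 → ℝ),
      IsCutoff (cone e θ) b ε d f f₁ f₂ := by
  obtain ⟨B, hB0, hB⟩ := exists_abs_deriv_profile_le
  set c := Real.cos θ with hcdef
  -- Chosen so that `4εd = (1 - c)d/2`: a shift by `d/2` along the axis exactly compensates a value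
  -- `-4` of the phase function.
  set ε : ℝ := (1 - c) / 8 with hε
  have hεpos : 0 < ε := by rw [hε]; linarith
  -- The first derivatives are at most `2Bρ` and the second at most `6Bρ²`, with `ρ = 1/(εd)`. Since
  -- `d ≥ 1`, also `d⁻² ≤ d⁻¹`.
  refine ⟨2 * B / ε + 6 * B / ε ^ 2, ε, by positivity, hεpos, fun d hd => ?_⟩
  have hd0 : 0 < d := by linarith
  set ρ : ℝ := (ε * d)⁻¹ with hρdef
  have hρ : 0 < ρ := by positivity
  have hρ1 : ρ = ε⁻¹ * d⁻¹ := by rw [hρdef, mul_inv]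
  have hd1 : d⁻¹ ≤ 1 := inv_le_one_of_one_le₀ hd
  have hb1 : 2 * B * ρ ≤ (2 * B / ε + 6 * B / ε ^ 2) / d := by
    have : (2 * B / ε + 6 * B / ε ^ 2) / d = 2 * B * ρ + 6 * B / ε ^ 2 / d := by
      rw [hρ1]; field_simp
    rw [this]
    have : 0 ≤ 6 * B / ε ^ 2 / d := by positivity
    linarith
  have hb2 : 6 * B * ρ ^ 2 ≤ (2 * B / ε + 6 * B / ε ^ 2) / d := by
    have h1 : (2 * B / ε + 6 * B / ε ^ 2) / d = 2 * B / ε / d + 6 * B * (ε⁻¹ ^ 2 * d⁻¹) := by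
      field_simp
    have h2 : ρ ^ 2 ≤ ε⁻¹ ^ 2 * d⁻¹ := by
      rw [hρ1, mul_pow]
      refine mul_le_mul_of_nonneg_left ?_ (by positivity)
      have : 0 < d⁻¹ := by positivity
      nlinarith
    rw [h1]
    have : 0 ≤ 2 * B / ε / d := by positivity
    have := mul_le_mul_of_nonneg_left h2 (by positivity : 0 ≤ 6 * B)
    linarith
  have hdf : ∀ s, HasDerivAt profile (deriv profile s) s := fun s =>
    (contDiff_profile.differentiable (by simp) s).hasDerivAt
  have hdf2 : ∀ s, HasDerivAt (deriv profile) (deriv (deriv profile) s) s := fun s =>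
    (contDiff_deriv_profile.differentiable (by simp) s).hasDerivAt
  have hder0 : ∀ s, s ∉ Set.Icc (-4 : ℝ) (-3) → deriv (deriv profile) s = 0 := by
    intro s hs
    have : deriv profile =ᶠ[𝓝 s] fun _ => 0 := by
      filter_upwards [isClosed_Icc.isOpen_compl.mem_nhds hs] with r hr
      exact deriv_profile_eq_zero hr
    rw [this.deriv_eq, deriv_const]
  have hcomp : ∀ (m x : R3) (g : ℝ → ℝ) (g' : ℝ), HasDerivAt g g' (coneFn e c ρ x) →
      HasDerivAt (fun s : ℝ => g (coneFn e c ρ (x + s • m))) (g' * coneFn₁ e c ρ m x) 0 := by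
    intro m x g g' hgd
    refine HasDerivAt.comp (h₂ := g) (0 : ℝ) ?_ (hasDerivAt_coneFn e c ρ m x)
    simpa using hgd
  -- On the cone the bracket is at most `1 + ρ|x|`, so the phase function is at least `-c > -3`,
  -- beyond the transition interval of the profile.
  have hcone : ∀ x ∈ cone e θ, coneFn e c ρ x ∉ Set.Icc (-4 : ℝ) (-3) := by
    intro x hx h
    have h1 : ‖x‖ * c ≤ ⟪x, e⟫_ℝ := hx
    have h2 : bracket ρ (1 / 2) x ≤ 1 + ρ * ‖x‖ := by
      refine le_of_sq_le_sq ?_ (by positivity)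
      rw [bracket_half_sq, norm_smul, Real.norm_of_nonneg hρ.le]
      nlinarith [mul_nonneg hρ.le (norm_nonneg x)]
    have h3 : coneFn e c ρ x ≤ -3 := h.2
    rw [coneFn] at h3
    have h4 := mul_le_mul_of_nonneg_left h1 hρ.le
    have h5 := mul_le_mul_of_nonneg_left h2 hc
    nlinarith
  refine ⟨fun x => profile (coneFn e c ρ x),
    fun i x => deriv profile (coneFn e c ρ x) * coneFn₁ e c ρ (coordVec i) x,
    fun i x => deriv (deriv profile) (coneFn e c ρ x) * coneFn₁ e c ρ (coordVec i) x ^ 2 +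
      deriv profile (coneFn e c ρ x) * coneFn₂ c ρ (coordVec i) x, ?_⟩
  have hg := hasTemperateGrowth_coneFn e c ρ
  have hg₁ := fun i => hasTemperateGrowth_coneFn₁ e c ρ (coordVec i)
  have hg₂ := fun i => hasTemperateGrowth_coneFn₂ c ρ (coordVec i)
  have hp : (fun x => profile (coneFn e c ρ x)).HasTemperateGrowth :=
    hasTemperateGrowth_profile.comp hg
  have hp1 : (fun x => deriv profile (coneFn e c ρ x)).HasTemperateGrowth :=
    hasTemperateGrowth_deriv_profile.comp hg
  have hp2 : (fun x => deriv (deriv profile) (coneFn e c ρ x)).HasTemperateGrowth :=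
    hasTemperateGrowth_deriv_deriv_profile.comp hg
  refine ⟨hp, fun i => hp1.mul (hg₁ i), fun i => ?_, fun x => Real.smoothTransition.nonneg _,
    fun x => Real.smoothTransition.le_one _, fun x hx => ?_, fun x hx => ?_, fun i x => ?_,
    fun i x => ?_, fun i x => ?_, fun i x => ?_, fun i x hx => ?_, fun i x hx => ?_⟩
  · exact (hp2.mul ((hg₁ i).pow 2)).add (hp1.mul (hg₂ i))
  -- On this ball `ρ|x| ≤ 1`: the linear term is at least `-1` and the bracket term at least `-2`,
  -- so the phase function is at least `-3`.
  · refine Real.smoothTransition.one_of_one_le ?_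
    have h1 : ρ * ‖x‖ ≤ 1 := by
      rw [hρdef, inv_mul_le_iff₀ (by positivity), mul_one]; exact hx
    have h2 : bracket ρ (1 / 2) x ≤ 2 := by
      refine le_of_sq_le_sq ?_ (by positivity)
      rw [bracket_half_sq, norm_smul, Real.norm_of_nonneg hρ.le]
      have : 0 ≤ ρ * ‖x‖ := by positivity
      nlinarith
    have h3 : -‖x‖ ≤ ⟪x, e⟫_ℝ := by
      have := abs_le.1 (abs_real_inner_le_norm x e)
      rw [he, mul_one] at this
      exact this.1
    have h4 := mul_le_mul_of_nonneg_left h3 hρ.le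
    have h5 : c * bracket ρ (1 / 2) x ≤ 2 :=
      (mul_le_of_le_one_left (bracket_pos _ _ _).le hc'.le).trans h2
    rw [coneFn]
    nlinarith
  · have h1 : -4 < coneFn e c ρ x := by
      by_contra h
      exact hx (Real.smoothTransition.zero_of_nonpos (by linarith))
    have h2 : ρ * ‖x‖ ≤ bracket ρ (1 / 2) x := by
      refine le_of_sq_le_sq ?_ (bracket_pos _ _ _).le
      rw [bracket_half_sq, norm_smul, Real.norm_of_nonneg hρ.le]
      linarith
    -- Moving by `d/2` along the axis gains `(1 - c)d/2` in the cone inequality, which makes up for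
    -- the deficit `4εd`.
    refine ⟨x + (d / 2) • e, ?_, ?_⟩
    · change ‖x + (d / 2) • e‖ * c ≤ ⟪x + (d / 2) • e, e⟫_ℝ
      rw [inner_add_left, real_inner_smul_left, real_inner_self_eq_norm_sq, he]
      have h3 : ‖x + (d / 2) • e‖ ≤ ‖x‖ + d / 2 := by
        refine (norm_add_le _ _).trans_eq ?_
        rw [norm_smul, he, Real.norm_of_nonneg (by positivity), mul_one]
      have h4 := mul_le_mul_of_nonneg_right h3 hc
      have h5 : c * (ρ * ‖x‖) - 4 ≤ ρ * ⟪x, e⟫_ℝ := by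
        have := mul_le_mul_of_nonneg_left h2 hc
        rw [coneFn] at h1
        linarith
      have h6 : c * ‖x‖ - 4 * (ε * d) ≤ ⟪x, e⟫_ℝ := by
        have h7 := mul_le_mul_of_nonneg_left h5 (by positivity : 0 ≤ ε * d)
        have h8 : ε * d * ρ = 1 := mul_inv_cancel₀ (by positivity)
        have h9 : ε * d * (ρ * ⟪x, e⟫_ℝ) = ⟪x, e⟫_ℝ := by rw [← mul_assoc, h8, one_mul]
        have h10 : ε * d * (c * (ρ * ‖x‖) - 4) = (ε * d * ρ) * (c * ‖x‖) - 4 * (ε * d) := by ring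
        rw [h9, h10, h8, one_mul] at h7
        exact h7
      have h11 : 4 * (ε * d) = (1 - c) * (d / 2) := by rw [hε]; ring
      nlinarith
    · rw [dist_eq_norm, sub_add_cancel_left, norm_neg, norm_smul, he,
        Real.norm_of_nonneg (by positivity), mul_one]
  · exact hcomp (coordVec i) x _ _ (hdf _)
  · have h1 : HasDerivAt (fun s : ℝ => deriv profile (coneFn e c ρ (x + s • coordVec i)))
        (deriv (deriv profile) (coneFn e c ρ x) * coneFn₁ e c ρ (coordVec i) x) 0 :=
      hcomp (coordVec i) x _ _ (hdf2 _)
    refine (h1.mul (hasDerivAt_coneFn₁ e c ρ (coordVec i) x)).congr_deriv ?_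
    simp only [zero_smul, add_zero]
    ring
  · refine le_trans ?_ hb1
    rw [abs_mul]
    calc _ ≤ B * (2 * ρ) := mul_le_mul (hB _).1
          (abs_coneFn₁_le he hc hc'.le hρ.le (norm_coordVec i) x) (abs_nonneg _) hB0
      _ = 2 * B * ρ := by ring
  · refine le_trans ?_ hb2
    refine (abs_add_le _ _).trans ?_
    rw [abs_mul, abs_mul, abs_pow]
    calc _ ≤ B * (2 * ρ) ^ 2 + B * (2 * ρ ^ 2) := by
          gcongr
          · exact (hB _).2
          · exact abs_coneFn₁_le he hc hc'.le hρ.le (norm_coordVec i) x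
          · exact (hB _).1
          · exact abs_coneFn₂_le hc hc'.le hρ.le (norm_coordVec i) x
      _ = 6 * B * ρ ^ 2 := by ring
  · simp only [deriv_profile_eq_zero (hcone x hx), zero_mul]
  · simp only [deriv_profile_eq_zero (hcone x hx), hder0 _ (hcone x hx), zero_mul, add_zero]

end Construction

end ClosedSystem

end

noncomputable section

namespace ClosedSystem

/-! ### Observables of `P` and of `Q` on the tensor product -/

section Tensor

variable {K : Type*} [NormedAddCommGroup K] [InnerProductSpace ℂ K]

theorem eq_sum_spinTmul (c : SpinTensor K) :
    c = ∑ i, spinTmul (c i) (EuclideanSpace.single i (1 : ℂ)) := by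
  ext j
  fin_cases j <;> simp

/-- Continuous linear maps that agree on elementary tensors are equal. -/
theorem clm_ext_tensor {F : Type*} [NormedAddCommGroup F] [NormedSpace ℂ F]
    {A B : HilbertPQ K →L[ℂ] F} (h : ∀ χ φ, A (tensor χ φ) = B (tensor χ φ)) : A = B := by
  refine ContinuousLinearMap.ext fun Ψ => ?_
  refine Lp.induction ENNReal.ofNat_ne_top (motive := fun Ψ => A Ψ = B Ψ) ?_ ?_
    (isClosed_eq A.continuous B.continuous) Ψ
  · intro c s hs hμs
    have hc : (Lp.simpleFunc.indicatorConst 2 hs hμs.ne c : HilbertPQ K)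
        = ∑ i, tensor (c i) (indicatorConstLp 2 hs hμs.ne (EuclideanSpace.single i (1 : ℂ))) := by
      rw [Lp.simpleFunc.coe_indicatorConst]
      refine Lp.ext ?_
      have h1 : ∀ i : Fin 2, ∀ᵐ x, tensor (c i)
          (indicatorConstLp 2 hs hμs.ne (EuclideanSpace.single i (1 : ℂ)) : HilbertP) x
          = spinTmul (c i) (s.indicator (fun _ => EuclideanSpace.single i (1 : ℂ)) x) := by
        intro i
        filter_upwards [coeFn_tensor (c i)
          (indicatorConstLp 2 hs hμs.ne (EuclideanSpace.single i (1 : ℂ)) : HilbertP),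
          indicatorConstLp_coeFn (p := 2) (hs := hs) (hμs := hμs.ne)
            (c := (EuclideanSpace.single i (1 : ℂ) : Spin))] with x h1 h2
        rw [h1, h2]
      filter_upwards [indicatorConstLp_coeFn (p := 2) (hs := hs) (hμs := hμs.ne) (c := c),
        ae_all_iff.2 h1, Lp.coeFn_finsetSum Finset.univ fun i => tensor (c i)
          (indicatorConstLp 2 hs hμs.ne (EuclideanSpace.single i (1 : ℂ)) : HilbertP)]
        with x h2 h3 h4
      rw [h2, h4, Finset.sum_apply, Finset.sum_congr rfl fun i _ => h3 i]
      by_cases hx : x ∈ s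
      · simpa [hx] using eq_sum_spinTmul c
      · simp [hx]
    rw [hc, map_sum, map_sum]
    exact Finset.sum_congr rfl fun i _ => h _ _
  · intro f g hf hg _ h1 h2
    rw [map_add, map_add, h1, h2]

/-- The operator `1 ⊗ A` on `ℂ² ⊗ K`. -/
def spinMap (A : K →L[ℂ] K) : SpinTensor K →L[ℂ] SpinTensor K :=
  LinearMap.mkContinuous
    { toFun := fun u => WithLp.toLp 2 fun i => A (u i)
      map_add' := fun u w => by ext i; simp
      map_smul' := fun c u => by ext i; simp } ‖A‖
    (fun u => by
      refine le_of_sq_le_sq ?_ (by positivity)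
      rw [mul_pow, PiLp.norm_sq_eq_of_L2, PiLp.norm_sq_eq_of_L2, Finset.mul_sum]
      refine Finset.sum_le_sum fun i _ => ?_
      rw [← mul_pow]
      exact pow_le_pow_left₀ (norm_nonneg _) (A.le_opNorm _) 2)

theorem spinMap_apply (A : K →L[ℂ] K) (u : SpinTensor K) :
    spinMap A u = WithLp.toLp 2 fun i => A (u i) := rfl

theorem norm_spinMap {A : K →L[ℂ] K} (hA : ∀ χ, ‖A χ‖ = ‖χ‖) (u : SpinTensor K) :
    ‖spinMap A u‖ = ‖u‖ := by
  refine (pow_left_inj₀ (norm_nonneg _) (norm_nonneg _) two_ne_zero).1 ?_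
  rw [PiLp.norm_sq_eq_of_L2, PiLp.norm_sq_eq_of_L2]
  exact Finset.sum_congr rfl fun i _ => by rw [spinMap_apply]; simp [hA]

theorem spinMap_spinTmul (A : K →L[ℂ] K) (χ : K) (s : Spin) :
    spinMap A (spinTmul χ s) = spinTmul (A χ) s := by
  ext i
  simp [spinMap_apply]

/-- The observable `1 ⊗ A` of `Q`. -/
def liftQ (A : K →L[ℂ] K) : HilbertPQ K →L[ℂ] HilbertPQ K := (spinMap A).compLpL 2 volume

theorem coeFn_liftQ (A : K →L[ℂ] K) (Ψ : HilbertPQ K) :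
    liftQ A Ψ =ᵐ[volume] fun x => spinMap A (Ψ x) := ContinuousLinearMap.coeFn_compLp _ _

theorem norm_liftQ {A : K →L[ℂ] K} (hA : ∀ χ, ‖A χ‖ = ‖χ‖) (Ψ : HilbertPQ K) :
    ‖liftQ A Ψ‖ = ‖Ψ‖ := by
  apply le_antisymm <;> refine Lp.norm_le_norm_of_ae_le ?_ <;>
  filter_upwards [coeFn_liftQ A Ψ] with x hx <;> rw [hx, norm_spinMap hA]

theorem liftQ_tensor (A : K →L[ℂ] K) (χ : K) (φ : HilbertP) :
    liftQ A (tensor χ φ) = tensor (A χ) φ := by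
  refine Lp.ext ?_
  filter_upwards [coeFn_liftQ A (tensor χ φ), coeFn_tensor χ φ, coeFn_tensor (A χ) φ]
    with x h1 h2 h3
  rw [h1, h2, h3, spinMap_spinTmul]

end Tensor

/-! ### Algebra of `O ⊗ 1` and `1 ⊗ A`, the decoupled evolution, and the trace formula. -/

section Complete

variable {K : Type*} [NormedAddCommGroup K] [InnerProductSpace ℂ K] [CompleteSpace K]

theorem hasSum_amplify (O : HilbertP →L[ℂ] HilbertP) (Ψ : HilbertPQ K) :
    HasSum (fun j => tensor (stdBasis K j) (O (slice (stdBasis K j) Ψ))) (amplify O Ψ) :=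
  (summable_amplify (stdBasis K).orthonormal O Ψ).hasSum

/-- Comparison on elementary tensors suffices, and there the basis used to define `amplify` no
longer appears. -/
theorem amplify_comp (A B : HilbertP →L[ℂ] HilbertP) :
    amplify (K := K) (A ∘L B) = amplify A ∘L amplify B :=
  clm_ext_tensor fun χ φ => by simp [amplify_tensor]

theorem amplify_id : amplify (K := K) (ContinuousLinearMap.id ℂ HilbertP)
    = ContinuousLinearMap.id ℂ (HilbertPQ K) :=
  clm_ext_tensor fun χ φ => by simp [amplify_tensor]

theorem amplify_liftQ (A : HilbertP →L[ℂ] HilbertP) (B : K →L[ℂ] K) :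
    amplify A ∘L liftQ B = liftQ B ∘L amplify A :=
  clm_ext_tensor fun χ φ => by simp [amplify_tensor, liftQ_tensor]

theorem adjoint_amplify (A : HilbertP →L[ℂ] HilbertP) :
    ContinuousLinearMap.adjoint (amplify (K := K) A) = amplify (ContinuousLinearMap.adjoint A) := by
  refine clm_ext_tensor fun χ φ => ext_inner_right ℂ fun Ψ => ?_
  rw [ContinuousLinearMap.adjoint_inner_left]
  have h : innerSL ℂ (tensor χ φ) ∘L amplify A
      = innerSL ℂ (amplify (ContinuousLinearMap.adjoint A) (tensor χ φ)) := by
    refine clm_ext_tensor fun χ' φ' => ?_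
    simp [amplify_tensor, inner_tensor, ContinuousLinearMap.adjoint_inner_left]
  exact congrArg (fun F => F Ψ) h

theorem norm_amplify_le (A : HilbertP →L[ℂ] HilbertP) : ‖amplify (K := K) A‖ ≤ ‖A‖ :=
  LinearMap.mkContinuous_norm_le _ (norm_nonneg _) _

theorem norm_amplify_freeEvolution (t : ℝ) (Ψ : HilbertPQ K) :
    ‖amplify (freeEvolution t) Ψ‖ = ‖Ψ‖ := by
  have h : ContinuousLinearMap.adjoint (amplify (K := K) (freeEvolution t)) ∘L
      amplify (freeEvolution t) = ContinuousLinearMap.id ℂ (HilbertPQ K) := by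
    rw [adjoint_amplify, adjoint_freeEvolution, ← amplify_comp, ← freeEvolution_add,
      neg_add_cancel, freeEvolution_zero, amplify_id]
  have h2 : ⟪amplify (freeEvolution t) Ψ, amplify (freeEvolution t) Ψ⟫_ℂ = ⟪Ψ, Ψ⟫_ℂ := by
    rw [← ContinuousLinearMap.adjoint_inner_left, ← ContinuousLinearMap.comp_apply, h]
    rfl
  have h3 := congrArg RCLike.re h2
  rw [inner_self_eq_norm_sq, inner_self_eq_norm_sq] at h3
  exact (pow_left_inj₀ (norm_nonneg _) (norm_nonneg _) two_ne_zero).1 h3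

/-- The decoupled evolution `e^{-itH_P} ⊗ e^{-itH_Q}`. -/
def decoupled (UQ : ℝ → K →L[ℂ] K) (t : ℝ) : HilbertPQ K →L[ℂ] HilbertPQ K :=
  amplify (freeEvolution t) ∘L liftQ (UQ t)

theorem norm_decoupled {UQ : ℝ → K →L[ℂ] K} (hU : ∀ t χ, ‖UQ t χ‖ = ‖χ‖) (t : ℝ)
    (Ψ : HilbertPQ K) : ‖decoupled UQ t Ψ‖ = ‖Ψ‖ := by
  rw [decoupled, ContinuousLinearMap.comp_apply, norm_amplify_freeEvolution, norm_liftQ (hU t)]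

theorem decoupled_tensor (UQ : ℝ → K →L[ℂ] K) (t : ℝ) (χ : K) (φ : HilbertP) :
    decoupled UQ t (tensor χ φ) = tensor (UQ t χ) (freeEvolution t φ) := by
  rw [decoupled, ContinuousLinearMap.comp_apply, liftQ_tensor, amplify_tensor]

/-- The evolution of `Q` commutes with every observable of `P` and is isometric, so it cancels; the
evolution of `P` is moved onto the observable through its adjoint. -/
theorem inner_decoupled_amplify {UQ : ℝ → K →L[ℂ] K} (hU : ∀ t χ, ‖UQ t χ‖ = ‖χ‖) (t : ℝ)
    (O : HilbertP →L[ℂ] HilbertP) (Ψ : HilbertPQ K) :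
    ⟪decoupled UQ t Ψ, amplify O (decoupled UQ t Ψ)⟫_ℂ
      = ⟪Ψ, amplify (freeEvolution (-t) ∘L O ∘L freeEvolution t) Ψ⟫_ℂ := by
  have h1 : amplify O (decoupled UQ t Ψ) = amplify (O ∘L freeEvolution t) (liftQ (UQ t) Ψ) := by
    rw [amplify_comp]; rfl
  rw [h1, decoupled, ContinuousLinearMap.comp_apply, ← ContinuousLinearMap.adjoint_inner_right,
    adjoint_amplify, adjoint_freeEvolution, ← ContinuousLinearMap.comp_apply (amplify _) (amplify _),
    ← amplify_comp, ← ContinuousLinearMap.comp_apply, amplify_liftQ,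
    ContinuousLinearMap.comp_apply]
  exact (LinearMap.norm_map_iff_inner_map_map (liftQ (UQ t))).1 (norm_liftQ (hU t)) _ _

/-- If `∑ⱼ ‖xⱼ‖²` and `∑ⱼ ‖yⱼ‖²` converge, then `∑ₖ ∑ⱼ ⟨yⱼ, bₖ⟩ ⟨bₖ, xⱼ⟩ = ∑ⱼ ⟨yⱼ, xⱼ⟩`. -/
theorem hasSum_inner_mul_inner_swap {E ι κ : Type*} [NormedAddCommGroup E] [InnerProductSpace ℂ E]
    (b : HilbertBasis ι ℂ E) {x y : κ → E} (hx : Summable fun j => ‖x j‖ ^ 2)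
    (hy : Summable fun j => ‖y j‖ ^ 2) {g : ι → ℂ} {c : ℂ}
    (hg : ∀ k, HasSum (fun j => ⟪y j, b k⟫_ℂ * ⟪b k, x j⟫_ℂ) (g k))
    (hc : HasSum (fun j => ⟪y j, x j⟫_ℂ) c) : HasSum g c := by
  have hk : ∀ z : E, Summable fun k => ‖⟪b k, z⟫_ℂ‖ ^ 2 := fun z =>
    b.orthonormal.inner_products_summable z
  have hle : ∀ z : E, ∑' k, ‖⟪b k, z⟫_ℂ‖ ^ 2 ≤ ‖z‖ ^ 2 := fun z =>
    b.orthonormal.tsum_inner_products_le z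
  -- Bessel's inequality bounds the sum over the basis by `‖yⱼ‖² + ‖xⱼ‖²`. This majorant makes the
  -- double series absolutely convergent, so that the order of summation can be exchanged.
  have hs : Summable fun p : κ × ι => ‖⟪b p.2, y p.1⟫_ℂ‖ ^ 2 + ‖⟪b p.2, x p.1⟫_ℂ‖ ^ 2 := by
    refine (summable_prod_of_nonneg fun p => by positivity).2
      ⟨fun j => (hk (y j)).add (hk (x j)), ?_⟩
    refine Summable.of_nonneg_of_le (fun j => tsum_nonneg fun k => by positivity) (fun j => ?_)
      (hy.add hx)
    rw [(hk (y j)).tsum_add (hk (x j))]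
    exact add_le_add (hle _) (hle _)
  have hu : Summable fun p : κ × ι => ⟪y p.1, b p.2⟫_ℂ * ⟪b p.2, x p.1⟫_ℂ := by
    refine Summable.of_norm_bounded hs fun p => ?_
    rw [norm_mul, norm_inner_symm]
    nlinarith [sq_nonneg (‖⟪b p.2, y p.1⟫_ℂ‖ - ‖⟪b p.2, x p.1⟫_ℂ‖),
      sq_nonneg ‖⟪b p.2, y p.1⟫_ℂ‖, sq_nonneg ‖⟪b p.2, x p.1⟫_ℂ‖]
  have h1 := hu.hasSum.prod_fiberwise fun j => b.hasSum_inner_mul_inner (y j) (x j)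
  have hu' := hu.hasSum
  rw [h1.unique hc] at hu'
  have h3 : HasSum (fun p : ι × κ => ⟪y p.2, b p.1⟫_ℂ * ⟪b p.1, x p.2⟫_ℂ) c :=
    (Equiv.prodComm ι κ).hasSum_iff.2 hu'
  exact h3.prod_fiberwise hg

/-- `Tr(ρ_P B) = ⟨Ψ, (B ⊗ 1) Ψ⟩`. -/
theorem isTrace_reducedDensity_comp (Ψ : HilbertPQ K) (B : HilbertP →L[ℂ] HilbertP) :
    IsTrace (reducedDensity Ψ ∘L B) ⟪Ψ, amplify B Ψ⟫_ℂ := by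
  intro ι b
  have hsx : Summable fun j => ‖slice (stdBasis K j) Ψ‖ ^ 2 :=
    summable_of_sum_le (fun _ => sq_nonneg _) (sum_norm_slice_sq_le (stdBasis K).orthonormal Ψ)
  -- The slices of `Ψ` are square-summable, hence so are their images under `B*`.
  refine hasSum_inner_mul_inner_swap b (x := fun j => slice (stdBasis K j) Ψ)
    (y := fun j => ContinuousLinearMap.adjoint B (slice (stdBasis K j) Ψ)) hsx ?_ (fun k => ?_) ?_
  · refine Summable.of_nonneg_of_le (fun j => sq_nonneg _) (fun j => ?_)
      (hsx.mul_left (‖ContinuousLinearMap.adjoint B‖ ^ 2))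
    rw [← mul_pow]
    exact pow_le_pow_left₀ (norm_nonneg _) (ContinuousLinearMap.le_opNorm _ _) 2
  · refine (hasSum_inner_rankOne (summable_reducedDensity Ψ) (b k) (B (b k))).congr_fun fun j => ?_
    rw [ContinuousLinearMap.adjoint_inner_left, mul_comm]
  · have h := (innerSL ℂ Ψ).hasSum (hasSum_amplify B Ψ)
    simp only [innerSL_apply_apply, ← inner_slice_left] at h
    simpa only [ContinuousLinearMap.adjoint_inner_left] using h

end Complete

end ClosedSystem

end

noncomputable section

namespace ClosedSystem

open LineDeriv

/-! ### Duhamel's formula -/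

section Duhamel

variable {E : Type*} [NormedAddCommGroup E] [InnerProductSpace ℂ E] {A : E →ₗ.[ℂ] E}
  {U : ℝ → E →L[ℂ] E}

theorem IsUnitaryGroup.hasDerivAt (hU : IsUnitaryGroup A U) {ψ φ : E} (h : (ψ, φ) ∈ A.graph)
    (t : ℝ) : HasDerivAt (fun s => U s ψ) (-Complex.I • U t φ) t := by
  have h0 := (hU.generator ψ φ).1 h
  have h1 := ((U t).restrictScalars ℝ).hasFDerivAt.comp_hasDerivAt (0 : ℝ) h0
  simp only [ContinuousLinearMap.coe_restrictScalars', map_smul] at h1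
  have h2 := HasDerivAt.comp_sub_const t t (by rw [sub_self]; exact h1)
  refine h2.congr_of_eventuallyEq (Eventually.of_forall fun s => ?_)
  simp only [Function.comp]
  rw [← mul_apply_eq_comp, ← hU.add, add_sub_cancel]

theorem IsUnitaryGroup.mem_graph (hU : IsUnitaryGroup A U) {ψ φ : E} (h : (ψ, φ) ∈ A.graph)
    (t : ℝ) : (U t ψ, U t φ) ∈ A.graph := by
  have h0 := (hU.generator ψ φ).1 h
  have h1 := ((U t).restrictScalars ℝ).hasFDerivAt.comp_hasDerivAt (0 : ℝ) h0
  simp only [ContinuousLinearMap.coe_restrictScalars', map_smul] at h1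
  refine (hU.generator _ _).2 (h1.congr_of_eventuallyEq (Eventually.of_forall fun s => ?_))
  simp only [Function.comp]
  rw [← mul_apply_eq_comp, ← mul_apply_eq_comp, ← hU.add, ← hU.add, add_comm]

theorem IsUnitaryGroup.apply_neg_apply (hU : IsUnitaryGroup A U) (t : ℝ) (ψ : E) :
    U t (U (-t) ψ) = ψ := by
  rw [← mul_apply_eq_comp, ← hU.add, add_neg_cancel, hU.zero]
  rfl

/-- Split `w r = w s + (w r - w s)`. Only `w s` must lie in the domain of the generator; on the
difference quotient, isometry and strong continuity suffice. -/
theorem IsUnitaryGroup.hasDerivAt_neg_apply (hU : IsUnitaryGroup A U) {w : ℝ → E} {w' h : E}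
    {s : ℝ} (hw : HasDerivAt w w' s) (hh : (w s, h) ∈ A.graph) :
    HasDerivAt (fun r => U (-r) (w r)) (U (-s) (Complex.I • h + w')) s := by
  have h1 : HasDerivAt (fun r => U (-r) (w s)) (Complex.I • U (-s) h) s := by
    have := HasDerivAt.scomp s (hU.hasDerivAt hh (-s)) (hasDerivAt_neg s)
    simpa [Function.comp_def] using this
  have h2 : HasDerivAt (fun r => U (-r) (w r - w s)) (U (-s) w') s := by
    rw [hasDerivAt_iff_tendsto_slope] at hw ⊢
    have hlim : Tendsto (fun r => U (-r) (slope w s r - w') + U (-r) w') (𝓝[≠] s)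
        (𝓝 (0 + U (-s) w')) := by
      refine Tendsto.add ?_ ?_
      · rw [tendsto_zero_iff_norm_tendsto_zero]
        simp only [hU.norm_map]
        rw [← tendsto_zero_iff_norm_tendsto_zero]
        simpa using hw.sub_const w'
      · exact ((hU.continuous w').comp continuous_neg).continuousAt.tendsto.mono_left
          nhdsWithin_le_nhds
    rw [zero_add] at hlim
    refine hlim.congr fun r => ?_
    rw [← map_add, sub_add_cancel, slope_def_module, slope_def_module, sub_self, map_zero,
      sub_zero]
    exact ((U (-r)).restrictScalars ℝ).map_smul _ _
  have h3 := h1.add h2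
  rw [map_add, map_smul]
  refine h3.congr_of_eventuallyEq (Eventually.of_forall fun r => ?_)
  simp [map_sub]

/-- An approximate solution of the Schrödinger equation is close to the exact solution. -/
theorem IsUnitaryGroup.norm_sub_le (hU : IsUnitaryGroup A U) {w w' h : ℝ → E}
    (hw : ∀ s, HasDerivAt w (w' s) s) (hh : ∀ s, 0 ≤ s → (w s, h s) ∈ A.graph) {a ε p : ℝ}
    (hp : 1 < p) (ha : 0 ≤ a)
    (hb : ∀ s, 0 ≤ s → ‖Complex.I • h s + w' s‖ ≤ a * (1 + s) ^ (-p) + ε) {t : ℝ} (ht : 0 ≤ t) :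
    ‖w t - U t (w 0)‖ ≤ a / (p - 1) + ε * t := by
  have hp' : 0 < p - 1 := by linarith
  -- The antiderivative of the error bound that vanishes at `0`; it majorises the norm of `U(-s)
  -- w(s) - w(0)`.
  have hB : ∀ s, 0 ≤ s → HasDerivAt (fun s : ℝ => a / (p - 1) * (1 - (1 + s) ^ (1 - p)) + ε * s)
      (a * (1 + s) ^ (-p) + ε) s := by
    intro s hs
    have h1 : HasDerivAt (fun s : ℝ => (1 + s) ^ (1 - p)) ((1 - p) * (1 + s) ^ (-p)) s := by
      have := ((hasDerivAt_id s).const_add 1).rpow_const (p := 1 - p)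
        (Or.inl (by simp only [id_eq]; positivity))
      refine this.congr_deriv ?_
      simp only [id_eq, one_mul]
      rw [show 1 - p - 1 = -p by ring]
    refine (((h1.const_sub 1).const_mul (a / (p - 1))).add ((hasDerivAt_id s).const_mul ε)).congr_deriv ?_
    field_simp
    ring
  have hd : ∀ s, 0 ≤ s → HasDerivAt (fun r => U (-r) (w r) - w 0)
      (U (-s) (Complex.I • h s + w' s)) s := fun s hs =>
    (hU.hasDerivAt_neg_apply (hw s) (hh s hs)).sub_const _
  have key := image_norm_le_of_norm_deriv_right_le_deriv_boundary' (a := 0) (b := t)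
    (f := fun r => U (-r) (w r) - w 0) (f' := fun s => U (-s) (Complex.I • h s + w' s))
    (B := fun s : ℝ => a / (p - 1) * (1 - (1 + s) ^ (1 - p)) + ε * s)
    (B' := fun s => a * (1 + s) ^ (-p) + ε)
    (fun s hs => (hd s hs.1).continuousAt.continuousWithinAt)
    (fun s hs => (hd s hs.1).hasDerivWithinAt) (by simp [hU.zero])
    (fun s hs => (hB s hs.1).continuousAt.continuousWithinAt)
    (fun s hs => (hB s hs.1).hasDerivWithinAt)
    (fun s hs => by rw [hU.norm_map]; exact hb s hs.1) (Set.right_mem_Icc.2 ht)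
  have h1 : ‖w t - U t (w 0)‖ = ‖U (-t) (w t) - w 0‖ := by
    rw [← hU.norm_map t (U (-t) (w t) - w 0), map_sub, hU.apply_neg_apply]
  rw [h1]
  refine key.trans ?_
  have h2 : 0 ≤ a / (p - 1) * (1 + t) ^ (1 - p) := by positivity
  simp only [mul_sub, mul_one]
  linarith

end Duhamel

/-! ### Duhamel's formula for cut-off finite sums of product states. -/

section Product

variable {K : Type*} [NormedAddCommGroup K] [InnerProductSpace ℂ K] [CompleteSpace K]

/-- The Schwartz function `x ↦ φ(x) ⊗ χ`. -/
def tenS (χ : K) (φ : 𝓢(R3, Spin)) : 𝓢(R3, SpinTensor K) := φ.postcompCLM (spinTmul χ)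

@[simp] theorem tenS_apply (χ : K) (φ : 𝓢(R3, Spin)) (x : R3) :
    tenS χ φ x = spinTmul χ (φ x) := rfl

theorem toL2_add {E : Type*} [NormedAddCommGroup E] [InnerProductSpace ℂ E] (ψ φ : 𝓢(R3, E)) :
    toL2 E (ψ + φ) = toL2 E ψ + toL2 E φ := map_add _ _ _

theorem toL2_sub {E : Type*} [NormedAddCommGroup E] [InnerProductSpace ℂ E] (ψ φ : 𝓢(R3, E)) :
    toL2 E (ψ - φ) = toL2 E ψ - toL2 E φ := map_sub _ _ _

theorem toL2_tenS (χ : K) (φ : 𝓢(R3, Spin)) :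
    toL2 (SpinTensor K) (tenS χ φ) = tensor χ (toL2 Spin φ) := by
  refine Lp.ext ?_
  filter_upwards [coeFn_toL2 (tenS χ φ), coeFn_tensor χ (toL2 Spin φ), coeFn_toL2 φ]
    with x h1 h2 h3
  rw [h1, h2, h3, tenS_apply]

theorem freeS_tenS (t : ℝ) (χ : K) (φ : 𝓢(R3, Spin)) :
    freeS (SpinTensor K) t (tenS χ φ) = tenS χ (freeS Spin t φ) := freeS_postcomp _ t φ

theorem decoupled_toL2_tenS (UQ : ℝ → K →L[ℂ] K) (t : ℝ) (χ : K) (φ : 𝓢(R3, Spin)) :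
    decoupled UQ t (toL2 (SpinTensor K) (tenS χ φ))
      = toL2 (SpinTensor K) (tenS (UQ t χ) (freeS Spin t φ)) := by
  rw [toL2_tenS, decoupled_tensor, freeEvolution_toL2, toL2_tenS]

theorem mulS_smul {E : Type*} [NormedAddCommGroup E] [InnerProductSpace ℂ E] [CompleteSpace E]
    {f : R3 → ℝ} (hf : f.HasTemperateGrowth) (c : ℂ) (ψ : 𝓢(R3, E)) :
    mulS E f (c • ψ) = c • mulS E f ψ := by
  ext x
  rw [mulS_apply hf, smul_apply, smul_apply, mulS_apply hf, smul_comm]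

theorem mulS_tenS {f : R3 → ℝ} (hf : f.HasTemperateGrowth) (χ : K) (φ : 𝓢(R3, Spin)) :
    mulS (SpinTensor K) f (tenS χ φ) = tenS χ (mulS Spin f φ) := by
  ext x : 1
  rw [mulS_apply hf, tenS_apply, tenS_apply, mulS_apply hf]
  exact (((spinTmul χ).restrictScalars ℝ).map_smul _ _).symm

theorem lineDeriv_postcomp {E F : Type*} [NormedAddCommGroup E] [InnerProductSpace ℂ E]
    [NormedAddCommGroup F] [InnerProductSpace ℂ F] (A : E →L[ℂ] F) (m : R3) (ψ : 𝓢(R3, E)) :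
    (∂_{m} (ψ.postcompCLM A) : 𝓢(R3, F)) = (∂_{m} ψ : 𝓢(R3, E)).postcompCLM A := by
  ext x : 1
  have h : HasFDerivAt (ψ.postcompCLM A) ((A.restrictScalars ℝ) ∘L fderiv ℝ ψ x) x :=
    ((A.restrictScalars ℝ).hasFDerivAt (x := ψ x)).comp x ψ.differentiableAt.hasFDerivAt
  rw [SchwartzMap.lineDerivOp_apply_eq_fderiv, h.fderiv]
  change A (fderiv ℝ ψ x m) = A ((∂_{m} ψ : 𝓢(R3, E)) x)
  rw [SchwartzMap.lineDerivOp_apply_eq_fderiv]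

theorem commS_postcomp {E F : Type*} [NormedAddCommGroup E] [InnerProductSpace ℂ E]
    [CompleteSpace E] [NormedAddCommGroup F] [InnerProductSpace ℂ F] [CompleteSpace F]
    {C : Set R3} {b ε d : ℝ} {f : R3 → ℝ} {f₁ f₂ : Fin 3 → R3 → ℝ}
    (h : IsCutoff C b ε d f f₁ f₂) (A : E →L[ℂ] F) (ψ : 𝓢(R3, E)) :
    commS F f₁ f₂ (ψ.postcompCLM A) = (commS E f₁ f₂ ψ).postcompCLM A := by
  ext x : 1
  change _ = (A.restrictScalars ℝ) (commS E f₁ f₂ ψ x)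
  simp only [commS, smul_apply, sum_apply, add_apply, lineDeriv_postcomp, map_smul, map_sum,
    map_add, mulS_apply (h.growth₁ _), mulS_apply (h.growth₂ _)]
  rfl

theorem kinS_mulS_tenS_sub {C : Set R3} {b ε d : ℝ} {f : R3 → ℝ} {f₁ f₂ : Fin 3 → R3 → ℝ}
    (h : IsCutoff C b ε d f f₁ f₂) (φ : 𝓢(R3, Spin)) (χ : K) :
    tensor χ (toL2 Spin (kinS Spin (mulS Spin f φ))) - tensor χ (toL2 Spin (mulS Spin f (kinS Spin φ)))
      = toL2 (SpinTensor K) (commS (SpinTensor K) f₁ f₂ (tenS χ φ)) := by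
  have h1 : commS (SpinTensor K) f₁ f₂ (tenS χ φ) = tenS χ (commS Spin f₁ f₂ φ) :=
    commS_postcomp h (spinTmul χ) φ
  have h2 : kinS Spin (mulS Spin f φ) = mulS Spin f (kinS Spin φ) + commS Spin f₁ f₂ φ :=
    kinS_mulS h φ
  have h3 : toL2 Spin (kinS Spin (mulS Spin f φ))
      = toL2 Spin (mulS Spin f (kinS Spin φ)) + toL2 Spin (commS Spin f₁ f₂ φ) :=
    (congrArg (toL2 Spin) h2).trans (toL2_add _ _)
  have h4 : toL2 (SpinTensor K) (commS (SpinTensor K) f₁ f₂ (tenS χ φ))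
      = tensor χ (toL2 Spin (commS Spin f₁ f₂ φ)) :=
    (congrArg (toL2 (SpinTensor K)) h1).trans (toL2_tenS _ _)
  refine Eq.trans ?_ h4.symm
  exact sub_eq_of_eq_add' ((congrArg (tensor χ) h3).trans (map_add (tensor χ) _ _))

theorem commS_sum {E ι : Type*} [NormedAddCommGroup E] [InnerProductSpace ℂ E]
    [CompleteSpace E] (f₁ f₂ : Fin 3 → R3 → ℝ) (S : Finset ι) (ψ : ι → 𝓢(R3, E)) :
    commS E f₁ f₂ (∑ i ∈ S, ψ i) = ∑ i ∈ S, commS E f₁ f₂ (ψ i) := by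
  classical
  induction S using Finset.induction_on with
  | empty => simp [commS]
  | insert i S hi ih =>
    rw [Finset.sum_insert hi, Finset.sum_insert hi, ← ih]
    have := commS_sub f₁ f₂ (ψ i + ∑ i ∈ S, ψ i) (∑ i ∈ S, ψ i)
    rw [add_sub_cancel_right] at this
    rw [this, sub_add_cancel]

theorem freeS_zero {E : Type*} [NormedAddCommGroup E] [InnerProductSpace ℂ E] [CompleteSpace E]
    (ψ : 𝓢(R3, E)) : freeS E 0 ψ = ψ := by
  have h : 𝓕 (freeS E 0 ψ) = 𝓕 ψ := by
    rw [fourier_freeS]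
    ext x : 1
    rw [SchwartzMap.smulLeftCLM_apply_apply (hasTemperateGrowth_phase 0)]
    simp [phase]
  simpa using congrArg (fun φ => 𝓕⁻ φ) h

theorem integrable_norm_sq {E : Type*} [NormedAddCommGroup E] [InnerProductSpace ℂ E]
    (ψ : 𝓢(R3, E)) : Integrable (fun x => ‖ψ x‖ ^ 2) :=
  (memLp_two_iff_integrable_sq_norm ψ.continuous.aestronglyMeasurable).1 (ψ.memLp 2 volume)

theorem l2norm_sq {E : Type*} [NormedAddCommGroup E] [InnerProductSpace ℂ E] [CompleteSpace E]
    (ψ : 𝓢(R3, E)) : l2norm ψ ^ 2 = ∫ x, ‖ψ x‖ ^ 2 := by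
  rw [← norm_toL2, ← @inner_self_eq_norm_sq ℂ, L2.inner_def, ← integral_re]
  · refine integral_congr_ae ?_
    filter_upwards [coeFn_toL2 ψ] with x hx
    rw [hx, inner_self_eq_norm_sq]
  · exact L2.integrable_inner _ _

theorem hasDerivAt_mulS_freeS {f : R3 → ℝ} (hf : f.HasTemperateGrowth) {b : ℝ}
    (hb : ∀ x, |f x| ≤ b) (t : ℝ) (φ : 𝓢(R3, Spin)) :
    HasDerivAt (fun s => toL2 Spin (mulS Spin f (freeS Spin s φ)))
      (-Complex.I • toL2 Spin (mulS Spin f (freeS Spin t (kinS Spin φ)))) t := by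
  have hb0 : 0 ≤ b := (abs_nonneg _).trans (hb 0)
  refine hasDerivAt_of_norm_sub_le (C := b * (1 / 2 * l2norm (kinS Spin (kinS Spin φ))))
    fun r => ?_
  have h1 : toL2 Spin (mulS Spin f (freeS Spin (t + r) φ)) - toL2 Spin (mulS Spin f (freeS Spin t φ))
      - (r : ℂ) • (-Complex.I • toL2 Spin (mulS Spin f (freeS Spin t (kinS Spin φ))))
      = toL2 Spin (mulS Spin f (freeS Spin (t + r) φ - freeS Spin t φ
        - (-(r * Complex.I)) • freeS Spin t (kinS Spin φ))) := by
    rw [map_sub, map_sub, mulS_smul hf, map_sub, map_sub, map_smul, smul_smul, mul_neg]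
  rw [h1, norm_toL2]
  refine (l2norm_mulS_le hf hb _).trans ?_
  calc b * _ ≤ b * (r ^ 2 / 2 * l2norm (kinS Spin (kinS Spin φ))) :=
        mul_le_mul_of_nonneg_left (l2norm_freeS_sub_le t r φ) hb0
    _ = _ := by ring

theorem hasDerivAt_tensor_mulS_freeS {HQ : K →ₗ.[ℂ] K} {UQ : ℝ → K →L[ℂ] K}
    (hUQ : IsUnitaryGroup HQ UQ) {f : R3 → ℝ} (hf : f.HasTemperateGrowth) {b : ℝ}
    (hb : ∀ x, |f x| ≤ b) {χ ω : K} (hχ : (χ, ω) ∈ HQ.graph) (φ : 𝓢(R3, Spin)) (t : ℝ) :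
    HasDerivAt (fun s => tensor (UQ s χ) (toL2 Spin (mulS Spin f (freeS Spin s φ))))
      (-Complex.I • (tensor (UQ t χ) (toL2 Spin (mulS Spin f (freeS Spin t (kinS Spin φ))))
        + tensor (UQ t ω) (toL2 Spin (mulS Spin f (freeS Spin t φ))))) t := by
  have h := ContinuousLinearMap.hasDerivAt_of_bilinear
    (B := (tensor (K := K)).bilinearRestrictScalars ℝ)
    (fun _ => hUQ.hasDerivAt hχ t) (fun _ => hasDerivAt_mulS_freeS hf hb t φ)
  refine h.congr_deriv ?_
  simp only [ContinuousLinearMap.bilinearRestrictScalars_apply_apply, map_smul, smul_apply,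
    smul_add]

/-- The state `∑ᵢ φᵢ ⊗ χᵢ`. -/
def prodS {ι : Type*} (S : Finset ι) (χ : ι → K) (φ : ι → 𝓢(R3, Spin)) : 𝓢(R3, SpinTensor K) :=
  ∑ i ∈ S, tenS (χ i) (φ i)

theorem prodS_apply {ι : Type*} (S : Finset ι) (χ : ι → K) (φ : ι → 𝓢(R3, Spin)) (x : R3) :
    prodS S χ φ x = ∑ i ∈ S, spinTmul (χ i) (φ i x) := by
  simp [prodS, sum_apply]

theorem decoupled_toL2_prodS (UQ : ℝ → K →L[ℂ] K) (t : ℝ) {ι : Type*} (S : Finset ι) (χ : ι → K)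
    (φ : ι → 𝓢(R3, Spin)) :
    decoupled UQ t (toL2 (SpinTensor K) (prodS S χ φ))
      = toL2 (SpinTensor K) (prodS S (fun i => UQ t (χ i)) fun i => freeS Spin t (φ i)) := by
  simp only [prodS, map_sum, decoupled_toL2_tenS]

theorem toL2_prodS {ι : Type*} (S : Finset ι) (χ : ι → K) (φ : ι → 𝓢(R3, Spin)) :
    toL2 (SpinTensor K) (prodS S χ φ) = ∑ i ∈ S, tensor (χ i) (toL2 Spin (φ i)) := by
  simp only [prodS, map_sum, toL2_tenS]

theorem freeS_prodS (t : ℝ) {ι : Type*} (S : Finset ι) (χ : ι → K) (φ : ι → 𝓢(R3, Spin)) :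
    freeS (SpinTensor K) t (prodS S χ φ) = prodS S χ fun i => freeS Spin t (φ i) := by
  simp only [prodS, map_sum, freeS_tenS]

theorem mulS_prodS {f : R3 → ℝ} (hf : f.HasTemperateGrowth) {ι : Type*} (S : Finset ι) (χ : ι → K)
    (φ : ι → 𝓢(R3, Spin)) :
    mulS (SpinTensor K) f (prodS S χ φ) = prodS S χ fun i => mulS Spin f (φ i) := by
  simp only [prodS, map_sum, mulS_tenS hf]

theorem postcomp_prodS (A : K →L[ℂ] K) {ι : Type*} (S : Finset ι) (χ : ι → K)
    (φ : ι → 𝓢(R3, Spin)) :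
    (prodS S χ φ).postcompCLM (spinMap A) = prodS S (fun i => A (χ i)) φ := by
  ext x : 1
  change spinMap A (prodS S χ φ x) = _
  simp only [prodS_apply, map_sum, spinMap_spinTmul]

theorem toL2_prodS_mem_algTensor {HQ : K →ₗ.[ℂ] K} {ι : Type*} (S : Finset ι) {χ : ι → K}
    (hχ : ∀ i, χ i ∈ HQ.domain) (φ : ι → 𝓢(R3, Spin)) :
    toL2 (SpinTensor K) (prodS S χ φ) ∈ algTensor HQ := by
  rw [prodS, map_sum]
  refine Submodule.sum_mem _ fun i _ => Submodule.subset_span ⟨toL2 Spin (φ i), ?_, χ i, hχ i,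
    toL2_tenS _ _⟩
  exact LinearPMap.mem_domain_of_mem_graph (mem_graph_freeHamiltonian (φ i))

theorem l2norm_postcomp_spinMap {A : K →L[ℂ] K} (hA : ∀ χ, ‖A χ‖ = ‖χ‖)
    (ψ : 𝓢(R3, SpinTensor K)) : l2norm (ψ.postcompCLM (spinMap A)) = l2norm ψ :=
  le_antisymm (l2norm_le_of_norm_le fun x => (norm_spinMap hA (ψ x)).le)
    (l2norm_le_of_norm_le fun x => (norm_spinMap hA (ψ x)).ge)

theorem IsHamiltonian.mem_graph_tensor {HQ : K →ₗ.[ℂ] K} {HPQ H : HilbertPQ K →ₗ.[ℂ] HilbertPQ K}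
    (hH : IsHamiltonian HQ HPQ H) {φ φ' : HilbertP} (hφ : (φ, φ') ∈ freeHamiltonian.graph) {χ ω : K}
    (hχ : (χ, ω) ∈ HQ.graph) {Θ : HilbertPQ K} (hΘ : (tensor χ φ, Θ) ∈ HPQ.graph) :
    (tensor χ φ, tensor χ φ' + tensor ω φ + Θ) ∈ H.graph := by
  obtain ⟨x, rfl, rfl⟩ := (LinearPMap.mem_graph_iff _).1 hφ
  obtain ⟨y, rfl, rfl⟩ := (LinearPMap.mem_graph_iff _).1 hχ
  exact hH.apply_tensor x y Θ hΘ

/-- The Hamiltonian is given on single tensors only. Graphs are subspaces, so the summands add up,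
and single-valuedness of `HPQ` identifies the sum of the interaction terms with `Θ`. -/
theorem IsHamiltonian.mem_graph_toL2_prodS {HQ : K →ₗ.[ℂ] K} {HPQ H : HilbertPQ K →ₗ.[ℂ] HilbertPQ K}
    (hH : IsHamiltonian HQ HPQ H) (hdom : algTensor HQ ≤ HPQ.domain) {ι : Type*} (S : Finset ι)
    {χ ω : ι → K} (hχ : ∀ i, (χ i, ω i) ∈ HQ.graph) (φ : ι → 𝓢(R3, Spin)) {Θ : HilbertPQ K}
    (hΘ : (toL2 (SpinTensor K) (prodS S χ φ), Θ) ∈ HPQ.graph) :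
    (toL2 (SpinTensor K) (prodS S χ φ),
      ∑ i ∈ S, (tensor (χ i) (toL2 Spin (kinS Spin (φ i))) + tensor (ω i) (toL2 Spin (φ i))) + Θ)
      ∈ H.graph := by
  have hmem : ∀ i, ∃ Θ', (tensor (χ i) (toL2 Spin (φ i)), Θ') ∈ HPQ.graph := by
    intro i
    have h : tensor (χ i) (toL2 Spin (φ i)) ∈ HPQ.domain := hdom (Submodule.subset_span
      ⟨_, LinearPMap.mem_domain_of_mem_graph (mem_graph_freeHamiltonian (φ i)), _,
        LinearPMap.mem_domain_of_mem_graph (hχ i), rfl⟩)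
    exact ⟨HPQ ⟨_, h⟩, LinearPMap.mem_graph HPQ ⟨_, h⟩⟩
  choose Θ' hΘ' using hmem
  have hi : ∀ i, (tensor (χ i) (toL2 Spin (φ i)), (tensor (χ i) (toL2 Spin (kinS Spin (φ i)))
      + tensor (ω i) (toL2 Spin (φ i))) + Θ' i) ∈ H.graph := by
    intro i
    exact hH.mem_graph_tensor (mem_graph_freeHamiltonian (φ i)) (hχ i) (hΘ' i)
  have hsum := Submodule.sum_mem H.graph (t := S) fun i _ => hi i
  have hsum' := Submodule.sum_mem HPQ.graph (t := S) fun i _ => hΘ' i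
  rw [← prod_mk_sum, Finset.sum_add_distrib] at hsum
  rw [← prod_mk_sum] at hsum'
  have he : ∑ i ∈ S, tensor (χ i) (toL2 Spin (φ i)) = toL2 (SpinTensor K) (prodS S χ φ) := by
    simp only [prodS, map_sum, toL2_tenS]
  rw [he] at hsum hsum'
  rwa [LinearPMap.mem_graph_snd_inj HPQ hsum' hΘ rfl] at hsum

theorem kinS_mulS_prodS_sub {C : Set R3} {b ε d : ℝ} {f : R3 → ℝ} {f₁ f₂ : Fin 3 → R3 → ℝ}
    (h : IsCutoff C b ε d f f₁ f₂) {ι : Type*} (S : Finset ι) (χ : ι → K)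
    (φ : ι → 𝓢(R3, Spin)) :
    ∑ i ∈ S, tensor (χ i) (toL2 Spin (kinS Spin (mulS Spin f (φ i))))
      - ∑ i ∈ S, tensor (χ i) (toL2 Spin (mulS Spin f (kinS Spin (φ i))))
      = toL2 (SpinTensor K) (commS (SpinTensor K) f₁ f₂ (prodS S χ φ)) := by
  rw [← Finset.sum_sub_distrib, prodS, commS_sum, map_sum]
  exact Finset.sum_congr rfl fun i _ => kinS_mulS_tenS_sub h (φ i) (χ i)

theorem smul_sum_add_smul_sum {V ι : Type*} [AddCommGroup V] [Module ℂ V] (S : Finset ι)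
    (x y z : ι → V) (Θ : V) :
    Complex.I • (∑ i ∈ S, (x i + z i) + Θ) + ∑ i ∈ S, -Complex.I • (y i + z i)
      = Complex.I • (∑ i ∈ S, x i - ∑ i ∈ S, y i + Θ) := by
  rw [← Finset.smul_sum, Finset.sum_add_distrib, Finset.sum_add_distrib]
  module

/-- The terms with `H_Q` cancel, and the two kinetic terms combine to the commutator with `f`.
Writing `A`, the evolution of `Q`, outside the commutator allows its isometry to remove it from the
norm. -/
theorem duhamel_integrand {C : Set R3} {b ε d : ℝ} {f : R3 → ℝ} {f₁ f₂ : Fin 3 → R3 → ℝ}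
    (hf : IsCutoff C b ε d f f₁ f₂) (A : K →L[ℂ] K) {ι : Type*} (S : Finset ι) (χ ω : ι → K)
    (φ : ι → 𝓢(R3, Spin)) (s : ℝ) (Θ : HilbertPQ K) :
    Complex.I • (∑ i ∈ S, (tensor (A (χ i)) (toL2 Spin (kinS Spin (mulS Spin f (freeS Spin s (φ i)))))
      + tensor (A (ω i)) (toL2 Spin (mulS Spin f (freeS Spin s (φ i))))) + Θ)
      + ∑ i ∈ S, -Complex.I •
        (tensor (A (χ i)) (toL2 Spin (mulS Spin f (freeS Spin s (kinS Spin (φ i)))))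
        + tensor (A (ω i)) (toL2 Spin (mulS Spin f (freeS Spin s (φ i)))))
      = Complex.I • (toL2 (SpinTensor K) ((commS (SpinTensor K) f₁ f₂
        (freeS (SpinTensor K) s (prodS S χ φ))).postcompCLM (spinMap A)) + Θ) := by
  have h1 : (commS (SpinTensor K) f₁ f₂ (freeS (SpinTensor K) s (prodS S χ φ))).postcompCLM
      (spinMap A) = commS (SpinTensor K) f₁ f₂
        (prodS S (fun i => A (χ i)) fun i => freeS Spin s (φ i)) := by
    rw [← commS_postcomp hf (spinMap A), freeS_prodS,
      postcomp_prodS A S χ fun i => freeS Spin s (φ i)]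
  have h2 := kinS_mulS_prodS_sub hf S (fun i => A (χ i)) fun i => freeS Spin s (φ i)
  have h3 : ∀ i, kinS Spin (freeS Spin s (φ i)) = freeS Spin s (kinS Spin (φ i)) := fun i =>
    kinS_freeS s (φ i)
  simp only [h3] at h2
  refine (smul_sum_add_smul_sum S _ _ _ Θ).trans (congrArg (fun T => Complex.I • (T + Θ)) ?_)
  exact h2.trans (congrArg (toL2 (SpinTensor K)) h1.symm)
-- Pointwise `(1 - f)² + f² ≤ 1`, because `f(1 - f) ≥ 0`.
theorem l2norm_sub_mulS_sq_le {f : R3 → ℝ} (hf : f.HasTemperateGrowth) (h0 : ∀ x, 0 ≤ f x)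
    (h1 : ∀ x, f x ≤ 1) (ψ : 𝓢(R3, SpinTensor K)) :
    l2norm (ψ - mulS (SpinTensor K) f ψ) ^ 2 + l2norm (mulS (SpinTensor K) f ψ) ^ 2
      ≤ l2norm ψ ^ 2 := by
  simp only [l2norm_sq]
  rw [← integral_add (integrable_norm_sq _) (integrable_norm_sq _)]
  refine integral_mono ((integrable_norm_sq _).add (integrable_norm_sq _)) (integrable_norm_sq _)
    fun x => ?_
  have h2 : ψ x - f x • ψ x = (1 - f x) • ψ x := by rw [sub_smul, one_smul]
  simp only [sub_apply, mulS_apply hf, h2, norm_smul, Real.norm_eq_abs, mul_pow, sq_abs]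
  have h3 := mul_nonneg (h0 x) (sub_nonneg.2 (h1 x))
  nlinarith [sq_nonneg ‖ψ x‖]

theorem norm_duhamel_le {HQ : K →ₗ.[ℂ] K} {UQ : ℝ → K →L[ℂ] K}
    {HPQ H : HilbertPQ K →ₗ.[ℂ] HilbertPQ K} {U : ℝ → HilbertPQ K →L[ℂ] HilbertPQ K}
    (hUQ : IsUnitaryGroup HQ UQ) (hH : IsHamiltonian HQ HPQ H) (hU : IsUnitaryGroup H U)
    (hdom : algTensor HQ ≤ HPQ.domain) {C : Set R3} {b ε d : ℝ} {f : R3 → ℝ}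
    {f₁ f₂ : Fin 3 → R3 → ℝ} (hf : IsCutoff C b ε d f f₁ f₂) {ι : Type*} (S : Finset ι)
    {χ : ι → K} (hχ : ∀ i, χ i ∈ HQ.domain) (φ : ι → 𝓢(R3, Spin)) {a ε' p : ℝ} (ha : 0 ≤ a)
    (hp : 1 < p) (hb : ∀ s, 0 ≤ s → ∀ Θ,
      (toL2 (SpinTensor K) (prodS S (fun i => UQ s (χ i)) fun i => mulS Spin f (freeS Spin s (φ i))),
        Θ) ∈ HPQ.graph →
      l2norm (commS (SpinTensor K) f₁ f₂ (freeS (SpinTensor K) s (prodS S χ φ))) + ‖Θ‖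
        ≤ a * (1 + s) ^ (-p) + ε') {t : ℝ} (ht : 0 ≤ t) :
    ‖toL2 (SpinTensor K) (prodS S (fun i => UQ t (χ i)) fun i => mulS Spin f (freeS Spin t (φ i)))
      - U t (toL2 (SpinTensor K) (prodS S χ fun i => mulS Spin f (φ i)))‖
      ≤ a / (p - 1) + ε' * t := by
  have hω : ∀ i, ∃ ω, (χ i, ω) ∈ HQ.graph := fun i =>
    ⟨HQ ⟨χ i, hχ i⟩, LinearPMap.mem_graph HQ ⟨χ i, hχ i⟩⟩
  choose ω hω using hω
  have hfb : ∀ x, |f x| ≤ 1 := fun x => abs_le.2 ⟨by linarith [hf.nonneg x], hf.le_one x⟩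
  have hderiv : ∀ s, HasDerivAt (fun s => toL2 (SpinTensor K)
      (prodS S (fun i => UQ s (χ i)) fun i => mulS Spin f (freeS Spin s (φ i))))
      (∑ i ∈ S, -Complex.I •
      (tensor (UQ s (χ i)) (toL2 Spin (mulS Spin f (freeS Spin s (kinS Spin (φ i)))))
        + tensor (UQ s (ω i)) (toL2 Spin (mulS Spin f (freeS Spin s (φ i)))))) s := by
    intro s
    have := HasDerivAt.fun_sum (u := S) fun i _ =>
      hasDerivAt_tensor_mulS_freeS hUQ hf.growth hfb (hω i) (φ i) s
    exact this.congr_of_eventuallyEq (Eventually.of_forall fun s => toL2_prodS S _ _)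
  have hΘ : ∀ s, ∃ Θ, (toL2 (SpinTensor K)
      (prodS S (fun i => UQ s (χ i)) fun i => mulS Spin f (freeS Spin s (φ i))), Θ) ∈ HPQ.graph := by
    intro s
    have h := hdom (toL2_prodS_mem_algTensor S
        (fun i => LinearPMap.mem_domain_of_mem_graph (hUQ.mem_graph (hω i) s))
        fun i => mulS Spin f (freeS Spin s (φ i)))
    exact ⟨HPQ ⟨_, h⟩, LinearPMap.mem_graph HPQ ⟨_, h⟩⟩
  choose Θ hΘ using hΘ
  have key := hU.norm_sub_le (ε := ε') (a := a) hderiv (fun s _ =>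
    hH.mem_graph_toL2_prodS hdom S (fun i => hUQ.mem_graph (hω i) s) _ (hΘ s)) hp ha (fun s hs => by
      refine (congrArg norm (duhamel_integrand hf (UQ s) S χ ω φ s (Θ s))).le.trans ?_
      rw [norm_smul, Complex.norm_I, one_mul]
      refine (norm_add_le _ _).trans ?_
      rw [norm_toL2, l2norm_postcomp_spinMap (hUQ.norm_map s)]
      exact hb s hs (Θ s) (hΘ s)) ht
  have h0 : (prodS S (fun i => UQ 0 (χ i)) fun i => mulS Spin f (freeS Spin 0 (φ i)))
      = prodS S χ fun i => mulS Spin f (φ i) := by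
    simp only [freeS_zero, hUQ.zero, one_apply_eq_self]
  exact (congrArg (fun ψ => ‖toL2 (SpinTensor K) (prodS S (fun i => UQ t (χ i))
    fun i => mulS Spin f (freeS Spin t (φ i))) - U t (toL2 (SpinTensor K) ψ)‖) h0).symm.le.trans key

/-- The exact and the decoupled evolution of `Φ = ∑ᵢ φᵢ ⊗ χᵢ` are close if the commutator of the
kinetic energy with the cut-off and the interaction, restricted to the region selected by the
cut-off, are integrable in time. -/
theorem norm_exact_sub_decoupled_le {HQ : K →ₗ.[ℂ] K} {UQ : ℝ → K →L[ℂ] K}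
    {HPQ H : HilbertPQ K →ₗ.[ℂ] HilbertPQ K} {U : ℝ → HilbertPQ K →L[ℂ] HilbertPQ K}
    (hUQ : IsUnitaryGroup HQ UQ) (hH : IsHamiltonian HQ HPQ H) (hU : IsUnitaryGroup H U)
    (hdom : algTensor HQ ≤ HPQ.domain) {C : Set R3} {b ε d : ℝ} {f : R3 → ℝ}
    {f₁ f₂ : Fin 3 → R3 → ℝ} (hf : IsCutoff C b ε d f f₁ f₂) {ι : Type*} (S : Finset ι)
    {χ : ι → K} (hχ : ∀ i, χ i ∈ HQ.domain) (φ : ι → 𝓢(R3, Spin)) {a ε' p : ℝ} (ha : 0 ≤ a)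
    (hp : 1 < p) (hb : ∀ s, 0 ≤ s → ∀ Θ,
      (toL2 (SpinTensor K) (prodS S (fun i => UQ s (χ i)) fun i => mulS Spin f (freeS Spin s (φ i))),
        Θ) ∈ HPQ.graph →
      l2norm (commS (SpinTensor K) f₁ f₂ (freeS (SpinTensor K) s (prodS S χ φ))) + ‖Θ‖
        ≤ a * (1 + s) ^ (-p) + ε') {t r : ℝ} (ht : 0 ≤ t)
    (hr : l2norm (prodS S χ φ - mulS (SpinTensor K) f (prodS S χ φ)) + (a / (p - 1) + ε' * t) ≤ r) :
    ‖U t (toL2 (SpinTensor K) (prodS S χ φ)) - decoupled UQ t (toL2 (SpinTensor K) (prodS S χ φ))‖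
      ≤ r + Real.sqrt (2 * l2norm (prodS S χ φ) * r) := by
  have hdu := norm_duhamel_le hUQ hH hU hdom hf S hχ φ ha hp hb ht
  have hfb : ∀ x, |f x| ≤ 1 := fun x => abs_le.2 ⟨by linarith [hf.nonneg x], hf.le_one x⟩
  have hVt := decoupled_toL2_prodS UQ t S χ φ
  have hnorm := congrArg norm hVt
  rw [norm_decoupled hUQ.norm_map, norm_toL2, norm_toL2] at hnorm
  rw [hVt]
  rw [← mulS_prodS hf.growth, ← mulS_prodS hf.growth] at hdu
  clear hVt hb
  generalize prodS S (fun i => UQ t (χ i)) (fun i => freeS Spin t (φ i)) = Φt at hdu hnorm ⊢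
  generalize prodS S χ φ = Φ at hdu hnorm hr ⊢
  have hsq := l2norm_sub_mulS_sq_le hf.growth hf.nonneg hf.le_one Φt
  have hupp := l2norm_mulS_le hf.growth hfb Φt
  have hlow : l2norm Φ ≤ l2norm (Φ - mulS (SpinTensor K) f Φ) + l2norm (mulS (SpinTensor K) f Φ) := by
    simpa using l2norm_add_le (Φ - mulS (SpinTensor K) f Φ) (mulS (SpinTensor K) f Φ)
  have h1 : l2norm (mulS (SpinTensor K) f Φ) ≤ l2norm (mulS (SpinTensor K) f Φt)
      + (a / (p - 1) + ε' * t) := by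
    have := norm_sub_norm_le (U t (toL2 (SpinTensor K) (mulS (SpinTensor K) f Φ)))
      (toL2 (SpinTensor K) (mulS (SpinTensor K) f Φt))
    rw [norm_sub_rev, hU.norm_map, norm_toL2, norm_toL2] at this
    linarith
  -- The preceding estimates give `‖Φ‖ - ‖f Φt‖ ≤ r`, while `‖Φt‖ = ‖Φ‖`. Hence `‖(1-f)Φt‖² ≤ ‖Φ‖² -
  -- ‖f Φt‖² ≤ 2‖Φ‖ r`.
  have hV : l2norm (Φt - mulS (SpinTensor K) f Φt) ≤ Real.sqrt (2 * l2norm Φ * r) := by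
    refine Real.le_sqrt_of_sq_le ?_
    nlinarith [l2norm_nonneg (mulS (SpinTensor K) f Φt), l2norm_nonneg Φ,
      l2norm_nonneg (Φ - mulS (SpinTensor K) f Φ)]
  -- Three errors: the cut-off at time `0`, the Duhamel error, and the cut-off at time `t`.
  have hdec : U t (toL2 (SpinTensor K) Φ) - toL2 (SpinTensor K) Φt
      = U t (toL2 (SpinTensor K) (Φ - mulS (SpinTensor K) f Φ))
        - (toL2 (SpinTensor K) (mulS (SpinTensor K) f Φt)
          - U t (toL2 (SpinTensor K) (mulS (SpinTensor K) f Φ)))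
        - toL2 (SpinTensor K) (Φt - mulS (SpinTensor K) f Φt) := by
    rw [toL2_sub, toL2_sub, map_sub]
    abel
  rw [hdec]
  refine (norm_sub_le _ _).trans (add_le_add ((norm_sub_le _ _).trans ?_) hV)
  rw [hU.norm_map, norm_toL2]
  linarith

end Product

end ClosedSystem

end

noncomputable section

namespace ClosedSystem

/-! ### The interaction in the region selected by the cut-off -/

/-! ### Distances between the cubes, the cone and the support of the cut-off. -/

section Geometry

theorem isBounded_nonempty_of_isOpenCube {S : Set R3} (hS : IsOpenCube S) :
    Bornology.IsBounded S ∧ S.Nonempty := by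
  obtain ⟨g, ℓ, hℓ, rfl⟩ := hS
  constructor
  · refine g.isometry.lipschitz.isBounded_image ((Metric.isBounded_iff_subset_closedBall 0).2
      ⟨Real.sqrt (3 * ℓ ^ 2), fun x hx => ?_⟩)
    rw [mem_closedBall_zero_iff]
    refine Real.le_sqrt_of_sq_le ?_
    rw [EuclideanSpace.norm_sq_eq]
    calc ∑ i, ‖x i‖ ^ 2 ≤ ∑ _i : Fin 3, ℓ ^ 2 := by
          refine Finset.sum_le_sum fun i _ => ?_
          rw [Real.norm_eq_abs, sq_abs]
          exact pow_le_pow_left₀ (hx i).1.le (hx i).2.le 2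
      _ = 3 * ℓ ^ 2 := by simp
  · exact ⟨_, WithLp.toLp 2 fun _ => ℓ / 2, fun i => ⟨by simp [hℓ], by simp [hℓ]⟩, rfl⟩

theorem setDist_le {S C : Set R3} {x y : R3} (hx : x ∈ S) (hy : y ∈ C) : setDist S C ≤ dist x y := by
  refine csInf_le ⟨0, ?_⟩ (Set.mem_image2_of_mem hx hy)
  rintro _ ⟨a, _, b, _, rfl⟩
  exact dist_nonneg

theorem le_setDist {S C : Set R3} (hS : S.Nonempty) (hC : C.Nonempty) {d : ℝ}
    (h : ∀ x ∈ S, ∀ y ∈ C, d ≤ dist x y) : d ≤ setDist S C := by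
  refine le_csInf (hS.image2 hC) ?_
  rintro _ ⟨a, ha, b, hb, rfl⟩
  exact h a ha b hb

/-- Far away from a small set `S` and close to `C`, negative powers of the distance to `S` decay
both in the distance of `S` to `C` and in the position. -/
theorem rpow_mul_le_infDist_rpow {S C : Set R3} (hS : Bornology.IsBounded S) (hC : C.Nonempty)
    {d L α : ℝ} (hα : 1 < α) (hd : 1 ≤ d) (hL : 2 * L ≤ d) (hdiam : Metric.diam S ≤ L)
    (hdist : ∀ x ∈ S, ∀ y ∈ C, d ≤ dist x y) {z x c : R3} (hz : z ∈ S) (hc : c ∈ C)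
    (hxc : dist x c ≤ d / 2) :
    1 ≤ 4 ^ α * setDist S C ^ ((1 - α) / 2) * (1 + ‖x - z‖) ^ (-((1 + α) / 2))
      * Metric.infDist x S ^ α := by
  have hne : S.Nonempty := ⟨z, hz⟩
  have hdn : d ≤ setDist S C := le_setDist hne hC hdist
  set D := setDist S C with hD
  -- The point `x` is within `d/2 ≤ D/2` of a point of `C`, which has distance at least `D` from
  -- `S`.
  have hρ : D / 2 ≤ Metric.infDist x S := by
    refine (Metric.le_infDist hne).2 fun y hy => ?_
    have h1 := setDist_le hy hc
    have h2 := dist_triangle y x c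
    rw [dist_comm y x] at h2
    linarith
  have h1 : ‖x - z‖ ≤ Metric.infDist x S + L := by
    rw [← dist_eq_norm]
    exact (Metric.dist_le_infDist_add_diam hS hz).trans (by linarith)
  set ρ := Metric.infDist x S with hρ'
  have hρ0 : 0 < ρ := by linarith
  have hD0 : 0 < D := by linarith
  -- Since `2ρ ≥ D ≥ d`, both `1` and `2L` are at most `2ρ`, so `1 + L ≤ 3ρ`.
  have h2 : 1 + ‖x - z‖ ≤ 4 * ρ := by linarith
  -- The exponent `α` is shared out as `(α - 1)/2` for the distance to the cone and `(1 + α)/2 > 1`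
  -- for the position.
  have h3 : D ^ ((α - 1) / 2) * (1 + ‖x - z‖) ^ ((1 + α) / 2) ≤ (4 * ρ) ^ α := by
    calc D ^ ((α - 1) / 2) * (1 + ‖x - z‖) ^ ((1 + α) / 2)
        ≤ (4 * ρ) ^ ((α - 1) / 2) * (4 * ρ) ^ ((1 + α) / 2) := by
          refine mul_le_mul (Real.rpow_le_rpow hD0.le (by linarith) (by linarith))
            (Real.rpow_le_rpow (by positivity) h2 (by linarith)) (by positivity) (by positivity)
      _ = (4 * ρ) ^ α := by rw [← Real.rpow_add (by positivity)]; ring_nf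
  have h4 : D ^ ((1 - α) / 2) * D ^ ((α - 1) / 2) = 1 := by
    rw [← Real.rpow_add hD0, show (1 - α) / 2 + (α - 1) / 2 = 0 by ring, Real.rpow_zero]
  have h5 : (1 + ‖x - z‖) ^ (-((1 + α) / 2)) * (1 + ‖x - z‖) ^ ((1 + α) / 2) = 1 := by
    rw [← Real.rpow_add (by positivity), neg_add_cancel, Real.rpow_zero]
  calc (1 : ℝ) = D ^ ((1 - α) / 2) * (1 + ‖x - z‖) ^ (-((1 + α) / 2)) *
        (D ^ ((α - 1) / 2) * (1 + ‖x - z‖) ^ ((1 + α) / 2)) := by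
        rw [mul_mul_mul_comm, h4, h5, one_mul]
    _ ≤ D ^ ((1 - α) / 2) * (1 + ‖x - z‖) ^ (-((1 + α) / 2)) * (4 * ρ) ^ α := by gcongr
    _ = _ := by rw [Real.mul_rpow (by norm_num) hρ0.le]; ring

end Geometry

/-! ### Local decay by interpolation between dispersion and conservation of the norm. -/

section Decay

variable {E : Type*} [NormedAddCommGroup E] [InnerProductSpace ℂ E] [CompleteSpace E]

/-- The rate of decay in time of a free wave packet in the weighted space with weight
`(1 + |x|)^{-a}`. -/
def decayExponent (a : ℝ) : ℝ := min ((1 + a) / 2) (5 / 4)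

theorem one_lt_decayExponent {a : ℝ} (ha : 1 < a) : 1 < decayExponent a :=
  lt_min (by linarith) (by norm_num)

/-- The rate `p` is chosen below `a`, so the exponent `3a/p` exceeds the dimension `3`. -/
theorem integrable_weight {a : ℝ} (ha : 1 < a) (y : R3) :
    Integrable fun x : R3 => (1 + ‖x - y‖) ^ (-(3 * a / decayExponent a)) := by
  have hp := one_lt_decayExponent ha
  have hpa : decayExponent a < a := (min_le_left _ _).trans_lt (by linarith)
  refine Integrable.comp_sub_right (f := fun x : R3 => (1 + ‖x‖) ^ (-(3 * a / decayExponent a)))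
    (integrable_one_add_norm ?_) y
  rw [finrank_euclideanSpace, Fintype.card_fin, lt_div_iff₀ (by linarith)]
  push_cast
  linarith

/-- Write `g² = g^{4p/3} (g²)^{1-2p/3}`. The first factor is estimated by the supremum; the second,
together with the weight, by the weighted arithmetic-geometric mean inequality. For `σ = s^{-3/2}`
this yields the rate `s^{-2p}` for the square. -/
theorem integral_weight_mul_sq_le {a : ℝ} (ha : 1 < a) {g : R3 → ℝ} (hg : ∀ x, 0 ≤ g x)
    (hgi : Integrable fun x => g x ^ 2) {σ : ℝ} (hσ : 0 ≤ σ) (hgσ : ∀ x, g x ≤ σ)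
    (hg2 : ∫ x, g x ^ 2 ≤ 1) (y : R3) :
    ∫ x, ((1 + ‖x - y‖) ^ (-a) * g x) ^ 2 ≤ σ ^ (4 * decayExponent a / 3) *
      ((∫ x : R3, (1 + ‖x‖) ^ (-(3 * a / decayExponent a))) + 1) := by
  have hp := one_lt_decayExponent ha
  have hp' : decayExponent a ≤ 5 / 4 := min_le_right _ _
  set p := decayExponent a with hp_def
  have hW := integrable_weight ha y
  rw [← hp_def] at hW
  have hpt : ∀ x, ((1 + ‖x - y‖) ^ (-a) * g x) ^ 2 ≤ σ ^ (4 * p / 3) *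
      ((1 + ‖x - y‖) ^ (-(3 * a / p)) + g x ^ 2) := by
    intro x
    have hx : 0 < 1 + ‖x - y‖ := by positivity
    -- The weights are admissible because `p ≤ 5/4 < 3/2`.
    have h1 := Real.geom_mean_le_arith_mean2_weighted (w₁ := 2 * p / 3) (w₂ := 1 - 2 * p / 3)
      (p₁ := (1 + ‖x - y‖) ^ (-(3 * a / p))) (p₂ := g x ^ 2) (by linarith) (by linarith)
      (by positivity) (by positivity) (by ring)
    have h2 : ((1 + ‖x - y‖) ^ (-(3 * a / p))) ^ (2 * p / 3) = ((1 + ‖x - y‖) ^ (-a)) ^ 2 := by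
      rw [← Real.rpow_mul hx.le, ← Real.rpow_natCast, ← Real.rpow_mul hx.le]
      congr 1
      field_simp
      push_cast
      ring
    have h3 : g x ^ 2 = g x ^ (4 * p / 3) * (g x ^ 2) ^ (1 - 2 * p / 3) := by
      rw [← Real.rpow_natCast (g x) 2, ← Real.rpow_mul (hg x), ← Real.rpow_add_of_nonneg (hg x)
        (by linarith) (by push_cast; linarith)]
      congr 1
      push_cast
      ring
    have h4 : g x ^ (4 * p / 3) ≤ σ ^ (4 * p / 3) :=
      Real.rpow_le_rpow (hg x) (hgσ x) (by linarith)
    have h5 : 0 ≤ (1 + ‖x - y‖) ^ (-(3 * a / p)) := by positivity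
    rw [h2] at h1
    calc ((1 + ‖x - y‖) ^ (-a) * g x) ^ 2
        = g x ^ (4 * p / 3) * (((1 + ‖x - y‖) ^ (-a)) ^ 2 * (g x ^ 2) ^ (1 - 2 * p / 3)) := by
          rw [mul_pow]
          conv_lhs => rw [h3]
          ring
      _ ≤ σ ^ (4 * p / 3) * (((1 + ‖x - y‖) ^ (-a)) ^ 2 * (g x ^ 2) ^ (1 - 2 * p / 3)) := by
          gcongr
      _ ≤ _ := by
          refine mul_le_mul_of_nonneg_left (h1.trans ?_) (by positivity)
          nlinarith [sq_nonneg (g x)]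
  refine (integral_mono_of_nonneg (Eventually.of_forall fun x => sq_nonneg _)
    ((hW.add hgi).const_mul _) (Eventually.of_forall hpt)).trans ?_
  simp only [Pi.add_apply]
  rw [integral_const_mul, integral_add hW hgi,
    integral_sub_right_eq_self (fun x : R3 => (1 + ‖x‖) ^ (-(3 * a / p)))]
  gcongr

/-- Local decay of free wave packets. -/
theorem exists_integral_weight_freeS_le {a : ℝ} (ha : 1 < a) :
    ∃ κ : ℝ, 0 ≤ κ ∧ ∀ (E : Type*) [NormedAddCommGroup E] [InnerProductSpace ℂ E] [CompleteSpace E]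
      (F : 𝓢(R3, E)) {B s : ℝ}, 0 ≤ s → ∫ x, ‖F x‖ ≤ B → l2norm F ≤ B → ∀ y,
      ∫ x, ((1 + ‖x - y‖) ^ (-a) * ‖freeS E s F x‖) ^ 2
        ≤ (κ * B * (1 + s) ^ (-decayExponent a)) ^ 2 := by
  set p := decayExponent a with hp_def
  have hp := one_lt_decayExponent ha
  rw [← hp_def] at hp
  set J := (∫ x : R3, (1 + ‖x‖) ^ (-(3 * a / p))) + 1 with hJ
  have hJ1 : 1 ≤ J := by
    have : 0 ≤ ∫ x : R3, (1 + ‖x‖) ^ (-(3 * a / p)) := integral_nonneg fun x => by positivity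
    linarith
  refine ⟨2 ^ p * Real.sqrt J, by positivity, ?_⟩
  intro E _ _ _ F B s hs h1 h2 y
  have hB : 0 ≤ B := (l2norm_nonneg F).trans h2
  have h2s : (∫ x, ‖freeS E s F x‖ ^ 2) ≤ B ^ 2 := by
    rw [← l2norm_sq, l2norm_freeS]
    exact pow_le_pow_left₀ (l2norm_nonneg F) h2 2
  have hint := integrable_norm_sq (freeS E s F)
  have hR : (2 ^ p * Real.sqrt J * B * (1 + s) ^ (-p)) ^ 2
      = J * B ^ 2 * ((2 / (1 + s)) ^ p) ^ 2 := by
    rw [Real.div_rpow (by norm_num) (by positivity), Real.rpow_neg (by positivity)]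
    rw [mul_pow, mul_pow, mul_pow, Real.sq_sqrt (by linarith)]
    ring
  rw [hR]
  rcases le_total s 1 with hs1 | hs1
  · have h3 : 1 ≤ (2 / (1 + s)) ^ p :=
      Real.one_le_rpow ((one_le_div (by positivity)).2 (by linarith)) (by linarith)
    calc ∫ x, ((1 + ‖x - y‖) ^ (-a) * ‖freeS E s F x‖) ^ 2
        ≤ ∫ x, ‖freeS E s F x‖ ^ 2 := by
          refine integral_mono_of_nonneg (Eventually.of_forall fun x => sq_nonneg _) hint
            (Eventually.of_forall fun x => ?_)
          refine pow_le_pow_left₀ (by positivity) (mul_le_of_le_one_left (norm_nonneg _) ?_) 2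
          exact Real.rpow_le_one_of_one_le_of_nonpos (by linarith [norm_nonneg (x - y)])
            (by linarith)
      _ ≤ B ^ 2 := h2s
      _ = 1 * B ^ 2 * 1 ^ 2 := by ring
      _ ≤ _ := by gcongr
  -- The main case divides by `B`, so a vanishing bound is treated separately.
  · rcases hB.eq_or_lt with hB0 | hB0
    · have h4 : l2norm F = 0 := le_antisymm (hB0 ▸ h2) (l2norm_nonneg F)
      have h5 : (∫ x, ‖freeS E s F x‖ ^ 2) = 0 := by
        rw [← l2norm_sq, l2norm_freeS, h4]
        ring
      refine le_trans ?_ (show (0 : ℝ) ≤ _ by positivity)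
      rw [← h5]
      refine integral_mono_of_nonneg (Eventually.of_forall fun x => sq_nonneg _) hint
            (Eventually.of_forall fun x => ?_)
      refine pow_le_pow_left₀ (by positivity) (mul_le_of_le_one_left (norm_nonneg _) ?_) 2
      exact Real.rpow_le_one_of_one_le_of_nonpos (by linarith [norm_nonneg (x - y)])
            (by linarith)
    have hs0 : 0 < s := by linarith
    have hsup : ∀ x, ‖freeS E s F x‖ / B ≤ s ^ (-(3 / 2) : ℝ) := by
      intro x
      rw [div_le_iff₀ hB0]
      refine (norm_freeS_le hs0 F x).trans (mul_le_mul ?_ h1 (integral_nonneg fun _ => norm_nonneg _)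
        (by positivity))
      refine Real.rpow_le_rpow_of_nonpos hs0 ?_ (by norm_num)
      nlinarith [Real.pi_gt_three]
    have h6 := integral_weight_mul_sq_le ha (g := fun x => ‖freeS E s F x‖ / B)
      (fun x => by positivity) (by simp only [div_pow]; exact hint.div_const _) (by positivity)
      hsup (by
        simp only [div_pow]
        rw [integral_div, div_le_one (by positivity)]
        exact h2s) y
    rw [← hp_def, ← hJ] at h6
    have h7 : ∫ x, ((1 + ‖x - y‖) ^ (-a) * ‖freeS E s F x‖) ^ 2
        = B ^ 2 * ∫ x, ((1 + ‖x - y‖) ^ (-a) * (‖freeS E s F x‖ / B)) ^ 2 := by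
      rw [← integral_const_mul]
      refine integral_congr_ae (Eventually.of_forall fun x => ?_)
      field_simp
    -- The left side is `s^{-2p}`, and `1 + s ≤ 2s` for `s ≥ 1`.
    have h8 : (s ^ (-(3 / 2) : ℝ)) ^ (4 * p / 3) ≤ ((2 / (1 + s)) ^ p) ^ 2 := by
      rw [← Real.rpow_mul hs0.le, show -(3 / 2) * (4 * p / 3) = -p * (2 : ℕ) by push_cast; ring,
        Real.rpow_mul hs0.le, Real.rpow_natCast, Real.rpow_neg hs0.le, ← Real.inv_rpow hs0.le]
      refine pow_le_pow_left₀ (by positivity) (Real.rpow_le_rpow (by positivity) ?_ (by linarith)) 2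
      rw [inv_eq_one_div, div_le_div_iff₀ hs0 (by positivity)]
      linarith
    rw [h7]
    calc B ^ 2 * ∫ x, ((1 + ‖x - y‖) ^ (-a) * (‖freeS E s F x‖ / B)) ^ 2
        ≤ B ^ 2 * (((2 / (1 + s)) ^ p) ^ 2 * J) := by
          refine mul_le_mul_of_nonneg_left (h6.trans ?_) (sq_nonneg _)
          gcongr
      _ = _ := by ring

end Decay

/-! ### The interaction applied to the cut-off wave: one cube at a time, then summed. -/

section Interaction

variable {K : Type*} [NormedAddCommGroup K] [InnerProductSpace ℂ K] [CompleteSpace K]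

theorem norm_sq_eq_integral {E : Type*} [NormedAddCommGroup E] [InnerProductSpace ℂ E]
    (Φ : Lp E 2 (volume : Measure R3)) : ‖Φ‖ ^ 2 = ∫ x, ‖Φ x‖ ^ 2 := by
  rw [← @inner_self_eq_norm_sq ℂ, L2.inner_def, ← integral_re]
  · simp only [inner_self_eq_norm_sq]
  · exact L2.integrable_inner _ _

theorem spinLift_prodS_apply {A : K →ₗ.[ℂ] K} {ι : Type*} (S : Finset ι) {χ ζ : ι → K}
    (h : ∀ i, (χ i, ζ i) ∈ A.graph) (φ : ι → 𝓢(R3, Spin)) (x : R3) :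
    SpinLift A (prodS S χ φ x) (prodS S ζ φ x) := by
  intro k
  rw [prodS_apply, prodS_apply]
  have := Submodule.sum_mem A.graph (t := S) fun i _ => Submodule.smul_mem _ (φ i x k) (h i)
  simp only [Prod.smul_mk, ← prod_mk_sum] at this
  simpa using this

variable {C : Set R3} {α β C₁ L d : ℝ} {HQ : K →ₗ.[ℂ] K} {HPQ : HilbertPQ K →ₗ.[ℂ] HilbertPQ K}
  {Ω : Set R3} {I : Set ℕ} {cube : ℕ → Set R3} {HPQn : ℕ → HilbertPQ K →ₗ.[ℂ] HilbertPQ K}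
  {N : ℕ → K →ₗ.[ℂ] K}

/-- Commutation with position confines the image to the set where `f ≠ 0`. That set stays away from
`Ω`, so the decay assumption applies there and its power of the distance is split geometrically. -/
theorem ae_norm_interaction_le (hI : InteractionAssumption C α β C₁ L d HQ HPQ Ω I cube HPQn N)
    (hC : C.Nonempty) (hα : 1 < α) (hd : 1 ≤ d) (hL : 2 * L ≤ d) {b ε : ℝ} {f : R3 → ℝ}
    {f₁ f₂ : Fin 3 → R3 → ℝ} (hf : IsCutoff C b ε d f f₁ f₂) {n : ℕ} (hn : n ∈ I)
    {z : R3} (hz : z ∈ cube n) {ι : Type*} (S : Finset ι) {χ ζ : ι → K}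
    (hχ : ∀ i, χ i ∈ HQ.domain) (hζ : ∀ i, (χ i, ζ i) ∈ (N n).graph) (φ : ι → 𝓢(R3, Spin))
    {Φ : HilbertPQ K}
    (hΦ : (toL2 (SpinTensor K) (prodS S χ fun i => mulS Spin f (φ i)), Φ) ∈ (HPQn n).graph) :
    ∀ᵐ x, ‖Φ x‖ ≤ 4 ^ α * setDist (cube n) C ^ ((1 - α) / 2) *
      ((1 + ‖x - z‖) ^ (-((1 + α) / 2)) * ‖prodS S ζ φ x‖) := by
  classical
  have hsub : cube n ⊆ Ω := by
    rw [hI.covering]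
    exact Set.subset_biUnion_of_mem (u := cube) hn
  have hmeas : MeasurableSet {x | f x ≠ 0} :=
    (hf.growth.1.continuous.measurable (MeasurableSet.singleton (0 : ℝ))).compl
  have hval : ∀ x, prodS S χ (fun i => mulS Spin f (φ i)) x = f x • prodS S χ φ x := by
    intro x
    rw [← mulS_prodS hf.growth, mulS_apply hf.growth]
  have hval' : ∀ x, prodS S ζ (fun i => mulS Spin f (φ i)) x = f x • prodS S ζ φ x := by
    intro x
    rw [← mulS_prodS hf.growth, mulS_apply hf.growth]
  -- The state equals itself times the indicator of `{f ≠ 0}`; hence so does its image.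
  have hcom := hI.commute_position n hn ({x | f x ≠ 0}.indicator fun _ => 1)
    (measurable_const.indicator hmeas) ⟨1, fun x => by
      by_cases hx : x ∈ {x | f x ≠ 0}
      · rw [Set.indicator_of_mem hx]; simp
      · rw [Set.indicator_of_notMem hx]; simp⟩ _ _ _ _ hΦ hΦ (by
      filter_upwards [coeFn_toL2 (prodS S χ fun i => mulS Spin f (φ i))] with x hx
      rw [hx, hval]
      by_cases h : f x = 0
      · simp [h]
      · rw [Set.indicator_of_mem (show x ∈ {x | f x ≠ 0} from h), one_smul])
  have hdec := hI.decay n hn _ (toL2_prodS_mem_algTensor S hχ fun i => mulS Spin f (φ i)) Φ hΦ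
  filter_upwards [hcom, hdec, coeFn_toL2 (prodS S χ fun i => mulS Spin f (φ i))] with x h1 h2 h3
  have hpos : 0 ≤ setDist (cube n) C := by
    refine Real.sInf_nonneg ?_
    rintro _ ⟨a, _, b, _, rfl⟩
    exact dist_nonneg
  by_cases hx : f x = 0
  · rw [h1, Set.indicator_of_notMem (by simpa using hx), zero_smul, norm_zero]
    positivity
  obtain ⟨c, hc, hxc⟩ := hf.near x hx
  have hxΩ : x ∉ Ω := fun h => by
    have := hI.separated x h c hc
    linarith
  have h4 := h2 hxΩ (prodS S ζ (fun i => mulS Spin f (φ i)) x) (by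
    rw [h3]
    exact spinLift_prodS_apply S hζ _ x)
  have h5 : ‖prodS S ζ (fun i => mulS Spin f (φ i)) x‖ ≤ ‖prodS S ζ φ x‖ := by
    rw [hval', norm_smul, Real.norm_eq_abs, abs_of_nonneg (hf.nonneg x)]
    exact mul_le_of_le_one_left (norm_nonneg _) (hf.le_one x)
  have h6 := rpow_mul_le_infDist_rpow (isBounded_nonempty_of_isOpenCube (hI.isOpenCube n hn)).1 hC hα
    hd hL (hI.diam_le n hn) (fun x hx => hI.separated x (hsub hx)) hz hc hxc
  calc ‖Φ x‖ = 1 * ‖Φ x‖ := (one_mul _).symm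
    _ ≤ (4 ^ α * setDist (cube n) C ^ ((1 - α) / 2) * (1 + ‖x - z‖) ^ (-((1 + α) / 2))
      * Metric.infDist x (cube n) ^ α) * ‖Φ x‖ := by gcongr
    _ = 4 ^ α * setDist (cube n) C ^ ((1 - α) / 2) * (1 + ‖x - z‖) ^ (-((1 + α) / 2)) *
      (Metric.infDist x (cube n) ^ α * ‖Φ x‖) := by ring
    _ ≤ 4 ^ α * setDist (cube n) C ^ ((1 - α) / 2) * (1 + ‖x - z‖) ^ (-((1 + α) / 2)) *
      ‖prodS S ζ φ x‖ := by
        refine mul_le_mul_of_nonneg_left (h4.trans h5) (by positivity)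
    _ = _ := by ring

/-- The weighted decay estimate bounds each cube's contribution by a common time factor times
`dist(Ωₙ, C)^{(1-α)/2}`. These factors have sum at most `C₁ d^{-β}`, whatever the number of cubes.
-/
theorem norm_interaction_le (hI : InteractionAssumption C α β C₁ L d HQ HPQ Ω I cube HPQn N)
    (hC : C.Nonempty) (hα : 1 < α) (hd : 1 ≤ d) (hL : 2 * L ≤ d) {b ε : ℝ} {f : R3 → ℝ}
    {f₁ f₂ : Fin 3 → R3 → ℝ} (hf : IsCutoff C b ε d f f₁ f₂) {κ B s : ℝ} (hκ : 0 ≤ κ) (hB : 0 ≤ B)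
    (hs : 0 ≤ s)
    (hκ' : ∀ (F : 𝓢(R3, SpinTensor K)), ∫ x, ‖F x‖ ≤ B → l2norm F ≤ B → ∀ y,
      ∫ x, ((1 + ‖x - y‖) ^ (-((1 + α) / 2)) * ‖freeS (SpinTensor K) s F x‖) ^ 2
        ≤ (κ * B * (1 + s) ^ (-decayExponent ((1 + α) / 2))) ^ 2)
    {ι : Type*} (S : Finset ι) {χ : ι → K} (hχ : ∀ i, χ i ∈ HQ.domain) (φ : ι → 𝓢(R3, Spin))
    (hB' : ∀ n ∈ I, ∀ ζ : ι → K, (∀ i, (χ i, ζ i) ∈ (N n).graph) →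
      ∫ x, ‖prodS S ζ φ x‖ ≤ B ∧ l2norm (prodS S ζ φ) ≤ B) {Θ : HilbertPQ K}
    (hΘ : (toL2 (SpinTensor K) (prodS S χ fun i => mulS Spin f (freeS Spin s (φ i))), Θ)
      ∈ HPQ.graph) :
    ‖Θ‖ ≤ 4 ^ α * κ * B * (C₁ * d ^ (-β)) * (1 + s) ^ (-decayExponent ((1 + α) / 2)) := by
  obtain ⟨w, hw, rfl⟩ := (LinearPMap.mem_graph_iff _).1 hΘ
  obtain ⟨Φ, hΦ, hlim⟩ := hI.strong_sum w
  rw [hw] at hΦ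
  set D : ℕ → ℝ := fun n => setDist (cube n) C ^ ((1 - α) / 2) with hD
  have hpos : ∀ n, 0 ≤ setDist (cube n) C := fun n => by
    refine Real.sInf_nonneg ?_
    rintro _ ⟨a, _, b, _, rfl⟩
    exact dist_nonneg
  have hD0 : ∀ n, 0 ≤ D n := fun n => Real.rpow_nonneg (hpos n) _
  set q := 4 ^ α * (κ * B * (1 + s) ^ (-decayExponent ((1 + α) / 2))) with hq
  have hq0 : 0 ≤ q := by positivity
  have hn : ∀ n ∈ I, ‖Φ n‖ ≤ q * D n := by
    intro n hn
    obtain ⟨z, hz⟩ := (isBounded_nonempty_of_isOpenCube (hI.isOpenCube n hn)).2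
    have hζ : ∀ i, ∃ ζ, (χ i, ζ) ∈ (N n).graph := fun i =>
      ⟨N n ⟨χ i, hI.domain_le n hn (hχ i)⟩, LinearPMap.mem_graph (N n) ⟨χ i, _⟩⟩
    choose ζ hζ using hζ
    obtain ⟨h1, h2⟩ := hB' n hn ζ hζ
    have h3 := hκ' _ h1 h2 z
    have h4 := ae_norm_interaction_le hI hC hα hd hL hf hn hz S hχ hζ _ (hΦ n hn)
    refine le_of_sq_le_sq ?_ (mul_nonneg hq0 (hD0 n))
    rw [norm_sq_eq_integral]
    calc ∫ x, ‖Φ n x‖ ^ 2 ≤ ∫ x, (4 ^ α * D n) ^ 2 *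
          ((1 + ‖x - z‖) ^ (-((1 + α) / 2)) * ‖freeS (SpinTensor K) s (prodS S ζ φ) x‖) ^ 2 := by
          refine integral_mono_of_nonneg (Eventually.of_forall fun x => sq_nonneg _) ?_ ?_
          · refine Integrable.const_mul ?_ _
            refine (integrable_norm_sq (freeS (SpinTensor K) s (prodS S ζ φ))).mono' ?_ ?_
            · have : Continuous fun x : R3 => (1 + ‖x - z‖) ^ (-((1 + α) / 2)) :=
                Continuous.rpow_const (by fun_prop) fun x => Or.inl (by positivity)
              exact ((this.mul (freeS (SpinTensor K) s (prodS S ζ φ)).continuous.norm).pow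
                2).aestronglyMeasurable
            · refine Eventually.of_forall fun x => ?_
              rw [Real.norm_of_nonneg (sq_nonneg _)]
              refine pow_le_pow_left₀ (by positivity) (mul_le_of_le_one_left (norm_nonneg _) ?_) 2
              exact Real.rpow_le_one_of_one_le_of_nonpos (by linarith [norm_nonneg (x - z)])
                (by linarith)
          · filter_upwards [h4] with x hx
            -- `Nₙ` acts on the factors of `Q` and the free evolution on those of `P`; they commute,
            -- so the local decay estimate is available for `Nₙ` applied to the state.
            rw [← mul_pow, freeS_prodS]
            exact pow_le_pow_left₀ (norm_nonneg _) hx 2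
      _ ≤ (4 ^ α * D n) ^ 2 * (κ * B * (1 + s) ^ (-decayExponent ((1 + α) / 2))) ^ 2 := by
          rw [integral_const_mul]
          gcongr
      _ = (q * D n) ^ 2 := by rw [hq]; ring
  have hsum : Summable (I.indicator D) := summable_subtype_iff_indicator.1 hI.summable
  have hle : ∑' n, I.indicator D n ≤ C₁ * d ^ (-β) := by
    rw [← tsum_subtype]
    exact hI.tsum_le
  have hfin : ‖HPQ w‖ ≤ q * (C₁ * d ^ (-β)) := by
    refine le_of_tendsto hlim.norm (Eventually.of_forall fun m => ?_)
    calc ‖∑ n ∈ Finset.range m, I.indicator Φ n‖ ≤ ∑ n ∈ Finset.range m, q * I.indicator D n := by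
          refine norm_sum_le_of_le _ fun n _ => ?_
          by_cases h : n ∈ I
          · rw [Set.indicator_of_mem h, Set.indicator_of_mem h]
            exact hn n h
          · simp [Set.indicator_of_notMem h]
      _ = q * ∑ n ∈ Finset.range m, I.indicator D n := by rw [Finset.mul_sum]
      _ ≤ q * (C₁ * d ^ (-β)) := by
          refine mul_le_mul_of_nonneg_left ((hsum.sum_le_tsum _ fun n _ => ?_).trans hle) hq0
          exact Set.indicator_nonneg (fun n _ => hD0 n) n
  refine hfin.trans (le_of_eq ?_)
  rw [hq]
  ring

end Interaction

end ClosedSystem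

end

noncomputable section

namespace ClosedSystem

/-! ### Closable operators and averages over unitary groups -/

section Adjoint

variable {K : Type*} [NormedAddCommGroup K] [InnerProductSpace ℂ K]

/-- The domain of the adjoint of `A`. -/
def adjointDom (A : K →ₗ.[ℂ] K) : Submodule ℂ K where
  carrier := {u | ∃ v, ∀ χ ζ, (χ, ζ) ∈ A.graph → ⟪u, ζ⟫_ℂ = ⟪v, χ⟫_ℂ}
  add_mem' := by
    rintro u u' ⟨v, hv⟩ ⟨v', hv'⟩
    exact ⟨v + v', fun χ ζ h => by rw [inner_add_left, inner_add_left, hv _ _ h, hv' _ _ h]⟩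
  zero_mem' := ⟨0, fun χ ζ _ => by rw [inner_zero_left, inner_zero_left]⟩
  smul_mem' := by
    rintro c u ⟨v, hv⟩
    exact ⟨c • v, fun χ ζ h => by rw [inner_smul_left, inner_smul_left, hv _ _ h]⟩

/-- The adjoint of a closable operator is densely defined. -/
theorem dense_adjointDom [CompleteSpace K] {A : K →ₗ.[ℂ] K} (hA : A.IsClosable) :
    Dense (adjointDom A : Set K) := by
  rw [Submodule.dense_iff_topologicalClosure_eq_top, Submodule.topologicalClosure_eq_top_iff,
    Submodule.eq_bot_iff]
  intro w hw
  set G : Submodule ℂ (WithLp 2 (K × K)) :=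
    A.graph.comap (WithLp.linearEquiv 2 ℂ (K × K)).toLinearMap with hG
  -- Von Neumann's graph argument: a vector `(q, u)` orthogonal to the graph has `u` in the adjoint
  -- domain with adjoint value `-q`. Thus `w` orthogonal to that domain places `(0, w)` in the
  -- closed graph, and closability forces `w = 0`.
  have h1 : WithLp.toLp 2 ((0 : K), w) ∈ Gᗮᗮ := by
    rw [Submodule.mem_orthogonal]
    intro p hp
    rw [Submodule.mem_orthogonal'] at hp
    rw [WithLp.prod_inner_apply]
    have h2 : p.snd ∈ adjointDom A := by
      refine ⟨-p.fst, fun χ ζ h => ?_⟩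
      have := hp (WithLp.toLp 2 (χ, ζ)) h
      rw [WithLp.prod_inner_apply] at this
      rw [inner_neg_left]
      exact eq_neg_of_add_eq_zero_right this
    have h3 := (Submodule.mem_orthogonal _ _).1 hw _ h2
    simpa using h3
  rw [Submodule.orthogonal_orthogonal_eq_closure] at h1
  have h2 : ((0 : K), w) ∈ A.graph.topologicalClosure := by
    have hc : Continuous fun p : WithLp 2 (K × K) => WithLp.ofLp p :=
      WithLp.prod_continuous_ofLp 2 K K
    have := map_mem_closure hc (s := (G : Set (WithLp 2 (K × K)))) (t := (A.graph : Set (K × K)))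
      h1 (fun p hp => hp)
    exact this
  rw [hA.graph_closure_eq_closure_graph] at h2
  exact LinearPMap.graph_fst_eq_zero_snd _ h2 rfl

end Adjoint

/-! ### Averages over short times, which lie in the domain of the generator. -/

section TimeAverage

variable {K : Type*} [NormedAddCommGroup K] [InnerProductSpace ℂ K] [CompleteSpace K]
  {HQ : K →ₗ.[ℂ] K} {UQ : ℝ → K →L[ℂ] K}

/-- The average `δ⁻¹ ∫₀^δ e^{-irH_Q} χ dr`. -/
def timeAvg (UQ : ℝ → K →L[ℂ] K) (δ : ℝ) (χ : K) : K := δ⁻¹ • ∫ r in (0 : ℝ)..δ, UQ r χ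

theorem hasDerivAt_integral_unitaryGroup (hU : IsUnitaryGroup HQ UQ) (χ : K) (t : ℝ) :
    HasDerivAt (fun t => ∫ r in (0 : ℝ)..t, UQ r χ) (UQ t χ) t :=
  intervalIntegral.integral_hasDerivAt_right ((hU.continuous χ).intervalIntegrable _ _)
    ((hU.continuous χ).stronglyMeasurableAtFilter _ _) (hU.continuous χ).continuousAt

theorem apply_timeAvg (hU : IsUnitaryGroup HQ UQ) (δ t : ℝ) (χ : K) :
    UQ t (timeAvg UQ δ χ) = δ⁻¹ • ∫ r in (0 : ℝ)..δ, UQ (t + r) χ := by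
  have h := ContinuousLinearMap.intervalIntegral_comp_comm (UQ t)
    ((hU.continuous χ).intervalIntegrable (μ := volume) 0 δ)
  simp only [hU.add, mul_apply_eq_comp]
  rw [h, timeAvg]
  exact ((UQ t).restrictScalars ℝ).map_smul _ _

/-- Evolving the average by `t` shifts the integration interval to `[t, t + δ]`, and the integral is
differentiable in its endpoints. -/
theorem timeAvg_mem_domain (hU : IsUnitaryGroup HQ UQ) (δ : ℝ) (χ : K) :
    timeAvg UQ δ χ ∈ HQ.domain := by
  refine LinearPMap.mem_domain_of_mem_graph (y := Complex.I • (δ⁻¹ : ℝ) • (UQ δ χ - χ))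
    ((hU.generator (timeAvg UQ δ χ) _).2 ?_)
  have h1 : ∀ t, UQ t (timeAvg UQ δ χ)
      = δ⁻¹ • ((∫ r in (0 : ℝ)..(t + δ), UQ r χ) - ∫ r in (0 : ℝ)..t, UQ r χ) := by
    intro t
    rw [apply_timeAvg hU, intervalIntegral.integral_comp_add_left (fun r => UQ r χ), add_zero,
      intervalIntegral.integral_interval_sub_left ((hU.continuous χ).intervalIntegrable _ _)
        ((hU.continuous χ).intervalIntegrable _ _)]
  have h2 : HasDerivAt (fun t => ∫ r in (0 : ℝ)..(t + δ), UQ r χ) (UQ δ χ) 0 := by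
    have h := hasDerivAt_integral_unitaryGroup hU χ (0 + δ)
    rw [zero_add] at h
    exact HasDerivAt.comp_add_const 0 δ (by rw [zero_add]; exact h)
  have h3 := hasDerivAt_integral_unitaryGroup hU χ 0
  rw [hU.zero, one_apply_eq_self] at h3
  have h4 := (h2.sub h3).const_smul δ⁻¹
  refine (h4.congr_of_eventuallyEq (Eventually.of_forall h1)).congr_deriv ?_
  rw [smul_smul, neg_mul, Complex.I_mul_I, neg_neg, one_smul]

theorem tendsto_timeAvg (hU : IsUnitaryGroup HQ UQ) (χ : K) :
    Tendsto (fun δ => timeAvg UQ δ χ) (𝓝[≠] 0) (𝓝 χ) := by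
  have h3 := hasDerivAt_integral_unitaryGroup hU χ 0
  rw [hU.zero, one_apply_eq_self, hasDerivAt_iff_tendsto_slope] at h3
  refine h3.congr fun δ => ?_
  rw [slope_def_module, intervalIntegral.integral_same, sub_zero, sub_zero, timeAvg]

/-- Averaging only looks at the times `s + r` with `0 < r ≤ δ`, which are nonnegative. The bound is
transferred for scalar functions of time, so no regularity in time of `Nₙ e^{-itH_Q} Ψ₀` is
required. -/
theorem norm_sum_inner_apply_timeAvg_le (hU : IsUnitaryGroup HQ UQ) {ι : Type*} [Fintype ι]
    (v ζ : ι → K) {δ s Y : ℝ} (hδ : 0 < δ) (hs : 0 ≤ s)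
    (h : ∀ t, 0 ≤ t → ‖∑ i, ⟪v i, UQ t (ζ i)⟫_ℂ‖ ≤ Y) :
    ‖∑ i, ⟪v i, UQ s (timeAvg UQ δ (ζ i))⟫_ℂ‖ ≤ Y := by
  have h1 : ∑ i, ⟪v i, UQ s (timeAvg UQ δ (ζ i))⟫_ℂ
      = δ⁻¹ • ∫ r in (0 : ℝ)..δ, ∑ i, ⟪v i, UQ (s + r) (ζ i)⟫_ℂ := by
    rw [intervalIntegral.integral_finsetSum, Finset.smul_sum]
    · refine Finset.sum_congr rfl fun i _ => ?_
      have hc : Continuous fun r => UQ (s + r) (ζ i) :=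
        (hU.continuous (ζ i)).comp (continuous_const.add continuous_id)
      have := ContinuousLinearMap.intervalIntegral_comp_comm (innerSL ℂ (v i))
        (hc.intervalIntegrable (μ := volume) 0 δ)
      simp only [innerSL_apply_apply] at this
      rw [apply_timeAvg hU, this]
      exact ((innerSL ℂ (v i)).restrictScalars ℝ).map_smul _ _
    · intro i _
      have hc : Continuous fun r => ⟪v i, UQ (s + r) (ζ i)⟫_ℂ :=
        continuous_const.inner ((hU.continuous (ζ i)).comp (continuous_const.add continuous_id))
      exact hc.intervalIntegrable _ _
  rw [h1, norm_smul, norm_inv, Real.norm_of_nonneg hδ.le, inv_mul_le_iff₀ hδ]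
  refine (intervalIntegral.norm_integral_le_of_norm_le_const (C := Y) fun r hr => ?_).trans ?_
  · rw [Set.uIoc_of_le hδ.le] at hr
    exact h _ (by linarith [hr.1])
  · rw [sub_zero, abs_of_pos hδ, mul_comm]

end TimeAverage

/-! ### Passing the particle bounds through averages in position and time. -/

section ParticleBound

variable {K : Type*} [NormedAddCommGroup K] [InnerProductSpace ℂ K] [CompleteSpace K]
  {HQ : K →ₗ.[ℂ] K} {UQ : ℝ → K →L[ℂ] K} {A : K →ₗ.[ℂ] K}

/-- Paired with vectors of the adjoint domain, the unbounded operator can be taken under the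
integral sign. -/
theorem norm_sum_inner_setIntegral_le {ι : Type*} [Fintype ι] {Q : ι → Set R3}
    {ψ F : R3 → SpinTensor K}
    (hψ : Integrable ψ) (hF : Integrable F) {u v : ι → SpinTensor K}
    (huv : ∀ i k χ ζ, (χ, ζ) ∈ A.graph → ⟪u i k, ζ⟫_ℂ = ⟪v i k, χ⟫_ℂ)
    (hlift : ∀ᵐ x, SpinLift A (ψ x) (F x)) :
    ‖∑ i, ⟪v i, ∫ x in Q i, ψ x⟫_ℂ‖ ≤ ∑ i, ‖u i‖ * ∫ x in Q i, ‖F x‖ := by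
  refine norm_sum_le_of_le _ fun i _ => ?_
  have h1 : ⟪v i, ∫ x in Q i, ψ x⟫_ℂ = ⟪u i, ∫ x in Q i, F x⟫_ℂ := by
    rw [← integral_inner hψ.integrableOn, ← integral_inner hF.integrableOn]
    refine integral_congr_ae (ae_restrict_of_ae ?_)
    filter_upwards [hlift] with x hx
    rw [PiLp.inner_apply, PiLp.inner_apply]
    exact Finset.sum_congr rfl fun k _ => (huv i k _ _ (hx k)).symm
  rw [h1]
  exact (norm_inner_le_norm _ _).trans
    (mul_le_mul_of_nonneg_left (norm_integral_le_integral_norm _) (norm_nonneg _))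

/-- Cauchy–Schwarz against the constant function `1` on `Q`. -/
theorem sq_setIntegral_le {Q : Set R3} (hQf : volume Q ≠ ∞) {g : R3 → ℝ}
    (hg2 : MemLp g 2 volume) :
    (∫ x in Q, g x) ^ 2 ≤ volume.real Q * ∫ x in Q, g x ^ 2 := by
  have hfin : IsFiniteMeasure (volume.restrict Q) :=
    ⟨by rw [Measure.restrict_apply_univ]; exact hQf.lt_top⟩
  have hr := hg2.restrict Q
  have h1 : MemLp (fun _ : R3 => (1 : ℝ)) 2 (volume.restrict Q) := memLp_const 1
  have h2 := L2.inner_def (𝕜 := ℝ) (h1.toLp _) (hr.toLp _)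
  have h3 : ⟪h1.toLp _, hr.toLp _⟫_ℝ = ∫ x in Q, g x := by
    rw [h2]
    refine integral_congr_ae ?_
    filter_upwards [h1.coeFn_toLp, hr.coeFn_toLp] with x hx hx'
    rw [hx, hx']
    simp
  have h4 : ∀ {f : R3 → ℝ} (hf : MemLp f 2 (volume.restrict Q)),
      ‖hf.toLp f‖ ^ 2 = ∫ x in Q, f x ^ 2 := by
    intro f hf
    rw [← @real_inner_self_eq_norm_sq, L2.inner_def]
    refine integral_congr_ae ?_
    filter_upwards [hf.coeFn_toLp] with x hx
    rw [hx]
    simp [sq]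
  have h5 := abs_real_inner_le_norm (h1.toLp _) (hr.toLp _)
  rw [h3] at h5
  calc (∫ x in Q, g x) ^ 2 = |∫ x in Q, g x| ^ 2 := (sq_abs _).symm
    _ ≤ (‖h1.toLp _‖ * ‖hr.toLp _‖) ^ 2 := pow_le_pow_left₀ (abs_nonneg _) h5 2
    _ = volume.real Q * ∫ x in Q, g x ^ 2 := by
      rw [mul_pow, h4, h4]
      simp [Measure.real]

theorem sum_setIntegral_le {ι : Type*} [Fintype ι] {Q : ι → Set R3}
    (hQ : ∀ i, MeasurableSet (Q i)) (hdisj : Pairwise (Function.onFun Disjoint Q)) {g : R3 → ℝ}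
    (hg : Integrable g) (hg0 : ∀ x, 0 ≤ g x) : ∑ i, ∫ x in Q i, g x ≤ ∫ x, g x := by
  rw [← integral_iUnion_fintype hQ hdisj fun i => hg.integrableOn]
  exact setIntegral_le_integral hg (Eventually.of_forall hg0)

/-- Bounds for averages of `N e^{-itH_Q} Ψ₀` over disjoint sets. -/
theorem particle_bounds (hU : IsUnitaryGroup HQ UQ) (hA : A.IsClosable)
    {ψ : R3 → SpinTensor K} (hψ : Integrable ψ) {C₂ : ℝ} (hC₂ : 0 ≤ C₂)
    (hF : ∀ t, 0 ≤ t → ∃ F : R3 → SpinTensor K,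
      (∀ᵐ x, SpinLift A (spinMap (UQ t) (ψ x)) (F x)) ∧ Integrable F ∧ MemLp F 2 volume ∧
      ∫ x, ‖F x‖ ≤ C₂ ∧ ∫ x, ‖F x‖ ^ 2 ≤ C₂ ^ 2)
    {ι : Type*} [Fintype ι] {Q : ι → Set R3}
    (hQ : ∀ i, MeasurableSet (Q i)) (hQf : ∀ i, volume (Q i) ≠ ∞)
    (hdisj : Pairwise (Function.onFun Disjoint Q)) {δ s : ℝ} (hδ : 0 < δ) (hs : 0 ≤ s)
    {g : ι → SpinTensor K}
    (hg : ∀ i k, (UQ s (timeAvg UQ δ ((∫ x in Q i, ψ x) k)), g i k) ∈ A.graph) :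
    ∑ i, ‖g i‖ ≤ C₂ ∧ ∑ i, (volume.real (Q i))⁻¹ * ‖g i‖ ^ 2 ≤ C₂ ^ 2 ∧
      ∀ i, volume.real (Q i) = 0 → g i = 0 := by
  -- Duality: after moving `A` to the test vectors only bounded operations remain, and the `L¹` and
  -- `L²` bounds on `F` control the pairing in the two corresponding dual norms.
  have hkey : ∀ u : ι → SpinTensor K, (∀ i k, u i k ∈ adjointDom A) →
      ‖∑ i, ⟪u i, g i⟫_ℂ‖ ≤ C₂ * ‖u‖ ∧
      ‖∑ i, ⟪u i, g i⟫_ℂ‖ ≤ C₂ * Real.sqrt (∑ i, volume.real (Q i) * ‖u i‖ ^ 2) := by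
    intro u hu
    choose v hv using hu
    set v' : ι → SpinTensor K := fun i => WithLp.toLp 2 (v i) with hv'
    have hE : ∑ i, ⟪u i, g i⟫_ℂ = ∑ p : ι × Fin 2,
        ⟪v p.1 p.2, UQ s (timeAvg UQ δ ((∫ x in Q p.1, ψ x) p.2))⟫_ℂ := by
      rw [Fintype.sum_prod_type]
      refine Finset.sum_congr rfl fun i _ => ?_
      rw [PiLp.inner_apply]
      exact Finset.sum_congr rfl fun k _ => hv i k _ _ (hg i k)
    have hT : ∀ t, 0 ≤ t → ∃ a : ι → ℝ, (∀ i, 0 ≤ a i) ∧ ∑ i, a i ≤ C₂ ∧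
        (∃ b : ι → ℝ, (∀ i, 0 ≤ b i) ∧ (∀ i, a i ^ 2 ≤ volume.real (Q i) * b i) ∧
          ∑ i, b i ≤ C₂ ^ 2) ∧
        ‖∑ p : ι × Fin 2, ⟪v p.1 p.2, UQ t ((∫ x in Q p.1, ψ x) p.2)⟫_ℂ‖ ≤ ∑ i, ‖u i‖ * a i := by
      intro t ht
      obtain ⟨F, hlift, hFi, hF2, hb1, hb2⟩ := hF t ht
      refine ⟨fun i => ∫ x in Q i, ‖F x‖, fun i => integral_nonneg fun x => norm_nonneg _,
        (sum_setIntegral_le hQ hdisj hFi.norm fun x => norm_nonneg _).trans hb1,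
        ⟨fun i => ∫ x in Q i, ‖F x‖ ^ 2, fun i => integral_nonneg fun x => sq_nonneg _,
          fun i => sq_setIntegral_le (hQf i) hF2.norm,
          (sum_setIntegral_le hQ hdisj ((memLp_two_iff_integrable_sq_norm hF2.1).1 hF2)
            fun x => sq_nonneg _).trans hb2⟩, ?_⟩
      have h1 := norm_sum_inner_setIntegral_le (A := A) (Q := Q) ((spinMap (UQ t)).integrable_comp hψ) hFi
        (u := u) (v := v') (fun i k χ ζ h => hv i k χ ζ h) hlift
      refine le_trans (le_of_eq (congrArg norm ?_)) h1
      rw [Fintype.sum_prod_type]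
      refine Finset.sum_congr rfl fun i _ => ?_
      rw [(spinMap (UQ t)).integral_comp_comm hψ.integrableOn, PiLp.inner_apply]
      rfl
    rw [hE]
    constructor
    · refine norm_sum_inner_apply_timeAvg_le hU _ _ hδ hs fun t ht => ?_
      obtain ⟨a, ha, ha1, -, h⟩ := hT t ht
      calc _ ≤ ∑ i, ‖u i‖ * a i := h
        _ ≤ ∑ i, ‖u‖ * a i := Finset.sum_le_sum fun i _ =>
            mul_le_mul_of_nonneg_right (norm_le_pi_norm u i) (ha i)
        _ = ‖u‖ * ∑ i, a i := by rw [Finset.mul_sum]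
        _ ≤ ‖u‖ * C₂ := by gcongr
        _ = C₂ * ‖u‖ := mul_comm _ _
    · refine norm_sum_inner_apply_timeAvg_le hU _ _ hδ hs fun t ht => ?_
      obtain ⟨a, ha, -, ⟨b, hb, hab, hb1⟩, h⟩ := hT t ht
      have hm : ∀ i, 0 ≤ volume.real (Q i) := fun i => measureReal_nonneg
      calc _ ≤ ∑ i, ‖u i‖ * a i := h
        _ ≤ ∑ i, Real.sqrt (volume.real (Q i) * ‖u i‖ ^ 2) * Real.sqrt (b i) := by
            refine Finset.sum_le_sum fun i _ => ?_
            rw [← Real.sqrt_mul (mul_nonneg (hm i) (sq_nonneg _))]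
            refine Real.le_sqrt_of_sq_le ?_
            rw [mul_pow]
            calc ‖u i‖ ^ 2 * a i ^ 2 ≤ ‖u i‖ ^ 2 * (volume.real (Q i) * b i) := by
                  gcongr
                  exact hab i
              _ = _ := by ring
        _ ≤ Real.sqrt (∑ i, volume.real (Q i) * ‖u i‖ ^ 2) * Real.sqrt (∑ i, b i) :=
            Real.sum_sqrt_mul_sqrt_le _ (fun i => mul_nonneg (hm i) (sq_nonneg _)) hb
        _ ≤ Real.sqrt (∑ i, volume.real (Q i) * ‖u i‖ ^ 2) * C₂ := by
            gcongr
            exact (Real.sqrt_le_sqrt hb1).trans_eq (Real.sqrt_sq hC₂)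
        _ = _ := mul_comm _ _
  -- Closability makes the test vectors dense, so both inequalities extend to all `u` by continuity.
  have hdense : Dense {u : ι → SpinTensor K | ∀ i k, u i k ∈ adjointDom A} := by
    have h1 : Dense {w : SpinTensor K | ∀ k, w k ∈ adjointDom A} := by
      have h2 : Dense (Set.univ.pi fun _ : Fin 2 => (adjointDom A : Set K)) :=
        dense_pi _ fun _ _ => dense_adjointDom hA
      have h3 := h2.preimage (PiLp.homeomorph 2 (fun _ : Fin 2 => K)).isOpenMap
      refine h3.mono fun w hw k => ?_
      exact hw k (Set.mem_univ k)
    have h4 : Dense (Set.univ.pi fun _ : ι => {w : SpinTensor K | ∀ k, w k ∈ adjointDom A}) :=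
      dense_pi _ fun _ _ => h1
    refine h4.mono ?_
    intro u hu i k
    exact hu i (Set.mem_univ i) k
  have hcs : Continuous fun u : ι → SpinTensor K => ‖∑ i, ⟪u i, g i⟫_ℂ‖ := by
    refine (continuous_finsetSum _ fun i _ => ?_).norm
    exact (continuous_apply i).inner continuous_const
  have hall1 : ∀ u : ι → SpinTensor K, ‖∑ i, ⟪u i, g i⟫_ℂ‖ ≤ C₂ * ‖u‖ := by
    have hcl : IsClosed {u : ι → SpinTensor K | ‖∑ i, ⟪u i, g i⟫_ℂ‖ ≤ C₂ * ‖u‖} :=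
      isClosed_le hcs (by fun_prop)
    intro u
    exact hcl.closure_subset_iff.2 (fun u hu => (hkey u hu).1) (hdense u)
  have hall2 : ∀ u : ι → SpinTensor K, ‖∑ i, ⟪u i, g i⟫_ℂ‖
      ≤ C₂ * Real.sqrt (∑ i, volume.real (Q i) * ‖u i‖ ^ 2) := by
    have hcl : IsClosed {u : ι → SpinTensor K | ‖∑ i, ⟪u i, g i⟫_ℂ‖
        ≤ C₂ * Real.sqrt (∑ i, volume.real (Q i) * ‖u i‖ ^ 2)} :=
      isClosed_le hcs (by fun_prop)
    intro u
    exact hcl.closure_subset_iff.2 (fun u hu => (hkey u hu).2) (hdense u)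
  have hreal : ∀ c : ι → ℝ, ‖∑ i, ⟪(c i : ℂ) • g i, g i⟫_ℂ‖ = |∑ i, c i * ‖g i‖ ^ 2| := by
    intro c
    rw [← Real.norm_eq_abs, ← Complex.norm_real]
    congr 1
    push_cast
    refine Finset.sum_congr rfl fun i _ => ?_
    rw [inner_smul_left, Complex.conj_ofReal, inner_self_eq_norm_sq_to_K]
    rfl
  refine ⟨?_, ?_, fun i hi => ?_⟩
  -- Normalised `gᵢ` are the extremal test vectors for the sum of norms.
  · have h := hall1 fun i => ((‖g i‖⁻¹ : ℝ) : ℂ) • g i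
    rw [hreal] at h
    have h1 : ∑ i, ‖g i‖⁻¹ * ‖g i‖ ^ 2 = ∑ i, ‖g i‖ := by
      refine Finset.sum_congr rfl fun i _ => ?_
      by_cases h0 : ‖g i‖ = 0
      · simp [h0]
      · field_simp
    rw [h1] at h
    refine (le_abs_self _).trans (h.trans (mul_le_of_le_one_right hC₂ ?_))
    refine (pi_norm_le_iff_of_nonneg zero_le_one).2 fun i => ?_
    rw [norm_smul, Complex.norm_real, norm_inv, norm_norm]
    exact inv_mul_le_one
  -- With this choice the inequality reads `X ≤ C₂ √X`. Cells of volume zero contribute nothing, as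
  -- their inverse volume is `0` by convention.
  · have h := hall2 fun i => (((volume.real (Q i))⁻¹ : ℝ) : ℂ) • g i
    rw [hreal] at h
    have h1 : ∑ i, volume.real (Q i) * ‖(((volume.real (Q i))⁻¹ : ℝ) : ℂ) • g i‖ ^ 2
        = ∑ i, (volume.real (Q i))⁻¹ * ‖g i‖ ^ 2 := by
      refine Finset.sum_congr rfl fun i _ => ?_
      rw [norm_smul, Complex.norm_real, norm_inv, mul_pow, Real.norm_of_nonneg measureReal_nonneg]
      by_cases h0 : volume.real (Q i) = 0
      · simp [h0]
      · field_simp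
    rw [h1] at h
    set X := ∑ i, (volume.real (Q i))⁻¹ * ‖g i‖ ^ 2 with hX
    have hX0 : 0 ≤ X := Finset.sum_nonneg fun i _ =>
      mul_nonneg (inv_nonneg.2 measureReal_nonneg) (sq_nonneg _)
    rw [abs_of_nonneg hX0] at h
    have h2 := Real.sq_sqrt hX0
    nlinarith [Real.sqrt_nonneg X, sq_nonneg (Real.sqrt X - C₂)]
  · classical
    have h := hall2 (Pi.single i (g i))
    have h1 : ∑ j, volume.real (Q j) * ‖(Pi.single i (g i) : ι → SpinTensor K) j‖ ^ 2 = 0 := by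
      refine Finset.sum_eq_zero fun j _ => ?_
      by_cases hj : j = i
      · subst hj; rw [hi, zero_mul]
      · simp [hj]
    rw [h1, Real.sqrt_zero, mul_zero, Finset.sum_eq_single i (fun j _ hj => by simp [hj])
      (by simp), Pi.single_eq_same] at h
    exact inner_self_eq_zero.1 (norm_le_zero_iff.1 h)

end ParticleBound

end ClosedSystem

end

noncomputable section

namespace ClosedSystem

open LineDeriv

/-! ### Discretised mollification -/

/-- A smooth even probability density supported in the ball of radius `ρ`. -/
structure IsMollifier (ρ : ℝ) (b : 𝓢(R3, ℝ)) : Prop where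
  nonneg : ∀ x, 0 ≤ b x
  integral_eq_one : ∫ x, b x = 1
  eq_zero : ∀ x, ρ ≤ ‖x‖ → b x = 0
  even : ∀ x, b (-x) = b x
  mul_volume_le : ∀ x, b x * volume.real (Metric.closedBall (0 : R3) (2 * ρ)) ≤ 64

theorem exists_isMollifier {ρ : ℝ} (hρ : 0 < ρ) : ∃ b : 𝓢(R3, ℝ), IsMollifier ρ b := by
  let f : ContDiffBump (0 : R3) := ⟨ρ / 2, ρ, by linarith, by linarith⟩
  refine ⟨HasCompactSupport.toSchwartzMap (f := f.normed volume) f.hasCompactSupport_normed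
    f.contDiff_normed, f.nonneg_normed, f.integral_normed, fun x hx => ?_, f.normed_neg,
    fun x => ?_⟩
  · have h : x ∉ Function.support (f.normed volume) := by
      rw [f.support_normed_eq, mem_ball_zero_iff, not_lt]
      exact hx
    exact Function.notMem_support.1 h
  -- The bump is at most `2³` over the volume of the `ρ`-ball, and doubling the radius costs another
  -- `2³`; together `64`.
  · have h := f.normed_le_div_measure_closedBall_rOut volume 2 (by simp only [f]; linarith) x
    have hpos : 0 < volume.real (Metric.closedBall (0 : R3) ρ) :=
      ENNReal.toReal_pos (Metric.measure_closedBall_pos _ _ hρ).ne' measure_closedBall_lt_top.ne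
    rw [le_div_iff₀ hpos] at h
    have h1 : volume.real (Metric.closedBall (0 : R3) (2 * ρ))
        = 8 * volume.real (Metric.closedBall (0 : R3) ρ) := by
      rw [Measure.addHaar_real_closedBall' _ _ (by positivity),
        Measure.addHaar_real_closedBall' _ _ hρ.le, finrank_euclideanSpace, Fintype.card_fin]
      ring
    rw [finrank_euclideanSpace, Fintype.card_fin] at h
    change f.normed volume x * _ ≤ 64
    rw [h1]
    linarith

theorem exists_norm_le (k : 𝓢(R3, ℝ)) : ∃ c, 0 ≤ c ∧ ∀ x, |k x| ≤ c := by
  obtain ⟨c, hc, h⟩ := k.decay 0 0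
  refine ⟨c, hc.le, fun x => ?_⟩
  have := h x
  rwa [pow_zero, one_mul, norm_iteratedFDeriv_zero] at this

/-! ### Finite sums of translated bumps and the error of mollification. -/

section BumpSum

variable {E : Type*} [NormedAddCommGroup E] [InnerProductSpace ℂ E] {ι : Type*} [Fintype ι]

/-- The function `x ↦ ∑ᵢ b(x - yᵢ) gᵢ`. -/
def bumpSum (b : 𝓢(R3, ℝ)) (y : ι → R3) (g : ι → E) : 𝓢(R3, E) :=
  ∑ i, (b.compSubConstCLM ℝ (y i)).postcompCLM (ContinuousLinearMap.toSpanSingleton ℝ (g i))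

theorem bumpSum_apply (b : 𝓢(R3, ℝ)) (y : ι → R3) (g : ι → E) (x : R3) :
    bumpSum b y g x = ∑ i, b (x - y i) • g i := by
  simp [bumpSum, sum_apply]

theorem lineDeriv_compSubConst (b : 𝓢(R3, ℝ)) (m y x : R3) :
    (∂_{m} (b.compSubConstCLM ℝ y) : 𝓢(R3, ℝ)) x = (∂_{m} b : 𝓢(R3, ℝ)) (x - y) := by
  rw [SchwartzMap.lineDerivOp_apply_eq_fderiv, SchwartzMap.lineDerivOp_apply_eq_fderiv]
  change fderiv ℝ (fun x => b (x - y)) x m = _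
  rw [fderiv_comp_sub]

theorem lineDeriv_bumpSum (b : 𝓢(R3, ℝ)) (y : ι → R3) (g : ι → E) (m : R3) :
    (∂_{m} (bumpSum b y g) : 𝓢(R3, E)) = bumpSum (∂_{m} b) y g := by
  ext x : 1
  rw [bumpSum_apply, SchwartzMap.lineDerivOp_apply_eq_fderiv]
  have h : HasFDerivAt (bumpSum b y g)
      (∑ i, (fderiv ℝ b (x - y i)).smulRight (g i)) x := by
    have h1 : (bumpSum b y g : R3 → E) = fun x => ∑ i, b (x - y i) • g i :=
      funext fun x => bumpSum_apply b y g x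
    rw [h1]
    refine HasFDerivAt.fun_sum fun i _ => HasFDerivAt.smul_const ?_ _
    exact (hasFDerivAt_comp_sub (y i)).2 b.differentiableAt.hasFDerivAt
  rw [h.fderiv, sum_apply]
  exact Finset.sum_congr rfl fun i _ => by
    rw [SchwartzMap.lineDerivOp_apply_eq_fderiv]; rfl

/-- Integration by parts; evenness of `b` turns `b(x - z)` into a translate of `b` in the variable
`z`, and makes the derivative odd. -/
theorem IsMollifier.integral_lineDeriv_smul {ρ : ℝ} {b : 𝓢(R3, ℝ)} (hb : IsMollifier ρ b)
    (ψ : 𝓢(R3, E)) (m x : R3) :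
    ∫ z, (∂_{m} b : 𝓢(R3, ℝ)) (x - z) • ψ z = ∫ z, b (x - z) • (∂_{m} ψ : 𝓢(R3, E)) z := by
  have h1 : ∀ w, (∂_{m} b : 𝓢(R3, ℝ)) (-w) = -(∂_{m} b : 𝓢(R3, ℝ)) w := by
    intro w
    rw [SchwartzMap.lineDerivOp_apply_eq_fderiv, SchwartzMap.lineDerivOp_apply_eq_fderiv]
    have h2 : (fun x => b (-x)) = b := funext hb.even
    have h3 : HasFDerivAt (fun x => b (-x)) ((fderiv ℝ b (-w)) ∘L (-ContinuousLinearMap.id ℝ R3)) w :=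
      (b.differentiableAt.hasFDerivAt (x := -w)).comp w (hasFDerivAt_id w).neg
    rw [h2] at h3
    rw [h3.fderiv]
    simp
  have h4 := SchwartzMap.integral_smul_lineDerivOp_right_eq_neg_left (μ := volume)
    (b.compSubConstCLM ℝ x) ψ m
  simp only [lineDeriv_compSubConst, SchwartzMap.compSubConstCLM_apply] at h4
  calc ∫ z, (∂_{m} b : 𝓢(R3, ℝ)) (x - z) • ψ z
      = -∫ z, (∂_{m} b : 𝓢(R3, ℝ)) (z - x) • ψ z := by
        rw [← integral_neg]
        refine integral_congr_ae (Eventually.of_forall fun z => ?_)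
        change (∂_{m} b : 𝓢(R3, ℝ)) (x - z) • ψ z = -((∂_{m} b : 𝓢(R3, ℝ)) (z - x) • ψ z)
        rw [← neg_sub z x, h1, neg_smul]
    _ = ∫ z, b (z - x) • (∂_{m} ψ : 𝓢(R3, E)) z := h4.symm
    _ = _ := by
        refine integral_congr_ae (Eventually.of_forall fun z => ?_)
        change b (z - x) • _ = b (x - z) • _
        rw [← neg_sub x z, hb.even]

theorem one_add_norm_sq_le {x z : R3} (h : ‖x - z‖ ≤ 2) : 1 + ‖x‖ ^ 2 ≤ 9 * (1 + ‖z‖ ^ 2) := by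
  have h1 : ‖x‖ ≤ ‖z‖ + 2 := by
    have := norm_sub_norm_le x z
    linarith
  nlinarith [norm_nonneg x, norm_nonneg z, sq_nonneg (‖z‖ - 2)]

/-- The error of mollification. -/
theorem IsMollifier.norm_integral_smul_sub_le {ρ : ℝ} (hρ : 0 < ρ) (hρ1 : ρ ≤ 1) {b : 𝓢(R3, ℝ)}
    (hb : IsMollifier ρ b) [CompleteSpace E] (ψ : 𝓢(R3, E)) {A : ℝ}
    (hA : ∀ x, (1 + ‖x‖ ^ 2) * ‖fderiv ℝ ψ x‖ ≤ A) (x : R3) :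
    ‖(∫ z, b (x - z) • ψ z) - ψ x‖ ≤ 9 * A * ρ * (1 + ‖x‖ ^ 2)⁻¹ := by
  have hbi : Integrable fun z => b (x - z) := (b.integrable).comp_sub_left x
  have hb1 : ∫ z, b (x - z) = 1 := by
    rw [integral_sub_left_eq_self (fun z => b z) volume x, hb.integral_eq_one]
  have hbψ : Integrable fun z => b (x - z) • ψ z := by
    obtain ⟨c, -, hc⟩ := exists_norm_le b
    have hcont : Continuous fun z => b (x - z) • ψ z :=
      (b.continuous.comp (continuous_const.sub continuous_id)).smul ψ.continuous
    refine (ψ.integrable.norm.const_mul c).mono' hcont.aestronglyMeasurable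
      (Eventually.of_forall fun z => ?_)
    rw [norm_smul]
    exact mul_le_mul_of_nonneg_right (hc _) (norm_nonneg _)
  have h1 : (∫ z, b (x - z) • ψ z) - ψ x = ∫ z, b (x - z) • (ψ z - ψ x) := by
    simp only [smul_sub]
    rw [integral_sub hbψ (hbi.smul_const _), integral_smul_const, hb1, one_smul]
  rw [h1]
  have h2 : ∀ z, ‖b (x - z) • (ψ z - ψ x)‖ ≤ b (x - z) * (9 * A * ρ * (1 + ‖x‖ ^ 2)⁻¹) := by
    intro z
    rw [norm_smul, Real.norm_of_nonneg (hb.nonneg _)]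
    by_cases hz : ρ ≤ ‖x - z‖
    · rw [hb.eq_zero _ hz, zero_mul, zero_mul]
    refine mul_le_mul_of_nonneg_left ?_ (hb.nonneg _)
    rw [not_le] at hz
    have h3 : ∀ w ∈ Metric.ball x ρ, ‖fderiv ℝ ψ w‖ ≤ 9 * A * (1 + ‖x‖ ^ 2)⁻¹ := by
      intro w hw
      rw [mem_ball_iff_norm'] at hw
      have h4 := one_add_norm_sq_le (x := x) (z := w) (by linarith)
      rw [← div_eq_mul_inv, le_div_iff₀ (by positivity)]
      nlinarith [hA w, norm_nonneg (fderiv ℝ ψ w)]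
    have h5 := (convex_ball x ρ).norm_image_sub_le_of_norm_fderiv_le (𝕜 := ℝ)
      (fun w _ => ψ.differentiableAt) h3 (Metric.mem_ball_self hρ)
      (show z ∈ Metric.ball x ρ by rw [mem_ball_iff_norm']; exact hz)
    have hA0 : 0 ≤ A := le_trans (by positivity) (hA 0)
    calc ‖ψ z - ψ x‖ ≤ 9 * A * (1 + ‖x‖ ^ 2)⁻¹ * ‖z - x‖ := h5
      _ ≤ 9 * A * (1 + ‖x‖ ^ 2)⁻¹ * ρ := by
        rw [norm_sub_rev]
        gcongr
      _ = _ := by ring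
  refine (norm_integral_le_of_norm_le (hbi.mul_const _) (Eventually.of_forall h2)).trans ?_
  rw [integral_mul_const, hb1, one_mul]

end BumpSum

/-! ### Convergence of the discretised convolutions as the partition is refined. -/

section Discretisation

variable {E : Type*} [NormedAddCommGroup E] [InnerProductSpace ℂ E] [CompleteSpace E]

/-- Simple functions approximating the identity of `ℝ³`. -/
def grid (j : ℕ) : SimpleFunc R3 R3 :=
  SimpleFunc.approxOn id measurable_id Set.univ 0 (Set.mem_univ _) j

theorem tendsto_grid (z : R3) : Tendsto (fun j => grid j z) atTop (𝓝 z) :=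
  SimpleFunc.tendsto_approxOn measurable_id (Set.mem_univ _) (by simp)

/-- The cell of the point `y` in the `j`-th partition, cut off at distance `ρ` from `y`. -/
def cell (ρ : ℝ) (j : ℕ) (y : (grid j).range) : Set R3 :=
  {z | grid j z = y} ∩ {z | ‖grid j z - z‖ < ρ}

theorem measurableSet_near (ρ : ℝ) (j : ℕ) : MeasurableSet {z | ‖grid j z - z‖ < ρ} :=
  measurableSet_lt ((grid j).measurable.sub measurable_id).norm measurable_const

theorem measurableSet_cell (ρ : ℝ) (j : ℕ) (y : (grid j).range) : MeasurableSet (cell ρ j y) :=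
  ((grid j).measurableSet_preimage {(y : R3)}).inter (measurableSet_near ρ j)

theorem cell_subset_closedBall (ρ : ℝ) (j : ℕ) (y : (grid j).range) :
    cell ρ j y ⊆ Metric.closedBall (y : R3) ρ := by
  rintro z ⟨h1, h2⟩
  rw [Set.mem_ofPred_eq] at h1 h2
  rw [h1] at h2
  rw [mem_closedBall_iff_norm']
  exact h2.le

theorem volume_cell_ne_top (ρ : ℝ) (j : ℕ) (y : (grid j).range) : volume (cell ρ j y) ≠ ∞ :=
  ((measure_mono (cell_subset_closedBall ρ j y)).trans_lt measure_closedBall_lt_top).ne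

theorem pairwise_disjoint_cell (ρ : ℝ) (j : ℕ) :
    Pairwise (Function.onFun Disjoint (cell ρ j)) := by
  intro y y' h
  refine Set.disjoint_left.2 fun z hz hz' => h (Subtype.ext ?_)
  exact hz.1.symm.trans hz'.1

/-- The integrand of the discretised convolution. -/
def discIntegrand (k : 𝓢(R3, ℝ)) (ψ : 𝓢(R3, E)) (ρ : ℝ) (j : ℕ) (x : R3) : R3 → E :=
  {z | ‖grid j z - z‖ < ρ}.indicator fun z => k (x - grid j z) • ψ z

theorem aestronglyMeasurable_discIntegrand (k : 𝓢(R3, ℝ)) (ψ : 𝓢(R3, E)) (ρ : ℝ) (j : ℕ) (x : R3) :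
    AEStronglyMeasurable (discIntegrand k ψ ρ j x) volume := by
  refine AEStronglyMeasurable.indicator ?_ (measurableSet_near ρ j)
  have h : Measurable fun z => k (x - grid j z) :=
    k.continuous.measurable.comp (measurable_const.sub (grid j).measurable)
  exact h.aestronglyMeasurable.smul ψ.continuous.aestronglyMeasurable

theorem norm_discIntegrand_le {k : 𝓢(R3, ℝ)} {c : ℝ} (hc : ∀ x, |k x| ≤ c) (ψ : 𝓢(R3, E)) (ρ : ℝ)
    (j : ℕ) (x z : R3) : ‖discIntegrand k ψ ρ j x z‖ ≤ c * ‖ψ z‖ := by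
  have hc0 : 0 ≤ c := (abs_nonneg _).trans (hc 0)
  refine (norm_indicator_le_norm_self _ z).trans ?_
  rw [norm_smul, Real.norm_eq_abs]
  exact mul_le_mul_of_nonneg_right (hc _) (norm_nonneg _)

/-- At each `z` only the cell of the grid point of `z` can contribute. -/
theorem bumpSum_eq_integral (k : 𝓢(R3, ℝ)) (ψ : 𝓢(R3, E)) (ρ : ℝ) (j : ℕ) (x : R3) :
    bumpSum k (fun y : (grid j).range => (y : R3)) (fun y => ∫ z in cell ρ j y, ψ z) x
      = ∫ z, discIntegrand k ψ ρ j x z := by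
  rw [bumpSum_apply]
  have h1 : ∀ y : (grid j).range, k (x - y) • ∫ z in cell ρ j y, ψ z
      = ∫ z, (cell ρ j y).indicator (fun z => k (x - y) • ψ z) z := by
    intro y
    rw [integral_indicator (measurableSet_cell ρ j y), integral_smul]
  rw [Finset.sum_congr rfl fun y _ => h1 y, ← integral_finsetSum]
  · refine integral_congr_ae (Eventually.of_forall fun z => ?_)
    change ∑ y : (grid j).range, (cell ρ j y).indicator (fun z => k (x - y) • ψ z) z = _
    rw [Finset.sum_eq_single (⟨grid j z, (grid j).mem_range_self z⟩ : (grid j).range)]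
    · by_cases hz : ‖grid j z - z‖ < ρ
      · rw [discIntegrand, Set.indicator_of_mem (show z ∈ {z | ‖grid j z - z‖ < ρ} from hz),
          Set.indicator_of_mem
            (show z ∈ cell ρ j ⟨grid j z, (grid j).mem_range_self z⟩ from ⟨rfl, hz⟩)]
      · rw [discIntegrand, Set.indicator_of_notMem (show z ∉ {z | ‖grid j z - z‖ < ρ} from hz),
          Set.indicator_of_notMem fun h => hz h.2]
    · intro y _ hy
      exact Set.indicator_of_notMem (fun h => hy (Subtype.ext h.1.symm)) _
    · exact fun h => absurd (Finset.mem_univ _) h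
  · intro y _
    exact (ψ.integrable.smul (k (x - y))).indicator (measurableSet_cell ρ j y)

theorem tendsto_integral_discIntegrand (k : 𝓢(R3, ℝ)) (ψ : 𝓢(R3, E)) {ρ : ℝ} (hρ : 0 < ρ) (x : R3) :
    Tendsto (fun j => ∫ z, discIntegrand k ψ ρ j x z) atTop (𝓝 (∫ z, k (x - z) • ψ z)) := by
  obtain ⟨c, -, hc⟩ := exists_norm_le k
  refine tendsto_integral_of_dominated_convergence (fun z => c * ‖ψ z‖)
    (fun j => aestronglyMeasurable_discIntegrand k ψ ρ j x) (ψ.integrable.norm.const_mul c)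
    (fun j => Eventually.of_forall fun z => norm_discIntegrand_le hc ψ ρ j x z)
    (Eventually.of_forall fun z => ?_)
  have h1 := tendsto_grid z
  have h2 : ∀ᶠ j in atTop, ‖grid j z - z‖ < ρ := by
    have := (tendsto_iff_norm_sub_tendsto_zero.1 h1).eventually (gt_mem_nhds hρ)
    exact this
  have h3 : Tendsto (fun j => k (x - grid j z) • ψ z) atTop (𝓝 (k (x - z) • ψ z)) :=
    ((k.continuous.tendsto _).comp (tendsto_const_nhds.sub h1)).smul_const _
  refine h3.congr' ?_
  filter_upwards [h2] with j hj
  rw [discIntegrand, Set.indicator_of_mem (show z ∈ {z | ‖grid j z - z‖ < ρ} from hj)]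

/-- Only `z` within `2ρ ≤ 2` of `x` matter: `ρ` for the support of `k` and `ρ` for the size of the
cells. On that scale the brackets at `x` and `z` are comparable. This is a majorant uniform in `j`.
-/
theorem norm_integral_discIntegrand_le {k : 𝓢(R3, ℝ)} {c : ℝ} (hc : ∀ x, |k x| ≤ c) {ρ : ℝ}
    (hρ : ρ ≤ 1) (hk : ∀ x, ρ ≤ ‖x‖ → k x = 0) {ψ : 𝓢(R3, E)} {A : ℝ}
    (hA : ∀ x, (1 + ‖x‖ ^ 2) * ‖ψ x‖ ≤ A) (j : ℕ) (x : R3) :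
    ‖∫ z, discIntegrand k ψ ρ j x z‖
      ≤ volume.real (Metric.closedBall (0 : R3) 2) * (9 * A * c) * (1 + ‖x‖ ^ 2)⁻¹ := by
  have hc0 : 0 ≤ c := (abs_nonneg _).trans (hc 0)
  have hA0 : 0 ≤ A := le_trans (by positivity) (hA 0)
  have h1 : ∀ z, ‖discIntegrand k ψ ρ j x z‖
      ≤ (Metric.closedBall x 2).indicator (fun _ => 9 * A * c * (1 + ‖x‖ ^ 2)⁻¹) z := by
    intro z
    by_cases hz : z ∈ Metric.closedBall x 2
    · rw [Set.indicator_of_mem hz]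
      refine (norm_discIntegrand_le hc ψ ρ j x z).trans ?_
      have h2 := one_add_norm_sq_le (x := x) (z := z) (by rwa [mem_closedBall_iff_norm'] at hz)
      have h3 : ‖ψ z‖ ≤ 9 * A * (1 + ‖x‖ ^ 2)⁻¹ := by
        rw [← div_eq_mul_inv, le_div_iff₀ (by positivity)]
        nlinarith [hA z, norm_nonneg (ψ z)]
      calc c * ‖ψ z‖ ≤ c * (9 * A * (1 + ‖x‖ ^ 2)⁻¹) := by gcongr
        _ = _ := by ring
    · rw [Set.indicator_of_notMem hz, discIntegrand]
      by_cases h2 : ‖grid j z - z‖ < ρ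
      · rw [Set.indicator_of_mem (show z ∈ {z | ‖grid j z - z‖ < ρ} from h2), hk, zero_smul,
          norm_zero]
        rw [mem_closedBall_iff_norm', not_le] at hz
        have := norm_sub_le_norm_sub_add_norm_sub x (grid j z) z
        linarith
      · rw [Set.indicator_of_notMem (show z ∉ {z | ‖grid j z - z‖ < ρ} from h2), norm_zero]
  refine (norm_integral_le_of_norm_le ?_ (Eventually.of_forall h1)).trans (le_of_eq ?_)
  · exact (integrable_indicator_iff measurableSet_closedBall).2
      (integrableOn_const measure_closedBall_lt_top.ne)
  · rw [integral_indicator measurableSet_closedBall, setIntegral_const, smul_eq_mul,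
      Measure.addHaar_real_closedBall_center]
    ring

theorem memLp_bracket_sq : Integrable fun x : R3 => ((1 + ‖x‖ ^ 2)⁻¹) ^ 2 :=
  (memLp_two_iff_integrable_sq memLp_bracket.1).1 memLp_bracket

/-- As the partition is refined, the discretised convolutions converge to the convolution. -/
theorem tendsto_l2norm_bumpSum_sub {k : 𝓢(R3, ℝ)} {ρ : ℝ} (hρ : 0 < ρ) (hρ1 : ρ ≤ 1)
    (hk : ∀ x, ρ ≤ ‖x‖ → k x = 0) (ψ θ : 𝓢(R3, E)) {A : ℝ}
    (hA : ∀ x, (1 + ‖x‖ ^ 2) * ‖ψ x‖ ≤ A) (hA' : ∀ x, (1 + ‖x‖ ^ 2) * ‖θ x‖ ≤ A) :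
    Tendsto (fun j => l2norm (bumpSum k (fun y : (grid j).range => (y : R3))
      (fun y => ∫ z in cell ρ j y, ψ z) - θ) ^ 2) atTop
      (𝓝 (∫ x, ‖(∫ z, k (x - z) • ψ z) - θ x‖ ^ 2)) := by
  obtain ⟨c, hc0, hc⟩ := exists_norm_le k
  simp only [l2norm_sq, sub_apply, bumpSum_eq_integral]
  set B := volume.real (Metric.closedBall (0 : R3) 2) * (9 * A * c) + A with hB
  refine tendsto_integral_of_dominated_convergence (fun x => B ^ 2 * ((1 + ‖x‖ ^ 2)⁻¹) ^ 2)
    (fun j => ?_) (memLp_bracket_sq.const_mul _) (fun j => Eventually.of_forall fun x => ?_)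
    (Eventually.of_forall fun x => ?_)
  · have h : (fun x => ‖(∫ z, discIntegrand k ψ ρ j x z) - θ x‖ ^ 2)
        = fun x => ‖bumpSum k (fun y : (grid j).range => (y : R3))
          (fun y => ∫ z in cell ρ j y, ψ z) x - θ x‖ ^ 2 := by
      funext x
      rw [bumpSum_eq_integral]
    rw [h]
    exact (((bumpSum k (fun y : (grid j).range => (y : R3))
      (fun y => ∫ z in cell ρ j y, ψ z)).continuous.sub θ.continuous).norm.pow
        2).aestronglyMeasurable
  · rw [Real.norm_of_nonneg (sq_nonneg _), ← mul_pow]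
    refine pow_le_pow_left₀ (norm_nonneg _) ((norm_sub_le _ _).trans ?_) 2
    rw [hB, add_mul]
    refine add_le_add (norm_integral_discIntegrand_le hc hρ1 hk hA j x) ?_
    rw [← div_eq_mul_inv, le_div_iff₀ (by positivity), mul_comm]
    exact hA' x
  · exact (((tendsto_integral_discIntegrand k ψ hρ x).sub_const _).norm).pow 2

theorem integral_sq_mollify_sub_le {ρ : ℝ} (hρ : 0 < ρ) (hρ1 : ρ ≤ 1) {b : 𝓢(R3, ℝ)}
    (hb : IsMollifier ρ b) (ψ : 𝓢(R3, E)) {A : ℝ}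
    (hA : ∀ x, (1 + ‖x‖ ^ 2) * ‖fderiv ℝ ψ x‖ ≤ A) :
    ∫ x, ‖(∫ z, b (x - z) • ψ z) - ψ x‖ ^ 2
      ≤ (9 * A * ρ) ^ 2 * ∫ x : R3, ((1 + ‖x‖ ^ 2)⁻¹) ^ 2 := by
  rw [← integral_const_mul]
  refine integral_mono_of_nonneg (Eventually.of_forall fun x => sq_nonneg _)
    (memLp_bracket_sq.const_mul _) (Eventually.of_forall fun x => ?_)
  change _ ≤ (9 * A * ρ) ^ 2 * ((1 + ‖x‖ ^ 2)⁻¹) ^ 2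
  rw [← mul_pow]
  exact pow_le_pow_left₀ (norm_nonneg _) (hb.norm_integral_smul_sub_le hρ hρ1 ψ hA x) 2

theorem exists_bracket_bound (ψ : 𝓢(R3, E)) : ∃ A, ∀ x, (1 + ‖x‖ ^ 2) * ‖ψ x‖ ≤ A := by
  obtain ⟨a, -, ha⟩ := ψ.decay 0 0
  obtain ⟨a', -, ha'⟩ := ψ.decay 2 0
  refine ⟨a + a', fun x => ?_⟩
  have h1 := ha x
  have h2 := ha' x
  simp only [pow_zero, one_mul, norm_iteratedFDeriv_zero] at h1 h2
  linarith

theorem exists_bracket_bound_fderiv (ψ : 𝓢(R3, E)) :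
    ∃ A, ∀ x, (1 + ‖x‖ ^ 2) * ‖fderiv ℝ ψ x‖ ≤ A := by
  obtain ⟨a, -, ha⟩ := ψ.decay 0 1
  obtain ⟨a', -, ha'⟩ := ψ.decay 2 1
  refine ⟨a + a', fun x => ?_⟩
  have h1 := ha x
  have h2 := ha' x
  simp only [pow_zero, one_mul, norm_iteratedFDeriv_one] at h1 h2
  linarith

/-- Discretised mollifications approximate a Schwartz function and its first derivatives. -/
theorem exists_bumpSum_approx (ψ : 𝓢(R3, E)) {ε : ℝ} (hε : 0 < ε) :
    ∃ (ρ : ℝ) (b : 𝓢(R3, ℝ)) (j : ℕ), 0 < ρ ∧ IsMollifier ρ b ∧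
      l2norm (bumpSum b (fun y : (grid j).range => (y : R3))
        (fun y => ∫ z in cell ρ j y, ψ z) - ψ) < ε ∧
      ∀ i, l2norm (∂_{coordVec i} (bumpSum b (fun y : (grid j).range => (y : R3))
        (fun y => ∫ z in cell ρ j y, ψ z) - ψ)) < ε := by
  obtain ⟨A, hA⟩ := exists_bracket_bound ψ
  obtain ⟨A', hA'⟩ := exists_bracket_bound_fderiv ψ
  choose D hD using fun i => exists_bracket_bound (∂_{coordVec i} ψ : 𝓢(R3, E))
  choose D' hD' using fun i => exists_bracket_bound_fderiv (∂_{coordVec i} ψ : 𝓢(R3, E))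
  set J := ∫ x : R3, ((1 + ‖x‖ ^ 2)⁻¹) ^ 2 with hJ
  have hsmall : ∀ a : ℝ, ∀ᶠ ρ in 𝓝[>] (0 : ℝ), (9 * a * ρ) ^ 2 * J < ε ^ 2 := by
    intro a
    have hc : Tendsto (fun ρ : ℝ => (9 * a * ρ) ^ 2 * J) (𝓝[>] 0) (𝓝 ((9 * a * 0) ^ 2 * J)) :=
      (Continuous.tendsto (by fun_prop) 0).mono_left nhdsWithin_le_nhds
    refine hc.eventually (gt_mem_nhds ?_)
    rw [mul_zero, zero_pow two_ne_zero, zero_mul]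
    positivity
  have hρ1 : ∀ᶠ ρ in 𝓝[>] (0 : ℝ), ρ ≤ 1 :=
    nhdsWithin_le_nhds (Iic_mem_nhds one_pos)
  obtain ⟨ρ, ⟨⟨h1, h2⟩, h3⟩, hρ⟩ := (((hsmall A').and (eventually_all.2 fun i => hsmall (D' i))).and
    hρ1 |>.and self_mem_nhdsWithin).exists
  obtain ⟨b, hb⟩ := exists_isMollifier hρ
  have hdz : ∀ m x : R3, ρ ≤ ‖x‖ → (∂_{m} b : 𝓢(R3, ℝ)) x = 0 := by
    intro m x hx
    have hcl : IsClosed (Metric.ball (0 : R3) ρ)ᶜ := Metric.isOpen_ball.isClosed_compl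
    rw [SchwartzMap.lineDerivOp_apply_eq_fderiv]
    -- A zero of the nonnegative function `b` is a minimum, so the derivative vanishes there,
    -- including on the boundary sphere.
    have hmin : IsLocalMin b x := Eventually.of_forall fun y => by
      rw [hb.eq_zero x hx]
      exact hb.nonneg y
    rw [hmin.fderiv_eq_zero]
    rfl
  have t0 := tendsto_l2norm_bumpSum_sub hρ h3 hb.eq_zero ψ ψ hA hA
  have e0 := t0.eventually (gt_mem_nhds ((integral_sq_mollify_sub_le hρ h3 hb ψ hA').trans_lt h1))
  have e1 : ∀ i, ∀ᶠ j in atTop, l2norm (bumpSum (∂_{coordVec i} b : 𝓢(R3, ℝ))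
      (fun y : (grid j).range => (y : R3)) (fun y => ∫ z in cell ρ j y, ψ z)
        - (∂_{coordVec i} ψ : 𝓢(R3, E))) ^ 2 < ε ^ 2 := by
    intro i
    have t1 := tendsto_l2norm_bumpSum_sub hρ h3 (hdz (coordVec i)) ψ (∂_{coordVec i} ψ : 𝓢(R3, E))
      (A := max A (D i)) (fun x => (hA x).trans (le_max_left _ _))
      (fun x => (hD i x).trans (le_max_right _ _))
    refine t1.eventually (gt_mem_nhds ?_)
    simp only [hb.integral_lineDeriv_smul]
    exact (integral_sq_mollify_sub_le hρ h3 hb _ (hD' i)).trans_lt (h2 i)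
  obtain ⟨j, hj0, hj1⟩ := (e0.and (eventually_all.2 e1)).exists
  refine ⟨ρ, b, j, hρ, hb, lt_of_pow_lt_pow_left₀ 2 hε.le hj0, fun i => ?_⟩
  have hsub : (∂_{coordVec i} (bumpSum b (fun y : (grid j).range => (y : R3))
      (fun y => ∫ z in cell ρ j y, ψ z) - ψ) : 𝓢(R3, E))
      = bumpSum (∂_{coordVec i} b : 𝓢(R3, ℝ)) (fun y : (grid j).range => (y : R3))
        (fun y => ∫ z in cell ρ j y, ψ z) - ∂_{coordVec i} ψ := by
    rw [← lineDeriv_bumpSum]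
    exact map_sub (lineDerivOpCLM ℝ 𝓢(R3, E) (coordVec i)) _ _
  rw [hsub]
  exact lt_of_pow_lt_pow_left₀ 2 hε.le (hj1 i)

end Discretisation

end ClosedSystem

end

noncomputable section

namespace ClosedSystem

open LineDeriv

/-! ### Approximation of the initial state by finite sums of product states -/

/-! ### Norms of bump sums in terms of their coefficients. -/

section Bounds

variable {E : Type*} [NormedAddCommGroup E] [InnerProductSpace ℂ E] [CompleteSpace E]
  {ι : Type*} [Fintype ι]

theorem norm_bumpSum_apply_le {ρ : ℝ} {b : 𝓢(R3, ℝ)} (hb : IsMollifier ρ b) (y : ι → R3)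
    (g : ι → E) (x : R3) : ‖bumpSum b y g x‖ ≤ ∑ i, b (x - y i) * ‖g i‖ := by
  rw [bumpSum_apply]
  refine norm_sum_le_of_le _ fun i _ => ?_
  rw [norm_smul, Real.norm_of_nonneg (hb.nonneg _)]

theorem integral_norm_bumpSum_le {ρ : ℝ} {b : 𝓢(R3, ℝ)} (hb : IsMollifier ρ b) (y : ι → R3)
    (g : ι → E) : ∫ x, ‖bumpSum b y g x‖ ≤ ∑ i, ‖g i‖ := by
  have hi : ∀ i, Integrable fun x => b (x - y i) * ‖g i‖ := fun i =>
    (b.integrable.comp_sub_right (y i)).mul_const _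
  refine (integral_mono_of_nonneg (Eventually.of_forall fun x => norm_nonneg _)
    (integrable_finsetSum _ fun i _ => hi i)
    (Eventually.of_forall (norm_bumpSum_apply_le hb y g))).trans_eq ?_
  rw [integral_finsetSum _ fun i _ => hi i]
  refine Finset.sum_congr rfl fun i _ => ?_
  rw [integral_mul_const, integral_sub_right_eq_self (fun x => b x), hb.integral_eq_one, one_mul]

/-- The cells whose bump reaches `x` are disjoint subsets of the ball of radius `2ρ` about `x`, and
`b` is at most `64` over the volume of that ball. -/
theorem IsMollifier.sum_mul_volume_le {ρ : ℝ} (hρ : 0 < ρ) {b : 𝓢(R3, ℝ)} (hb : IsMollifier ρ b)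
    {y : ι → R3} {Q : ι → Set R3} (hQ : ∀ i, MeasurableSet (Q i))
    (hQy : ∀ i, Q i ⊆ Metric.closedBall (y i) ρ) (hdisj : Pairwise (Function.onFun Disjoint Q))
    (x : R3) : ∑ i, b (x - y i) * volume.real (Q i) ≤ 64 := by
  classical
  set M := volume.real (Metric.closedBall (0 : R3) (2 * ρ)) with hM
  have hM0 : 0 < M := ENNReal.toReal_pos
    (Metric.measure_closedBall_pos _ _ (by positivity)).ne' measure_closedBall_lt_top.ne
  set s := Finset.univ.filter fun i => b (x - y i) ≠ 0 with hs
  have h1 : ∑ i ∈ s, volume.real (Q i) ≤ M := by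
    rw [← measureReal_biUnion_finset (fun i _ j _ h => hdisj h) (fun i _ => hQ i)
      (fun i _ => ((measure_mono (hQy i)).trans_lt measure_closedBall_lt_top).ne), hM,
      ← Measure.addHaar_real_closedBall_center volume x]
    refine measureReal_mono (Set.iUnion₂_subset fun i hi => ?_) measure_closedBall_lt_top.ne
    refine (hQy i).trans (Metric.closedBall_subset_closedBall' ?_)
    have h2 : ‖x - y i‖ < ρ := by
      by_contra h
      exact (Finset.mem_filter.1 hi).2 (hb.eq_zero _ (not_lt.1 h))
    rw [dist_comm, dist_eq_norm]
    linarith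
  calc ∑ i, b (x - y i) * volume.real (Q i) = ∑ i ∈ s, b (x - y i) * volume.real (Q i) := by
        refine (Finset.sum_subset (Finset.filter_subset _ _) fun i _ hi => ?_).symm
        have : b (x - y i) = 0 := by
          by_contra h
          exact hi (Finset.mem_filter.2 ⟨Finset.mem_univ i, h⟩)
        rw [this, zero_mul]
    _ ≤ ∑ i ∈ s, 64 / M * volume.real (Q i) := by
        refine Finset.sum_le_sum fun i _ => mul_le_mul_of_nonneg_right ?_ measureReal_nonneg
        rw [le_div_iff₀ hM0]
        exact hb.mul_volume_le _
    _ = 64 / M * ∑ i ∈ s, volume.real (Q i) := by rw [Finset.mul_sum]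
    _ ≤ 64 / M * M := by gcongr
    _ = 64 := by field_simp

/-- Cauchy–Schwarz with the weights `b(x - yᵢ)|Qᵢ|`, whose sum is at most `64` irrespective of the
fineness of the partition. -/
theorem l2norm_bumpSum_sq_le {ρ : ℝ} (hρ : 0 < ρ) {b : 𝓢(R3, ℝ)} (hb : IsMollifier ρ b)
    {y : ι → R3} {Q : ι → Set R3} (hQ : ∀ i, MeasurableSet (Q i))
    (hQy : ∀ i, Q i ⊆ Metric.closedBall (y i) ρ) (hdisj : Pairwise (Function.onFun Disjoint Q))
    {g : ι → E} (hg : ∀ i, volume.real (Q i) = 0 → g i = 0) :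
    l2norm (bumpSum b y g) ^ 2 ≤ 64 * ∑ i, (volume.real (Q i))⁻¹ * ‖g i‖ ^ 2 := by
  have hi : ∀ i, Integrable fun x => b (x - y i) * ((volume.real (Q i))⁻¹ * ‖g i‖ ^ 2) := fun i =>
    (b.integrable.comp_sub_right (y i)).mul_const _
  have hpt : ∀ x, ‖bumpSum b y g x‖ ^ 2
      ≤ 64 * ∑ i, b (x - y i) * ((volume.real (Q i))⁻¹ * ‖g i‖ ^ 2) := by
    intro x
    have h0 : ∀ i, 0 ≤ b (x - y i) * ((volume.real (Q i))⁻¹ * ‖g i‖ ^ 2) := fun i =>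
      mul_nonneg (hb.nonneg _) (mul_nonneg (inv_nonneg.2 measureReal_nonneg) (sq_nonneg _))
    calc ‖bumpSum b y g x‖ ^ 2 ≤ (∑ i, b (x - y i) * ‖g i‖) ^ 2 :=
          pow_le_pow_left₀ (norm_nonneg _) (norm_bumpSum_apply_le hb y g x) 2
      _ ≤ (∑ i, b (x - y i) * volume.real (Q i)) *
          ∑ i, b (x - y i) * ((volume.real (Q i))⁻¹ * ‖g i‖ ^ 2) := by
          refine Finset.sum_sq_le_sum_mul_sum_of_sq_le_mul _
            (fun i _ => mul_nonneg (hb.nonneg _) measureReal_nonneg) (fun i _ => h0 i)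
            fun i _ => le_of_eq ?_
          by_cases h : volume.real (Q i) = 0
          · rw [hg i h, h]
            simp
          · field_simp
      _ ≤ _ := mul_le_mul_of_nonneg_right (hb.sum_mul_volume_le hρ hQ hQy hdisj x)
          (Finset.sum_nonneg fun i _ => h0 i)
  rw [l2norm_sq]
  refine (integral_mono_of_nonneg (Eventually.of_forall fun x => sq_nonneg _)
    ((integrable_finsetSum _ fun i _ => hi i).const_mul 64)
    (Eventually.of_forall hpt)).trans_eq ?_
  rw [integral_const_mul, integral_finsetSum _ fun i _ => hi i]
  congr 1
  refine Finset.sum_congr rfl fun i _ => ?_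
  rw [integral_mul_const, integral_sub_right_eq_self (fun x => b x), hb.integral_eq_one, one_mul]

theorem l2norm_bumpSum_le (k : 𝓢(R3, ℝ)) (y : ι → R3) (g : ι → E) :
    l2norm (bumpSum k y g) ≤ ∑ i, ‖g i‖ *
      l2norm ((k.compSubConstCLM ℝ (y i)).postcompCLM Complex.ofRealCLM) := by
  refine (l2norm_sum_le _ _).trans (Finset.sum_le_sum fun i _ => ?_)
  have h1 : ‖g i‖ * l2norm ((k.compSubConstCLM ℝ (y i)).postcompCLM Complex.ofRealCLM)
      = l2norm ((‖g i‖ : ℂ) • (k.compSubConstCLM ℝ (y i)).postcompCLM Complex.ofRealCLM) := by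
    rw [l2norm_smul, Complex.norm_real, norm_norm]
  rw [h1]
  refine l2norm_le_of_norm_le fun x => le_of_eq ?_
  rw [smul_apply, SchwartzMap.postcompCLM_apply, SchwartzMap.postcompCLM_apply,
    ContinuousLinearMap.toSpanSingleton_apply, norm_smul, norm_smul, Complex.norm_real, norm_norm,
    mul_comm, Complex.ofRealCLM_apply, Complex.norm_real]

theorem bumpSum_sub (k : 𝓢(R3, ℝ)) (y : ι → R3) (g g' : ι → E) :
    bumpSum k y g - bumpSum k y g' = bumpSum k y (g - g') := by
  ext x : 1
  rw [sub_apply, bumpSum_apply, bumpSum_apply, bumpSum_apply, ← Finset.sum_sub_distrib]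
  exact Finset.sum_congr rfl fun i _ => by rw [Pi.sub_apply, smul_sub]

theorem tendsto_l2norm_bumpSum {β : Type*} {l : Filter β} (k : 𝓢(R3, ℝ)) (y : ι → R3) {G : β → ι → E}
    {g : ι → E} (hG : ∀ i, Tendsto (fun δ => G δ i) l (𝓝 (g i))) (θ : 𝓢(R3, E)) {ε : ℝ}
    (h : l2norm (bumpSum k y g - θ) < ε) : ∀ᶠ δ in l, l2norm (bumpSum k y (G δ) - θ) < ε := by
  have h1 : Tendsto (fun δ => (∑ i, ‖G δ i - g i‖ *
      l2norm ((k.compSubConstCLM ℝ (y i)).postcompCLM Complex.ofRealCLM))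
        + l2norm (bumpSum k y g - θ)) l (𝓝 (0 + l2norm (bumpSum k y g - θ))) := by
    refine Tendsto.add_const _ ?_
    rw [← Finset.sum_const_zero (s := (Finset.univ : Finset ι))]
    refine tendsto_finsetSum _ fun i _ => ?_
    have := (tendsto_iff_norm_sub_tendsto_zero.1 (hG i)).mul_const
      (l2norm ((k.compSubConstCLM ℝ (y i)).postcompCLM Complex.ofRealCLM))
    rwa [zero_mul] at this
  rw [zero_add] at h1
  filter_upwards [h1.eventually (gt_mem_nhds h)] with δ hδ
  refine lt_of_le_of_lt ?_ hδ
  have h2 : bumpSum k y (G δ) - θ = bumpSum k y (G δ - g) + (bumpSum k y g - θ) := by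
    rw [← bumpSum_sub, sub_add_sub_cancel]
  rw [h2]
  exact (l2norm_add_le _ _).trans (add_le_add_left (l2norm_bumpSum_le k y (G δ - g)) _)

end Bounds

section Approximation

variable {K : Type*} [NormedAddCommGroup K] [InnerProductSpace ℂ K] [CompleteSpace K]

/-- The wave functions of `P` in the decomposition of `bumpSum b y g` into product states. -/
def bumpSpin {ι : Type*} (b : 𝓢(R3, ℝ)) (y : ι → R3) (p : ι × Fin 2) : 𝓢(R3, Spin) :=
  (b.compSubConstCLM ℝ (y p.1)).postcompCLM
    (ContinuousLinearMap.toSpanSingleton ℝ (EuclideanSpace.single p.2 (1 : ℂ) : Spin))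

theorem prodS_bumpSpin {ι : Type*} [Fintype ι] (b : 𝓢(R3, ℝ)) (y : ι → R3) (g : ι × Fin 2 → K) :
    prodS Finset.univ g (bumpSpin b y)
      = bumpSum b y fun i => (WithLp.toLp 2 fun k => g (i, k) : SpinTensor K) := by
  ext x : 1
  rw [prodS_apply, bumpSum_apply, Fintype.sum_prod_type]
  refine Finset.sum_congr rfl fun i _ => ?_
  have h := eq_sum_spinTmul (WithLp.toLp 2 fun k => g (i, k) : SpinTensor K)
  conv_rhs => rw [h, Finset.smul_sum]
  refine Finset.sum_congr rfl fun k _ => ?_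
  exact ((spinTmul (g (i, k))).restrictScalars ℝ).map_smul _ _

theorem ParticleBound.exists_integrable {C₂ : ℝ} {UQ : ℝ → K →L[ℂ] K} {I : Set ℕ}
    {N : ℕ → K →ₗ.[ℂ] K} {ψ : 𝓢(R3, SpinTensor K)} (h : ParticleBound C₂ UQ I N ψ) {n : ℕ}
    (hn : n ∈ I) {t : ℝ} (ht : 0 ≤ t) :
    ∃ F : R3 → SpinTensor K,
      (∀ᵐ x, SpinLift (N n) (spinMap (UQ t) (ψ x)) (F x)) ∧ Integrable F ∧ MemLp F 2 volume ∧
      ∫ x, ‖F x‖ ≤ |C₂| ∧ ∫ x, ‖F x‖ ^ 2 ≤ |C₂| ^ 2 := by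
  obtain ⟨F, hF, hs⟩ := h t ht n hn
  obtain ⟨h1, h1'⟩ := hs 1 (by simp)
  obtain ⟨h2, h2'⟩ := hs 2 (by simp)
  have hle : ∀ {a : ℝ≥0∞}, a < ENNReal.ofReal C₂ → a.toReal ≤ |C₂| := by
    intro a ha
    refine (ENNReal.toReal_mono ENNReal.ofReal_ne_top ha.le).trans ?_
    rw [ENNReal.toReal_ofReal']
    exact max_le (le_abs_self _) (abs_nonneg _)
  refine ⟨F, hF, memLp_one_iff_integrable.1 h1, h2, ?_, ?_⟩
  · rw [integral_norm_eq_lintegral_enorm h1.1, ← eLpNorm_one_eq_lintegral_enorm]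
    exact hle h1'
  · have h3 : ∫ x, ‖F x‖ ^ 2 = ‖h2.toLp F‖ ^ 2 := by
      rw [norm_sq_eq_integral]
      refine integral_congr_ae ?_
      filter_upwards [h2.coeFn_toLp] with x hx
      rw [hx]
    rw [h3, Lp.norm_toLp]
    exact pow_le_pow_left₀ ENNReal.toReal_nonneg (hle h2') 2

/-- Every initial state can be approximated by finite sums of product states which satisfy the
bound on the number of particles with the same constants. -/
theorem exists_prodS_approx {HQ : K →ₗ.[ℂ] K} {UQ : ℝ → K →L[ℂ] K} (hU : IsUnitaryGroup HQ UQ)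
    {C₂ : ℝ} {I : Set ℕ} {N : ℕ → K →ₗ.[ℂ] K} (hN : ∀ n ∈ I, (N n).IsClosable)
    {ψ : 𝓢(R3, SpinTensor K)} (hψ : ParticleBound C₂ UQ I N ψ) {ε : ℝ} (hε : 0 < ε) :
    ∃ (ι : Type) (_ : Fintype ι) (χ : ι → K) (φ : ι → 𝓢(R3, Spin)), (∀ i, χ i ∈ HQ.domain) ∧
      l2norm (prodS Finset.univ χ φ - ψ) < ε ∧
      (∀ m, l2norm (∂_{coordVec m} (prodS Finset.univ χ φ - ψ)) < ε) ∧
      ∀ s, 0 ≤ s → ∀ n ∈ I, ∀ ζ : ι → K, (∀ i, (UQ s (χ i), ζ i) ∈ (N n).graph) →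
        ∫ x, ‖prodS Finset.univ ζ φ x‖ ≤ 8 * |C₂| ∧
        l2norm (prodS Finset.univ ζ φ) ≤ 8 * |C₂| := by
  obtain ⟨ρ, b, j, hρ, hb, h0, h1⟩ := exists_bumpSum_approx ψ hε
  set y : (grid j).range → R3 := fun y => (y : R3) with hy
  set z : (grid j).range → SpinTensor K := fun y => ∫ x in cell ρ j y, ψ x with hz
  -- The cell integrals need not lie in the domain of `H_Q`; averaging over a short time puts them
  -- there at an arbitrarily small cost, as there are finitely many.
  set G : ℝ → (grid j).range → SpinTensor K := fun δ i =>
    WithLp.toLp 2 fun k => timeAvg UQ δ (z i k) with hG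
  have hGz : ∀ i, Tendsto (fun δ => G δ i) (𝓝[>] 0) (𝓝 (z i)) := by
    intro i
    have h2 : Tendsto (fun δ => fun k => timeAvg UQ δ (z i k)) (𝓝[>] 0) (𝓝 fun k => z i k) :=
      tendsto_pi_nhds.2 fun k => (tendsto_timeAvg hU (z i k)).mono_left
        (nhdsWithin_mono _ fun x hx => ne_of_gt hx)
    exact ((PiLp.continuous_toLp 2 fun _ : Fin 2 => K).tendsto _).comp h2
  have hsub : ∀ g : (grid j).range → SpinTensor K, ∀ m : Fin 3,
      (∂_{coordVec m} (bumpSum b y g - ψ) : 𝓢(R3, SpinTensor K))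
      = bumpSum (∂_{coordVec m} b : 𝓢(R3, ℝ)) y g - ∂_{coordVec m} ψ := by
    intro g m
    rw [← lineDeriv_bumpSum]
    exact map_sub (lineDerivOpCLM ℝ 𝓢(R3, SpinTensor K) (coordVec m)) _ _
  have e0 := tendsto_l2norm_bumpSum b y hGz ψ h0
  have e1 : ∀ m, ∀ᶠ δ in 𝓝[>] (0 : ℝ),
      l2norm (∂_{coordVec m} (bumpSum b y (G δ) - ψ) : 𝓢(R3, SpinTensor K)) < ε := by
    intro m
    have h2 := h1 m
    rw [hsub] at h2
    simp only [hsub]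
    exact tendsto_l2norm_bumpSum _ y hGz _ h2
  obtain ⟨δ, ⟨hd0, hd1⟩, hδ⟩ := ((e0.and (eventually_all.2 e1)).and self_mem_nhdsWithin).exists
  have hprod : prodS Finset.univ (fun p : (grid j).range × Fin 2 => timeAvg UQ δ (z p.1 p.2))
      (bumpSpin b y) = bumpSum b y (G δ) := prodS_bumpSpin b y _
  refine ⟨(grid j).range × Fin 2, inferInstance, fun p => timeAvg UQ δ (z p.1 p.2), bumpSpin b y,
    fun p => timeAvg_mem_domain hU δ _, ?_, ?_, ?_⟩
  · rw [hprod]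
    exact hd0
  · rw [hprod]
    exact hd1
  · intro s hs n hn ζ hζ
    obtain ⟨b1, b2, b3⟩ := particle_bounds hU (hN n hn) ψ.integrable (abs_nonneg C₂)
      (fun t ht => hψ.exists_integrable hn ht) (measurableSet_cell ρ j) (volume_cell_ne_top ρ j)
      (pairwise_disjoint_cell ρ j) (show (0 : ℝ) < δ from hδ) hs
      (g := fun i => (WithLp.toLp 2 fun k => ζ (i, k) : SpinTensor K)) fun i k => hζ (i, k)
    rw [prodS_bumpSpin]
    constructor
    · refine ((integral_norm_bumpSum_le hb y _).trans b1).trans ?_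
      linarith [abs_nonneg C₂]
    -- The factor `8` is the square root of the overlap constant `64`.
    · refine le_of_sq_le_sq ?_ (by positivity)
      refine (l2norm_bumpSum_sq_le hρ hb (measurableSet_cell ρ j) (cell_subset_closedBall ρ j)
        (pairwise_disjoint_cell ρ j) b3).trans ?_
      linarith

end Approximation

end ClosedSystem

end

noncomputable section

namespace ClosedSystem

open LineDeriv

/-! ### Comparison of the exact and the decoupled evolution -/

section Initial

variable {K : Type*} [NormedAddCommGroup K] [InnerProductSpace ℂ K] [CompleteSpace K]

theorem momentumTransform_smul (ψ : 𝓢(R3, SpinTensor K)) (ξ : R3) :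
    momentumTransform ψ ((2 * Real.pi) • ξ) = (2 * Real.pi) ^ (-(3 / 2) : ℝ) • 𝓕 ψ ξ := by
  rw [momentumTransform, SchwartzMap.fourier_coe, Real.fourier_eq']
  congr 1
  refine integral_congr_ae (Eventually.of_forall fun x => ?_)
  change Complex.exp _ • ψ x = Complex.exp _ • ψ x
  congr 2
  rw [real_inner_smul_left, real_inner_comm]
  push_cast
  ring

theorem zero_mem_cone (e : R3) (θ : ℝ) : (0 : R3) ∈ cone e θ := by
  change ‖(0 : R3)‖ * Real.cos θ ≤ ⟪(0 : R3), e⟫_ℝ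
  simp

theorem cone_mono {e : R3} {θ θ' : ℝ} (h : Real.cos θ' ≤ Real.cos θ) : cone e θ ⊆ cone e θ' :=
  fun x hx => (mul_le_mul_of_nonneg_left h (norm_nonneg x)).trans hx

/-- The two Fourier conventions differ by a dilation by `2π` and a nonzero constant, and cones are
invariant under dilations. -/
theorem fourier_eq_zero_off_cone {e : R3} {θ θ' v : ℝ} (h : Real.cos θ' ≤ Real.cos θ)
    {ψ : 𝓢(R3, SpinTensor K)} (hψ : Function.support (momentumTransform ψ) ⊆ truncatedCone e θ v) :
    ∀ ξ ∉ cone e θ', 𝓕 ψ ξ = 0 := by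
  intro ξ hξ
  by_contra h0
  have h1 : (2 * Real.pi) • ξ ∈ truncatedCone e θ v := by
    refine hψ ?_
    rw [Function.mem_support, momentumTransform_smul]
    exact smul_ne_zero (Real.rpow_pos_of_pos (by positivity) _).ne' h0
  exact hξ ((smul_mem_cone (by positivity)).1 (cone_mono h h1.1))

/-- A bound for the weighted suprema of a Schwartz function and of its first derivatives in terms
of the bounds `M` on its seminorms. -/
def schwartzConst (M : ℕ → ℕ → ℝ) : ℝ :=
  |M 0 0| + |M 2 0| + |M 4 0| + |M 6 0| + (|M 0 1| + |M 2 1| + |M 4 1| + |M 6 1|)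

theorem schwartzConst_nonneg (M : ℕ → ℕ → ℝ) : 0 ≤ schwartzConst M := by
  unfold schwartzConst
  positivity

theorem bracket_mul_norm_le {M : ℕ → ℕ → ℝ} {ψ : 𝓢(R3, SpinTensor K)}
    (h : ∀ k l, SchwartzMap.seminorm ℝ k l ψ ≤ M k l) (y : R3) :
    (1 + ‖y‖ ^ 2) * ‖ψ y‖ ≤ schwartzConst M ∧
    (1 + ‖y‖ ^ 2) * (‖y‖ ^ 4 * ‖ψ y‖) ≤ schwartzConst M ∧
    ∀ i, (1 + ‖y‖ ^ 2) * ‖(∂_{coordVec i} ψ : 𝓢(R3, SpinTensor K)) y‖ ≤ schwartzConst M ∧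
      (1 + ‖y‖ ^ 2) * (‖y‖ ^ 4 * ‖(∂_{coordVec i} ψ : 𝓢(R3, SpinTensor K)) y‖)
        ≤ schwartzConst M := by
  have h0 : ∀ k, ‖y‖ ^ k * ‖ψ y‖ ≤ |M k 0| := fun k => by
    have := SchwartzMap.le_seminorm ℝ k 0 ψ y
    rw [norm_iteratedFDeriv_zero] at this
    exact this.trans ((h k 0).trans (le_abs_self _))
  have h1 : ∀ i k, ‖y‖ ^ k * ‖(∂_{coordVec i} ψ : 𝓢(R3, SpinTensor K)) y‖ ≤ |M k 1| := fun i k => by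
    have := SchwartzMap.le_seminorm ℝ k 1 ψ y
    rw [norm_iteratedFDeriv_one] at this
    refine le_trans ?_ (this.trans ((h k 1).trans (le_abs_self _)))
    refine mul_le_mul_of_nonneg_left ?_ (by positivity)
    rw [SchwartzMap.lineDerivOp_apply_eq_fderiv]
    refine (ContinuousLinearMap.le_opNorm _ _).trans_eq ?_
    rw [norm_coordVec, mul_one]
  have hn : ∀ k l, 0 ≤ |M k l| := fun k l => abs_nonneg _
  have hk : ∀ {a c0 c2 c4 c6 : ℝ}, ‖y‖ ^ 0 * a ≤ c0 → ‖y‖ ^ 2 * a ≤ c2 → ‖y‖ ^ 4 * a ≤ c4 →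
      ‖y‖ ^ 6 * a ≤ c6 → (1 + ‖y‖ ^ 2) * a ≤ c0 + c2 ∧ (1 + ‖y‖ ^ 2) * (‖y‖ ^ 4 * a) ≤ c4 + c6 := by
    intro a c0 c2 c4 c6 e0 e2 e4 e6
    rw [pow_zero, one_mul] at e0
    have e7 : ‖y‖ ^ 2 * (‖y‖ ^ 4 * a) = ‖y‖ ^ 6 * a := by ring
    constructor
    · linarith
    · rw [add_mul, e7]
      linarith
  unfold schwartzConst
  refine ⟨?_, ?_, fun i => ⟨?_, ?_⟩⟩
  · linarith [(hk (h0 0) (h0 2) (h0 4) (h0 6)).1, hn 4 0, hn 6 0, hn 0 1, hn 2 1, hn 4 1, hn 6 1]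
  · linarith [(hk (h0 0) (h0 2) (h0 4) (h0 6)).2, hn 0 0, hn 2 0, hn 0 1, hn 2 1, hn 4 1, hn 6 1]
  · linarith [(hk (h1 i 0) (h1 i 2) (h1 i 4) (h1 i 6)).1, hn 0 0, hn 2 0, hn 4 0, hn 6 0, hn 4 1,
      hn 6 1]
  · linarith [(hk (h1 i 0) (h1 i 2) (h1 i 4) (h1 i 6)).2, hn 0 0, hn 2 0, hn 4 0, hn 6 0, hn 0 1,
      hn 2 1]

/-- The difference lives on `|y| > εd`, where one factor `εd ≤ |y| ≤ 1 + |y|⁴` can be gained from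
the decay of `ψ`. -/
theorem l2norm_sub_mulS_initial_le {C : Set R3} {b ε d : ℝ} (hε : 0 < ε) (hd : 0 < d) {f : R3 → ℝ}
    {f₁ f₂ : Fin 3 → R3 → ℝ} (hf : IsCutoff C b ε d f f₁ f₂) {ψ : 𝓢(R3, SpinTensor K)} {A : ℝ}
    (hA0 : ∀ y, (1 + ‖y‖ ^ 2) * ‖ψ y‖ ≤ A) (hA4 : ∀ y, (1 + ‖y‖ ^ 2) * (‖y‖ ^ 4 * ‖ψ y‖) ≤ A) :
    l2norm (ψ - mulS (SpinTensor K) f ψ) ≤ 2 * A * bracketNorm / ε * d⁻¹ := by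
  have hA : 0 ≤ A := le_trans (by positivity) (hA0 0)
  have hεd : 0 < ε * d := mul_pos hε hd
  refine (l2norm_le_bracketNorm (A := 2 * A / (ε * d)) (by positivity) fun y => ?_).trans_eq ?_
  · rw [sub_apply, mulS_apply hf.growth]
    by_cases hy : ‖y‖ ≤ ε * d
    · rw [hf.eq_one y hy, one_smul, sub_self, norm_zero, mul_zero]
      positivity
    rw [not_le] at hy
    have h1 : ‖ψ y - f y • ψ y‖ ≤ ‖ψ y‖ := by
      have h2 : ψ y - f y • ψ y = (1 - f y) • ψ y := by rw [sub_smul, one_smul]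
      rw [h2, norm_smul, Real.norm_of_nonneg (sub_nonneg.2 (hf.le_one y))]
      exact mul_le_of_le_one_left (norm_nonneg _) (by linarith [hf.nonneg y])
    rw [le_div_iff₀ hεd]
    have h3 : ‖y‖ ≤ 1 + ‖y‖ ^ 4 := by
      nlinarith [sq_nonneg (‖y‖ ^ 2 - 1), sq_nonneg (‖y‖ - 1), norm_nonneg y]
    calc (1 + ‖y‖ ^ 2) * ‖ψ y - f y • ψ y‖ * (ε * d)
        ≤ (1 + ‖y‖ ^ 2) * ‖ψ y‖ * (1 + ‖y‖ ^ 4) := by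
          have := hy.le.trans h3
          gcongr
      _ = (1 + ‖y‖ ^ 2) * ‖ψ y‖ + (1 + ‖y‖ ^ 2) * (‖y‖ ^ 4 * ‖ψ y‖) := by ring
      _ ≤ 2 * A := by linarith [hA0 y, hA4 y]
  · field_simp

/-- Differentiation preserves the momentum support, so `ψ` and its three derivatives all have small
substitutes off `C`; `24 = 3 · (4 + 4)`. -/
theorem l2norm_commS_freeS_initial_le {C : Set R3} (hC : IsClosed C)
    (hCs : ∀ c : ℝ, 0 < c → ∀ x, c • x ∈ C → x ∈ C) {b ε d : ℝ} (hb : 0 ≤ b) (hd : 0 < d)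
    {f : R3 → ℝ} {f₁ f₂ : Fin 3 → R3 → ℝ} (hf : IsCutoff C b ε d f f₁ f₂)
    {ψ : 𝓢(R3, SpinTensor K)} (hψ : ∀ ξ ∉ C, 𝓕 ψ ξ = 0) {A : ℝ}
    (hA0 : ∀ y, (1 + ‖y‖ ^ 2) * ‖ψ y‖ ≤ A) (hA4 : ∀ y, (1 + ‖y‖ ^ 2) * (‖y‖ ^ 4 * ‖ψ y‖) ≤ A)
    (hD0 : ∀ i y, (1 + ‖y‖ ^ 2) * ‖(∂_{coordVec i} ψ : 𝓢(R3, SpinTensor K)) y‖ ≤ A)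
    (hD4 : ∀ i y, (1 + ‖y‖ ^ 2) *
      (‖y‖ ^ 4 * ‖(∂_{coordVec i} ψ : 𝓢(R3, SpinTensor K)) y‖) ≤ A) {s : ℝ} (hs : 0 ≤ s) :
    l2norm (commS (SpinTensor K) f₁ f₂ (freeS (SpinTensor K) s ψ))
      ≤ 24 * A * bracketNorm * b * d⁻¹ * (1 + s) ^ (-2 : ℝ) := by
  obtain ⟨ψ', h1, h2⟩ := exists_freeS_eq_off_cone_l2norm_le hC hCs hψ hA0 hA4 hs
  choose φ' h3 h4 using fun i => exists_freeS_eq_off_cone_l2norm_le hC hCs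
    (fourier_lineDeriv_eq_zero_off hψ (coordVec i)) (hD0 i) (hD4 i) hs
  have h5 := l2norm_commS_le hf (χ := freeS (SpinTensor K) s ψ')
    (χ₁ := fun i => freeS (SpinTensor K) s (φ' i)) h1 fun i x hx => by
      rw [freeS_lineDeriv]
      exact h3 i x hx
  simp only [l2norm_freeS] at h5
  refine h5.trans ?_
  calc b / d * ∑ i, (l2norm (φ' i) + l2norm ψ')
      ≤ b / d * ∑ _i : Fin 3, (4 * A * bracketNorm * (1 + s) ^ (-2 : ℝ)
        + 4 * A * bracketNorm * (1 + s) ^ (-2 : ℝ)) := by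
        refine mul_le_mul_of_nonneg_left (Finset.sum_le_sum fun i _ => add_le_add (h4 i) h2)
          (by positivity)
    _ = _ := by
        rw [Finset.sum_const, Finset.card_univ, Fintype.card_fin, div_eq_mul_inv]
        ring

/-- Meant for the approximation error, whose momenta are not confined to the cone: there is no decay
in time, only smallness. -/
theorem l2norm_commS_freeS_le {C : Set R3} {b ε d : ℝ} (hb : 0 ≤ b) (hd : 1 ≤ d)
    {f : R3 → ℝ} {f₁ f₂ : Fin 3 → R3 → ℝ} (hf : IsCutoff C b ε d f f₁ f₂)
    {ψ : 𝓢(R3, SpinTensor K)} {ε' : ℝ} (h0 : l2norm ψ ≤ ε')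
    (h1 : ∀ i, l2norm (∂_{coordVec i} ψ : 𝓢(R3, SpinTensor K)) ≤ ε') (s : ℝ) :
    l2norm (commS (SpinTensor K) f₁ f₂ (freeS (SpinTensor K) s ψ)) ≤ 6 * b * ε' := by
  have h2 := l2norm_commS_le hf (χ := freeS (SpinTensor K) s ψ)
    (χ₁ := fun i => freeS (SpinTensor K) s (∂_{coordVec i} ψ)) (fun _ _ => rfl) fun i x _ => by
      rw [freeS_lineDeriv]
  simp only [l2norm_freeS] at h2
  have hε' : 0 ≤ ε' := (l2norm_nonneg ψ).trans h0
  refine h2.trans ?_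
  calc b / d * ∑ i, (l2norm (∂_{coordVec i} ψ : 𝓢(R3, SpinTensor K)) + l2norm ψ)
      ≤ b * ∑ _i : Fin 3, (ε' + ε') := by
        refine mul_le_mul (div_le_self hb hd)
          (Finset.sum_le_sum fun i _ => add_le_add (h1 i) h0)
          (Finset.sum_nonneg fun i _ => add_nonneg (l2norm_nonneg _) (l2norm_nonneg _)) hb
    _ = _ := by
        rw [Finset.sum_const, Finset.card_univ, Fintype.card_fin]
        ring

end Initial

theorem norm_apply_sub_apply_le {E : Type*} [NormedAddCommGroup E] [NormedSpace ℂ E]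
    {A B : E →L[ℂ] E} (hA : ∀ x, ‖A x‖ = ‖x‖) (hB : ∀ x, ‖B x‖ = ‖x‖) (x y : E) :
    ‖A x - B x‖ ≤ 2 * ‖y - x‖ + ‖A y - B y‖ := by
  have h : A x - B x = (B (y - x) - A (y - x)) + (A y - B y) := by
    rw [map_sub, map_sub]
    abel
  rw [h]
  refine (norm_add_le _ _).trans (add_le_add ((norm_sub_le _ _).trans ?_) le_rfl)
  rw [hA, hB, two_mul]

set_option maxHeartbeats 1000000 in
/-- The exact and the decoupled evolution of the initial state are close, uniformly in time. -/
theorem exists_norm_exact_sub_decoupled_le {e : R3} (he : ‖e‖ = 1) {θ₀ : ℝ} (hθ₀ : 0 < θ₀)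
    (hθ₀' : θ₀ < Real.pi / 4) (v : ℝ) {α : ℝ} (hα : 1 < α) (β C₁ C₂ L : ℝ) (M : ℕ → ℕ → ℝ) :
    ∃ c : ℝ, 0 ≤ c ∧ ∀ d : ℝ, 1 ≤ d → 2 * L ≤ d →
      ∀ (K : Type*) [NormedAddCommGroup K] [InnerProductSpace ℂ K] [CompleteSpace K]
        (HQ : K →ₗ.[ℂ] K) (UQ : ℝ → K →L[ℂ] K) (HPQ H : HilbertPQ K →ₗ.[ℂ] HilbertPQ K)
        (U : ℝ → HilbertPQ K →L[ℂ] HilbertPQ K) (Ω : Set R3) (I : Set ℕ) (cube : ℕ → Set R3)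
        (HPQn : ℕ → HilbertPQ K →ₗ.[ℂ] HilbertPQ K) (N : ℕ → K →ₗ.[ℂ] K)
        (Ψ₀ : 𝓢(R3, SpinTensor K)), IsUnitaryGroup HQ UQ → IsHamiltonian HQ HPQ H →
        IsUnitaryGroup H U →
        InteractionAssumption (cone e (2 * θ₀)) α β C₁ L d HQ HPQ Ω I cube HPQn N →
        InitialStateAssumption (truncatedCone e θ₀ v) M Ψ₀ → ParticleBound C₂ UQ I N Ψ₀ →
        ∀ t : ℝ, 0 ≤ t →
          ‖U t (toL2 (SpinTensor K) Ψ₀) - decoupled UQ t (toL2 (SpinTensor K) Ψ₀)‖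
            ≤ c * (d⁻¹ + d ^ (-β)) + Real.sqrt (2 * (c * (d⁻¹ + d ^ (-β)))) := by
  have hpi := Real.pi_pos
  have hcos : 0 ≤ Real.cos (2 * θ₀) :=
    Real.cos_nonneg_of_neg_pi_div_two_le_of_le (by linarith) (by linarith)
  have hcos' : Real.cos (2 * θ₀) < 1 := by
    rw [← Real.cos_zero]
    exact Real.cos_lt_cos_of_nonneg_of_le_pi le_rfl (by linarith) (by linarith)
  have hcos2 : Real.cos (2 * θ₀) ≤ Real.cos θ₀ :=
    Real.cos_le_cos_of_nonneg_of_le_pi hθ₀.le (by linarith) (by linarith)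
  obtain ⟨b, ε, hb, hε, hcut⟩ := exists_isCutoff he hcos hcos'
  have ha : 1 < (1 + α) / 2 := by linarith
  obtain ⟨κ, hκ, hdecay⟩ := exists_integral_weight_freeS_le ha
  set p := decayExponent ((1 + α) / 2) with hp_def
  have hp : 1 < p := one_lt_decayExponent ha
  have hp2 : p ≤ 2 := (min_le_right _ _).trans (by norm_num)
  have hp0 : 0 < p - 1 := by linarith
  set A := schwartzConst M with hA_def
  have hA : 0 ≤ A := schwartzConst_nonneg M
  have hbn : 0 ≤ bracketNorm := ENNReal.toReal_nonneg
  set c₁ := 24 * A * bracketNorm * b with hc₁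
  set c₂ := 4 ^ α * κ * (8 * |C₂|) * |C₁| with hc₂
  have hc₁0 : 0 ≤ c₁ := by positivity
  have hc₂0 : 0 ≤ c₂ := by positivity
  -- Contributions of the initial cut-off, the commutator and the interaction; `1/(p - 1)` is the
  -- integral of `(1 + s)^{-p}`.
  refine ⟨2 * A * bracketNorm / ε + c₁ / (p - 1) + c₂ / (p - 1), by positivity, ?_⟩
  intro d hd hL K _ _ _ HQ UQ HPQ H U Ω I cube HPQn N Ψ₀ hUQ hH hU hI hΨ hN t ht
  have hd0 : 0 < d := by linarith
  obtain ⟨f, f₁, f₂, hf⟩ := hcut d hd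
  have hdβ : 0 ≤ d ^ (-β) := Real.rpow_nonneg hd0.le _
  have hbr := fun y => bracket_mul_norm_le hΨ.seminorm_le y
  have hfour := fourier_eq_zero_off_cone hcos2 hΨ.support_subset
  set a := c₁ * d⁻¹ + c₂ * d ^ (-β) with ha_def
  have ha0 : 0 ≤ a := by positivity
  set r₀ := (2 * A * bracketNorm / ε + c₁ / (p - 1) + c₂ / (p - 1)) * (d⁻¹ + d ^ (-β)) with hr₀
  have hr₀le : 2 * A * bracketNorm / ε * d⁻¹ + a / (p - 1) ≤ r₀ := by
    have h1 : 0 ≤ 2 * A * bracketNorm / ε * d ^ (-β) := by positivity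
    have h2 : 0 ≤ c₁ / (p - 1) * d ^ (-β) := by positivity
    have h3 : 0 ≤ c₂ / (p - 1) * d⁻¹ := by positivity
    have h4 : a / (p - 1) = c₁ / (p - 1) * d⁻¹ + c₂ / (p - 1) * d ^ (-β) := by
      rw [ha_def]
      ring
    rw [h4, hr₀]
    linarith
  have hone : l2norm Ψ₀ = 1 := hΨ.norm_eq_one
  -- The estimate through an approximation of accuracy `ε'`. Its error grows linearly in `t`, which
  -- is harmless since `t` is fixed when `ε'` tends to `0`.
  have key : ∀ ε' : ℝ, 0 < ε' →
      ‖U t (toL2 (SpinTensor K) Ψ₀) - decoupled UQ t (toL2 (SpinTensor K) Ψ₀)‖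
        ≤ 2 * ε' + ((r₀ + ε' * (1 + 6 * b * t))
          + Real.sqrt (2 * (1 + ε') * (r₀ + ε' * (1 + 6 * b * t)))) := by
    intro ε' hε'
    obtain ⟨ι, _, χ, φ, hχ, h0, h1, hB⟩ := exists_prodS_approx hUQ hI.closable hN hε'
    set Φ := prodS Finset.univ χ φ with hΦ
    have hint : ∀ s, 0 ≤ s → ∀ Θ, (toL2 (SpinTensor K) (prodS Finset.univ (fun i => UQ s (χ i))
        fun i => mulS Spin f (freeS Spin s (φ i))), Θ) ∈ HPQ.graph →
        l2norm (commS (SpinTensor K) f₁ f₂ (freeS (SpinTensor K) s Φ)) + ‖Θ‖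
          ≤ a * (1 + s) ^ (-p) + 6 * b * ε' := by
      intro s hs Θ hΘ
      have hdom : ∀ i, UQ s (χ i) ∈ HQ.domain := fun i =>
        LinearPMap.mem_domain_of_mem_graph
          (hUQ.mem_graph (LinearPMap.mem_graph HQ ⟨χ i, hχ i⟩) s)
      have e1 := norm_interaction_le hI ⟨0, zero_mem_cone e _⟩ hα hd hL hf hκ
        (show 0 ≤ 8 * |C₂| by positivity) hs (fun F hF1 hF2 y => hdecay _ F hs hF1 hF2 y)
        Finset.univ hdom φ (fun n hn ζ hζ => hB s hs n hn ζ hζ) hΘ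
      have e2 := l2norm_commS_freeS_initial_le (isClosed_cone e (2 * θ₀))
        (fun c hc x hx => (smul_mem_cone hc).1 hx) hb hd0 hf hfour (fun y => (hbr y).1)
        (fun y => (hbr y).2.1) (fun i y => ((hbr y).2.2 i).1) (fun i y => ((hbr y).2.2 i).2) hs
      have e3 := l2norm_commS_freeS_le hb hd hf h0.le (fun i => (h1 i).le) s
      -- Only `Ψ₀` has momenta in the cone, so decay in time is used for `Ψ₀` and mere smallness for
      -- `Φ - Ψ₀`.
      have e4 : commS (SpinTensor K) f₁ f₂ (freeS (SpinTensor K) s Φ)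
          = commS (SpinTensor K) f₁ f₂ (freeS (SpinTensor K) s Ψ₀)
            + commS (SpinTensor K) f₁ f₂ (freeS (SpinTensor K) s (Φ - Ψ₀)) := by
        rw [map_sub, commS_sub, add_sub_cancel]
      have e5 : (1 + s) ^ (-2 : ℝ) ≤ (1 + s) ^ (-p) :=
        Real.rpow_le_rpow_of_exponent_le (by linarith) (by linarith)
      have e6 : 0 ≤ (1 + s) ^ (-p) := Real.rpow_nonneg (by linarith) _
      have e7 : c₁ * d⁻¹ * (1 + s) ^ (-2 : ℝ) ≤ c₁ * d⁻¹ * (1 + s) ^ (-p) :=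
        mul_le_mul_of_nonneg_left e5 (by positivity)
      have e8 : ‖Θ‖ ≤ c₂ * d ^ (-β) * (1 + s) ^ (-p) := by
        refine e1.trans ?_
        rw [hc₂, mul_assoc (4 ^ α * κ * (8 * |C₂|)) |C₁|]
        have : C₁ * d ^ (-β) ≤ |C₁| * d ^ (-β) := mul_le_mul_of_nonneg_right (le_abs_self _) hdβ
        gcongr
      rw [e4]
      have e9 := l2norm_add_le (commS (SpinTensor K) f₁ f₂ (freeS (SpinTensor K) s Ψ₀))
        (commS (SpinTensor K) f₁ f₂ (freeS (SpinTensor K) s (Φ - Ψ₀)))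
      rw [ha_def, add_mul]
      linarith
    have hfb : ∀ x, |f x| ≤ 1 := fun x => abs_le.2 ⟨by linarith [hf.nonneg x], hf.le_one x⟩
    have hcutΦ : l2norm (Φ - mulS (SpinTensor K) f Φ) ≤ 2 * A * bracketNorm / ε * d⁻¹ + ε' := by
      have g1 := l2norm_sub_mulS_initial_le hε hd0 hf (fun y => (hbr y).1) (fun y => (hbr y).2.1)
      have g2 := l2norm_sub_mulS_sq_le hf.growth hf.nonneg hf.le_one (Φ - Ψ₀)
      have g3 : l2norm (Φ - Ψ₀ - mulS (SpinTensor K) f (Φ - Ψ₀)) ≤ l2norm (Φ - Ψ₀) :=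
        le_of_sq_le_sq (by linarith [sq_nonneg (l2norm (mulS (SpinTensor K) f (Φ - Ψ₀)))])
          (l2norm_nonneg _)
      have g4 : Φ - mulS (SpinTensor K) f Φ = (Ψ₀ - mulS (SpinTensor K) f Ψ₀)
          + (Φ - Ψ₀ - mulS (SpinTensor K) f (Φ - Ψ₀)) := by
        rw [map_sub]
        abel
      rw [g4]
      exact (l2norm_add_le _ _).trans (add_le_add g1 (g3.trans h0.le))
    have hmain := norm_exact_sub_decoupled_le hUQ hH hU hI.le_domain hf Finset.univ hχ φ ha0 hp hint
      ht (r := r₀ + ε' * (1 + 6 * b * t)) (by rw [← hΦ]; linarith)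
    rw [← hΦ] at hmain
    have hnormΦ : l2norm Φ ≤ 1 + ε' := by
      have := l2norm_add_le (Φ - Ψ₀) Ψ₀
      rw [sub_add_cancel, hone] at this
      linarith
    have hr₀' : 0 ≤ r₀ + ε' * (1 + 6 * b * t) := by positivity
    have hdist : ‖toL2 (SpinTensor K) Φ - toL2 (SpinTensor K) Ψ₀‖ ≤ ε' :=
      ((congrArg norm (toL2_sub Φ Ψ₀)).symm.trans (norm_toL2 _)).trans_le h0.le
    refine (norm_apply_sub_apply_le (hU.norm_map t) (norm_decoupled hUQ.norm_map t) _
      (toL2 (SpinTensor K) Φ)).trans (add_le_add ?_ (hmain.trans ?_))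
    · linarith
    · gcongr
  have hlim : Tendsto (fun ε' : ℝ => 2 * ε' + ((r₀ + ε' * (1 + 6 * b * t))
          + Real.sqrt (2 * (1 + ε') * (r₀ + ε' * (1 + 6 * b * t))))) (𝓝[>] 0)
      (𝓝 (2 * 0 + ((r₀ + 0 * (1 + 6 * b * t))
          + Real.sqrt (2 * (1 + 0) * (r₀ + 0 * (1 + 6 * b * t)))))) :=
    (Continuous.tendsto (by fun_prop) 0).mono_left nhdsWithin_le_nhds
  have hfin := ge_of_tendsto hlim (by filter_upwards [self_mem_nhdsWithin] with ε' hε' using key ε' hε')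
  simpa using hfin

theorem norm_inner_sub_inner_le {E : Type*} [NormedAddCommGroup E] [InnerProductSpace ℂ E]
    (T : E →L[ℂ] E) {x y : E} (hx : ‖x‖ = 1) (hy : ‖y‖ = 1) :
    ‖⟪x, T x⟫_ℂ - ⟪y, T y⟫_ℂ‖ ≤ 2 * ‖T‖ * ‖x - y‖ := by
  have h : ⟪x, T x⟫_ℂ - ⟪y, T y⟫_ℂ = ⟪x, T (x - y)⟫_ℂ + ⟪x - y, T y⟫_ℂ := by
    rw [map_sub, inner_sub_right, inner_sub_left]
    ring
  rw [h]
  have h1 : ‖⟪x, T (x - y)⟫_ℂ‖ ≤ ‖T‖ * ‖x - y‖ := by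
    refine (norm_inner_le_norm _ _).trans ?_
    rw [hx, one_mul]
    exact T.le_opNorm _
  have h2 : ‖⟪x - y, T y⟫_ℂ‖ ≤ ‖T‖ * ‖x - y‖ := by
    refine (norm_inner_le_norm _ _).trans ?_
    have := T.le_opNorm y
    rw [hy, mul_one] at this
    rw [mul_comm]
    gcongr
  linarith [norm_add_le ⟪x, T (x - y)⟫_ℂ ⟪x - y, T y⟫_ℂ]

/-- Closeness of the exact and the decoupled evolution gives closeness of the expectations of the
observables of the particle. -/
theorem exists_isTrace_norm_sub_le {K : Type*} [NormedAddCommGroup K] [InnerProductSpace ℂ K]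
    [CompleteSpace K] {UQ : ℝ → K →L[ℂ] K} (hUQ : ∀ t χ, ‖UQ t χ‖ = ‖χ‖) (t : ℝ)
    {Φ Ψ : HilbertPQ K} (hΦ : ‖Φ‖ = 1) (hΨ : ‖Ψ‖ = 1) {η : ℝ}
    (h : ‖Φ - decoupled UQ t Ψ‖ ≤ η / 2) (O : HilbertP →L[ℂ] HilbertP) :
    ∃ τ : ℂ, IsTrace (reducedDensity Ψ ∘L freeEvolution (-t) ∘L O ∘L freeEvolution t) τ ∧
      ‖⟪Φ, amplify O Φ⟫_ℂ - τ‖ ≤ η * ‖O‖ := by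
  refine ⟨_, isTrace_reducedDensity_comp _ _, ?_⟩
  have h2 : ‖decoupled UQ t Ψ‖ = 1 := (norm_decoupled hUQ t Ψ).trans hΨ
  have h3 := norm_inner_sub_inner_le (E := HilbertPQ K) (amplify O) hΦ h2
  rw [inner_decoupled_amplify hUQ] at h3
  refine h3.trans ?_
  have h1 : 2 * ‖amplify (K := K) O‖ ≤ 2 * ‖O‖ :=
    mul_le_mul_of_nonneg_left (norm_amplify_le O) zero_le_two
  refine (mul_le_mul h1 h (norm_nonneg _) (by positivity)).trans_eq ?_
  ring

theorem exists_forall_gt_add_sqrt_le {c β η : ℝ} (hβ : 0 < β) (hη : 0 < η) (L : ℝ) :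
    ∃ d₀ : ℝ, 0 < d₀ ∧ ∀ d, d₀ < d → 1 ≤ d ∧ 2 * L ≤ d ∧
      c * (d⁻¹ + d ^ (-β)) + Real.sqrt (2 * (c * (d⁻¹ + d ^ (-β)))) ≤ η := by
  have h1 : Tendsto (fun d : ℝ => c * (d⁻¹ + d ^ (-β))) atTop (𝓝 (c * (0 + 0))) :=
    (tendsto_inv_atTop_zero.add (tendsto_rpow_neg_atTop hβ)).const_mul c
  have h2 : Tendsto (fun d : ℝ => c * (d⁻¹ + d ^ (-β)) + Real.sqrt (2 * (c * (d⁻¹ + d ^ (-β)))))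
      atTop (𝓝 (c * (0 + 0) + Real.sqrt (2 * (c * (0 + 0))))) :=
    h1.add ((Real.continuous_sqrt.tendsto _).comp (h1.const_mul 2))
  have h3 := h2.eventually_lt_const (u := η) (by simpa using hη)
  obtain ⟨d₀, hd₀⟩ := eventually_atTop.1
    (h3.and ((eventually_ge_atTop 1).and (eventually_ge_atTop (2 * L))))
  refine ⟨max d₀ 1, by positivity, fun d hd => ?_⟩
  obtain ⟨h4, h5, h6⟩ := hd₀ d ((le_max_left _ _).trans hd.le)
  exact ⟨h5, h6, h4.le⟩

end ClosedSystem

end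

theorem lemma1p1
    (e : ClosedSystem.R3) (he : ‖e‖ = 1) (θ₀ : ℝ) (hθ₀ : 0 < θ₀) (hθ₀' : θ₀ < Real.pi / 4)
    (v : ℝ) (hv : 0 < v) (α : ℝ) (hα : 1 < α) (β : ℝ) (hβ : 0 < β) (C₁ C₂ L : ℝ)
    (M : ℕ → ℕ → ℝ) (η : ℝ) (hη : 0 < η) :
    ∃ d₀ : ℝ, 0 < d₀ ∧ ∀ d : ℝ, d₀ < d →
      ∀ (K : Type*) [NormedAddCommGroup K] [InnerProductSpace ℂ K] [CompleteSpace K]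
        [TopologicalSpace.SeparableSpace K]
        (HQ : K →ₗ.[ℂ] K) (UQ : ℝ → K →L[ℂ] K)
        (HPQ H : ClosedSystem.HilbertPQ K →ₗ.[ℂ] ClosedSystem.HilbertPQ K)
        (U : ℝ → ClosedSystem.HilbertPQ K →L[ℂ] ClosedSystem.HilbertPQ K)
        (Ω : Set ClosedSystem.R3) (I : Set ℕ) (cube : ℕ → Set ClosedSystem.R3)
        (HPQn : ℕ → ClosedSystem.HilbertPQ K →ₗ.[ℂ] ClosedSystem.HilbertPQ K)
        (N : ℕ → K →ₗ.[ℂ] K) (Ψ₀ : 𝓢(ClosedSystem.R3, ClosedSystem.SpinTensor K)),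
        IsSelfAdjoint HQ →
        ClosedSystem.IsUnitaryGroup HQ UQ →
        ClosedSystem.IsHamiltonian HQ HPQ H →
        ClosedSystem.IsUnitaryGroup H U →
        ClosedSystem.InteractionAssumption (ClosedSystem.cone e (2 * θ₀)) α β C₁ L d
          HQ HPQ Ω I cube HPQn N →
        ClosedSystem.InitialStateAssumption (ClosedSystem.truncatedCone e θ₀ v) M Ψ₀ →
        ClosedSystem.ParticleBound C₂ UQ I N Ψ₀ →
        ∀ (O : ClosedSystem.HilbertP →L[ℂ] ClosedSystem.HilbertP) (t : ℝ), 0 ≤ t →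
          ∃ τ : ℂ,
            ClosedSystem.IsTrace
              (ClosedSystem.reducedDensity (Ψ₀.toLp 2 volume) ∘L
                ClosedSystem.freeEvolution (-t) ∘L O ∘L ClosedSystem.freeEvolution t) τ ∧
            ‖⟪U t (Ψ₀.toLp 2 volume),
                ClosedSystem.amplify O (U t (Ψ₀.toLp 2 volume))⟫_ℂ - τ‖ ≤ η * ‖O‖ := by
  obtain ⟨c, -, hc⟩ := ClosedSystem.exists_norm_exact_sub_decoupled_le he hθ₀ hθ₀' v hα β C₁ C₂ L M
  -- Half of `η`, because an expectation value changes by at most `2‖O‖` times the distance of the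
  -- unit vectors.
  obtain ⟨d₀, hd₀, hd⟩ := ClosedSystem.exists_forall_gt_add_sqrt_le (c := c) hβ (half_pos hη) L
  refine ⟨d₀, hd₀, ?_⟩
  intro d hdd K _ _ _ _ HQ UQ HPQ H U Ω I cube HPQn N Ψ₀ _ hUQ hH hU hI hΨ hN O t ht
  obtain ⟨h1, h2, h3⟩ := hd d hdd
  exact ClosedSystem.exists_isTrace_norm_sub_le hUQ.norm_map t
    ((hU.norm_map t _).trans hΨ.norm_eq_one) hΨ.norm_eq_one
    ((hc d h1 h2 K HQ UQ HPQ H U Ω I cube HPQn N Ψ₀ hUQ hH hU hI hΨ hN t ht).trans h3) O
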